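/- **Network and model.** For every $N$ let $E=(E_{ij})$ be the (nonrandom) adjacency matrix of a network on $N$ units: $E_{ij}\in\{0,1\}$, $E_{ij}=E_{ji}$, $E_{ii}=1$. Put $n_i=\sum_{j\ne i}E_{ij}$ and assume $n_i>0$ for all $i$ (for $N\ge 2$). For a vector $v\in\mathbb R^N$ let $(\widetilde Ev)_i=n_i^{-1}\sum_{j\neq i}E_{ij}v_j$. Let $C_i\in\mathbb R^p$ be confounders with an arbitrary joint law, and consider the linear random effects network structural equation model with parameter $\varphi=(\beta,\gamma,\alpha,\sigma_y^2,\sigma_{b^Y}^2,\sigma_m^2,\sigma_{b^M}^2)\in\mathbb R^K$: given $C$, the exposures $A_i\in\{0,1\}$ are independent with $P(A_i=1\mid C)=\pi(C_i,\alpha)=e^{\alpha^TC_i}/(1+e^{\alpha^TC_i})$, and $$M=X_m\gamma+Eb^M+\epsilon^M,\qquad X_m=(1,A,\widetilde EA,C,\widetilde EC),\qquad \gamma=(\gamma_0,\dots,\gamma_4),$$ $$Y=X_y\beta+Eb^Y+\epsilon^Y,\qquad X_y=(1,A,\widetilde EA,M,\widetilde EM,C,\widetilde EC),\qquad \beta=(\beta_0,\dots,\beta_6),$$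 where $b^M,\epsilon^M,b^Y,\epsilon^Y$ are mutually independent, independent of $(C,A)$, and centred Gaussian with covariances $\sigma^2_{b^M}I,\ \sigma_m^2I,\ \sigma^2_{b^Y}I,\ \sigma_y^2I$. With $\Sigma_y=\sigma_y^2I+\sigma_{b^Y}^2EE^T$ and $\Sigma_m=\sigma_m^2I+\sigma_{b^M}^2EE^T$ the log-likelihood is $$l(\varphi)=-N\log(2\pi)-\tfrac12\log|\Sigma_y|-\tfrac12(Y-X_y\beta)^T\Sigma_y^{-1}(Y-X_y\beta)-\tfrac12\log|\Sigma_m|-\tfrac12(M-X_m\gamma)^T\Sigma_m^{-1}(M-X_m\gamma)+\sum_{i=1}^N\Big\{A_i\log\tfrac{\pi(C_i,\alpha)}{1-\pi(C_i,\alpha)}+\log(1-\pi(C_i,\alpha))\Big\}.$$ Let $J_N(\varphi)=-\nabla^2l(\varphi)$ be the observed information and $B_N(\varphi)=\mathbb E_\varphi\{J_N(\varphi)\}$ the Fisher information, the expectation being taken under the model at $\varphi$. For $\Phi=(\varphi_1,\dots,\varphi_K)$ let $J_N(\Phi)$ be the matrix whose $k$-th row is the $k$-th row of $J_N(\varphi_k)$.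 $\|\cdot\|_F$ is the Frobenius norm and $B^{1/2}$ the symmetric positive semidefinite root. **Assumptions.** The parameter space $\Theta\subset\mathbb R^K$ is compact, all four variance components are positive on $\Theta$, the data are generated at a true value $\varphi_0$ in the interior of $\Theta$, and $\widehat\varphi_N\in\arg\max_{\varphi\in\Theta}l(\varphi)$ is a maximum likelihood estimator. As $N\to\infty$: 1. for all large $N$, $B_N(\varphi)$ exists, is positive definite and is continuous in $\varphi\in\Theta$; and $\sup_{\varphi\in\Theta}\|B_N^{-1}(\varphi)\|_F\to0$; 2. $\sup_{\varphi\in\Theta}\mathbb E_\varphi\|B_N^{-1/2}(\varphi)J_N(\varphi)B_N^{-1/2}(\varphi)-I\|_F^2\to0$; 3. (i) for every $\epsilon>0$, $\sup\{\|B_N^{-1/2}(\varphi)B_N^{1/2}(\varphi')-I\|_F:\ \varphi,\varphi'\in\Theta,\ \|B_N^{1/2}(\varphi)^T(\varphi-\varphi')\|\le\epsilon\}\to0$; (ii) for every $\varphi\in\Theta$ and all $\epsilon,\eta>0$, $P_\varphi\big[\sup\{\|B_N^{-1/2}(\varphi)\{J_N(\Phi)-J_N(\varphi)\}B_N^{-1/2}(\varphi)\|_F:\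 \varphi_k\in\Theta,\ \|B_N(\varphi)(\varphi-\varphi_k)\|\le\epsilon,\ 1\le k\le K\}>\eta\big]\to0$; 4. with probability tending to one, $J_N(\varphi_0)$ and $J_N(\widehat\varphi_N)$ are positive definite. **Estimands.** Let $a,a'\in\{0,1\}$ and $s_1^A,s_1^{A'}\in[0,1]$. Write $\tilde s_i^{A}=[s_1^{A}n_i]/n_i$ and $\tilde s_i^{A'}=[s_1^{A'}n_i]/n_i$ with $[x]$ the integer nearest to $x$, and $$\bar\Delta_{1N}=\frac1N\sum_i\sum_{j\ne i}\frac{E_{ij}}{n_in_j},\quad \bar\Delta_{2N}=\frac1N\sum_i(\tilde s_i^A-\tilde s_i^{A'}),\quad \bar\Delta_{3N}=\frac1N\sum_i\sum_{j\ne i}\frac1{n_in_j}\sum_{k\ne j,\,k\neq i,\,E_{ik}=1}E_{ij}E_{jk}(\tilde s_i^A-\tilde s_i^{A'}).$$ The six estimands are the functions of $\varphi$ $$\tau_1=\beta_1(a-a'),\quad \tau_2=\beta_3\gamma_1(a-a'),\quad \tau_3=\beta_4\gamma_2(a-a')\bar\Delta_{1N},\quad \tau_4=\beta_2\bar\Delta_{2N},\quad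 \tau_5=\beta_3\gamma_2\bar\Delta_{2N},\quad \tau_6=\beta_4\gamma_1\bar\Delta_{2N}+\beta_4\gamma_2\bar\Delta_{3N},$$ and $\widehat\tau_k=\tau_k(\widehat\varphi_N)$ are the plug-in estimators, with sandwich variances $Q_N^{(k)}=\nabla\tau_k(\varphi_0)^TB_N^{-1}(\varphi_0)\nabla\tau_k(\varphi_0)$. **Claim.** Let $j_N^{(u,v)}$ be the $(u,v)$ element of $J_N^{-1}(\widehat\varphi_N)$, and let - $\widehat{\rm Var}(\widehat\tau_1)=j_N^{(\beta_1,\beta_1)}(a-a')^2$; - $\widehat{\rm Var}(\widehat\tau_2)=\{\widehat\gamma_1^2j_N^{(\beta_3,\beta_3)}+\widehat\beta_3^2j_N^{(\gamma_1,\gamma_1)}\}(a-a')^2$; - $\widehat{\rm Var}(\widehat\tau_3)=\{\widehat\gamma_2^2j_N^{(\beta_4,\beta_4)}+\widehat\beta_4^2j_N^{(\gamma_2,\gamma_2)}\}(a-a')^2\bar\Delta_{1N}^2$; - $\widehat{\rm Var}(\widehat\tau_4)=j_N^{(\beta_2,\beta_2)}\bar\Delta_{2N}^2$; - $\widehat{\rm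 Var}(\widehat\tau_5)=\{\widehat\gamma_2^2j_N^{(\beta_3,\beta_3)}+\widehat\beta_3^2j_N^{(\gamma_2,\gamma_2)}\}\bar\Delta_{2N}^2$; - $\widehat{\rm Var}(\widehat\tau_6)=j_N^{(\beta_4,\beta_4)}\{\widehat\gamma_1\bar\Delta_{2N}+\widehat\gamma_2\bar\Delta_{3N}\}^2+\widehat\beta_4^2\{j_N^{(\gamma_1,\gamma_1)}\bar\Delta_{2N}^2+j_N^{(\gamma_2,\gamma_2)}\bar\Delta_{3N}^2\}+2\widehat\beta_4^2j_N^{(\gamma_1,\gamma_2)}\bar\Delta_{2N}\bar\Delta_{3N}$. Then for each $k=1,\dots,6$: (1) whenever $J_N(\widehat\varphi_N)$ is invertible, $\widehat{\rm Var}(\widehat\tau_k)=\nabla\tau_k(\widehat\varphi_N)^TJ_N^{-1}(\widehat\varphi_N)\nabla\tau_k(\widehat\varphi_N)$; and (2) $\widehat{\rm Var}(\widehat\tau_k)$ is a consistent variance estimator in the sense that $\widehat{\rm Var}(\widehat\tau_k)-Q_N^{(k)}\to0$ in probability as $N\to\infty$. -/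

import Mathlib

open MeasureTheory ProbabilityTheory Filter Topology Matrix

namespace RENSEM

/-! ### The network -/

/-- Adjacency matrix of a network on `N` units: binary, symmetric, with unit diagonal. -/
structure IsAdjacency {N : ℕ} (E : Matrix (Fin N) (Fin N) ℝ) : Prop where
  binary : ∀ i j, E i j = 0 ∨ E i j = 1
  symm : ∀ i j, E i j = E j i
  diag : ∀ i, E i i = 1

/-- The number of first-degree neighbours, `n_i = ∑_{j ≠ i} E_ij`. -/
noncomputable def degree {N : ℕ} (E : Matrix (Fin N) (Fin N) ℝ) (i : Fin N) : ℝ :=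
  ∑ j ∈ Finset.univ.filter (fun j => j ≠ i), E i j

/-- The neighbourhood average `S_{1i}(v) = n_i⁻¹ ∑_{j ≠ i} E_ij v_j`. -/
noncomputable def nbrAvg {N : ℕ} (E : Matrix (Fin N) (Fin N) ℝ) (v : Fin N → ℝ) (i : Fin N) : ℝ :=
  (1 / degree E i) * ∑ j ∈ Finset.univ.filter (fun j => j ≠ i), E i j * v j

/-- The plausible neighbourhood exposure `[s n_i] / n_i`, with `[x]` the integer nearest to `x`. -/
noncomputable def plausible {N : ℕ} (E : Matrix (Fin N) (Fin N) ℝ) (s : ℝ) (i : Fin N) : ℝ :=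
  (round (s * degree E i) : ℝ) / degree E i

noncomputable def Delta1 {N : ℕ} (E : Matrix (Fin N) (Fin N) ℝ) : ℝ :=
  (1 / (N : ℝ)) * ∑ i, ∑ j ∈ Finset.univ.filter (fun j => j ≠ i),
    E i j / (degree E i * degree E j)

/-- `s` is the new and `s'` the reference level of the neighbourhood exposure. -/
noncomputable def Delta2 {N : ℕ} (E : Matrix (Fin N) (Fin N) ℝ) (s s' : ℝ) : ℝ :=
  (1 / (N : ℝ)) * ∑ i, (plausible E s i - plausible E s' i)

noncomputable def Delta3 {N : ℕ} (E : Matrix (Fin N) (Fin N) ℝ) (s s' : ℝ) : ℝ :=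
  (1 / (N : ℝ)) * ∑ i, ∑ j ∈ Finset.univ.filter (fun j => j ≠ i),
    (1 / (degree E i * degree E j)) *
      ∑ k ∈ Finset.univ.filter (fun k => k ≠ j ∧ k ≠ i ∧ E i k = 1),
        E i j * E j k * (plausible E s i - plausible E s' i)

/-! ### Parameters -/

/-- Coordinates of `β = (β₀, …, β₄, β₅, β₆)`, with `β₅, β₆ ∈ ℝᵖ`. -/
abbrev YIdx (p : ℕ) := Fin 5 ⊕ (Fin p ⊕ Fin p)

/-- Coordinates of `γ = (γ₀, γ₁, γ₂, γ₃, γ₄)`, with `γ₃, γ₄ ∈ ℝᵖ`. -/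
abbrev MIdx (p : ℕ) := Fin 3 ⊕ (Fin p ⊕ Fin p)

/-- Coordinates of the grand parameter: `β, (σ²_y, σ²_{bY}), γ, (σ²_m, σ²_{bM}), α`. -/
abbrev Idx (p : ℕ) := (YIdx p ⊕ Fin 2) ⊕ ((MIdx p ⊕ Fin 2) ⊕ Fin p)

instance instDecidableEqIdx (p : ℕ) : DecidableEq (Idx p) := inferInstance
instance instFintypeIdx (p : ℕ) : Fintype (Idx p) := inferInstance

abbrev Param (p : ℕ) := Idx p → ℝ

/-- Index of `β_k`, `k = 0, …, 4`. -/
abbrev iBeta (p : ℕ) (k : Fin 5) : Idx p := Sum.inl (Sum.inl (Sum.inl k))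

/-- Index of `γ_k`, `k = 0, 1, 2`. -/
abbrev iGamma (p : ℕ) (k : Fin 3) : Idx p := Sum.inr (Sum.inl (Sum.inl (Sum.inl k)))

namespace Param

variable {p : ℕ} (φ : Param p)

def beta : YIdx p → ℝ := fun k => φ (Sum.inl (Sum.inl k))
def gamma : MIdx p → ℝ := fun k => φ (Sum.inr (Sum.inl (Sum.inl k)))
def alpha : Fin p → ℝ := fun k => φ (Sum.inr (Sum.inr k))
/-- Variance of the outcome errors. -/
def varY : ℝ := φ (Sum.inl (Sum.inr 0))
/-- Variance of the outcome random effects. -/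
def varBY : ℝ := φ (Sum.inl (Sum.inr 1))
/-- Variance of the mediator errors. -/
def varM : ℝ := φ (Sum.inr (Sum.inl (Sum.inr 0)))
/-- Variance of the mediator random effects. -/
def varBM : ℝ := φ (Sum.inr (Sum.inl (Sum.inr 1)))

end Param

/-! ### The structural equation model -/

/-- Observed data on `N` units: confounders, exposures, mediators, outcomes. -/
structure Obs (N p : ℕ) where
  C : Fin N → Fin p → ℝ
  A : Fin N → ℝ
  M : Fin N → ℝ
  Y : Fin N → ℝ

/-- The design matrix `X_m = (1, A, ẼA, C, ẼC)`. -/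
noncomputable def designM {N p : ℕ} (E : Matrix (Fin N) (Fin N) ℝ) (C : Fin N → Fin p → ℝ)
    (A : Fin N → ℝ) : Matrix (Fin N) (MIdx p) ℝ :=
  Matrix.of fun i => Sum.elim ![1, A i, nbrAvg E A i]
    (Sum.elim (fun k => C i k) (fun k => nbrAvg E (fun j => C j k) i))

/-- The design matrix `X_y = (1, A, ẼA, M, ẼM, C, ẼC)`. -/
noncomputable def designY {N p : ℕ} (E : Matrix (Fin N) (Fin N) ℝ) (C : Fin N → Fin p → ℝ)
    (A M : Fin N → ℝ) : Matrix (Fin N) (YIdx p) ℝ :=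
  Matrix.of fun i => Sum.elim ![1, A i, nbrAvg E A i, M i, nbrAvg E M i]
    (Sum.elim (fun k => C i k) (fun k => nbrAvg E (fun j => C j k) i))

/-- The logistic exposure probability. -/
noncomputable def propensity {p : ℕ} (c α : Fin p → ℝ) : ℝ :=
  Real.exp (α ⬝ᵥ c) / (1 + Real.exp (α ⬝ᵥ c))

/-- Networks of every size `N`, with the confounders and the exogenous noise of the structural
equations: `U` drives the exposures; `ZbM, ZM, ZbY, ZY` are the standardized random effects and
errors of the mediator and the outcome equation. -/
structure System (p : ℕ) (Ω : Type*) where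
  E : ∀ N : ℕ, Matrix (Fin N) (Fin N) ℝ
  C : ∀ N : ℕ, Ω → Fin N → Fin p → ℝ
  U : ∀ N : ℕ, Ω → Fin N → ℝ
  ZbM : ∀ N : ℕ, Ω → Fin N → ℝ
  ZM : ∀ N : ℕ, Ω → Fin N → ℝ
  ZbY : ∀ N : ℕ, Ω → Fin N → ℝ
  ZY : ∀ N : ℕ, Ω → Fin N → ℝ

/-- `MVN(0, I_N)`. -/
noncomputable def stdNormal (N : ℕ) : Measure (Fin N → ℝ) :=
  Measure.pi fun _ => gaussianReal 0 1

/-- The law of `N` independent uniform variables on `[0, 1]`. -/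
noncomputable def stdUniform (N : ℕ) : Measure (Fin N → ℝ) :=
  Measure.pi fun _ => (volume : Measure ℝ).restrict (Set.Icc 0 1)

variable {p : ℕ} {Ω : Type*}

/-- The standing assumptions on the network and on the noise. The last field says that the
confounders, the exposure noise, and the four standardized Gaussian vectors are mutually
independent, with the stated laws; the law of the confounders is arbitrary. -/
structure System.Valid [MeasurableSpace Ω] (S : System p Ω) (P : Measure Ω) : Prop where
  adjacency : ∀ N, IsAdjacency (S.E N)
  connected : ∀ N, 2 ≤ N → ∀ i, 0 < degree (S.E N) i
  meas_C : ∀ N, Measurable (S.C N)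
  meas_U : ∀ N, Measurable (S.U N)
  meas_ZbM : ∀ N, Measurable (S.ZbM N)
  meas_ZM : ∀ N, Measurable (S.ZM N)
  meas_ZbY : ∀ N, Measurable (S.ZbY N)
  meas_ZY : ∀ N, Measurable (S.ZY N)
  law : ∀ N,
    P.map (fun ω => (S.C N ω, S.U N ω, S.ZbM N ω, S.ZM N ω, S.ZbY N ω, S.ZY N ω)) =
      (P.map (S.C N)).prod ((stdUniform N).prod ((stdNormal N).prod
        ((stdNormal N).prod ((stdNormal N).prod (stdNormal N)))))

/-- `A_i = 1` with conditional probability `π(C_i, α)` given the confounders. -/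
noncomputable def System.exposure (S : System p Ω) (N : ℕ) (φ : Param p) (ω : Ω) : Fin N → ℝ :=
  fun i => if S.U N ω i ≤ propensity (S.C N ω i) φ.alpha then 1 else 0

/-- `M = X_m γ + E b^M + ε^M` with `b^M = σ_{bM} ZbM` and `ε^M = σ_m ZM`. -/
noncomputable def System.mediator (S : System p Ω) (N : ℕ) (φ : Param p) (ω : Ω) : Fin N → ℝ :=
  designM (S.E N) (S.C N ω) (S.exposure N φ ω) *ᵥ φ.gamma
    + S.E N *ᵥ (Real.sqrt φ.varBM • S.ZbM N ω) + Real.sqrt φ.varM • S.ZM N ω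

/-- `Y = X_y β + E b^Y + ε^Y` with `b^Y = σ_{bY} ZbY` and `ε^Y = σ_y ZY`. -/
noncomputable def System.outcome (S : System p Ω) (N : ℕ) (φ : Param p) (ω : Ω) : Fin N → ℝ :=
  designY (S.E N) (S.C N ω) (S.exposure N φ ω) (S.mediator N φ ω) *ᵥ φ.beta
    + S.E N *ᵥ (Real.sqrt φ.varBY • S.ZbY N ω) + Real.sqrt φ.varY • S.ZY N ω

/-- The data generated by the model on `N` units at the parameter value `φ`. -/
noncomputable def System.data (S : System p Ω) (N : ℕ) (φ : Param p) (ω : Ω) : Obs N p where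
  C := S.C N ω
  A := S.exposure N φ ω
  M := S.mediator N φ ω
  Y := S.outcome N φ ω

/-! ### Likelihood and information -/

/-- `s I + t E Eᵀ`. -/
noncomputable def covMat {N : ℕ} (E : Matrix (Fin N) (Fin N) ℝ) (s t : ℝ) :
    Matrix (Fin N) (Fin N) ℝ :=
  s • (1 : Matrix (Fin N) (Fin N) ℝ) + t • (E * Eᵀ)

/-- Log-density at `v` of the normal law with mean `μ` and covariance `Γ`. -/
noncomputable def gaussLogLik {N : ℕ} (Γ : Matrix (Fin N) (Fin N) ℝ) (v μ : Fin N → ℝ) : ℝ :=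
  -((N : ℝ) / 2) * Real.log (2 * Real.pi) - (1 / 2) * Real.log Γ.det
    - (1 / 2) * ((v - μ) ⬝ᵥ (Γ⁻¹ *ᵥ (v - μ)))

/-- The log-likelihood of the model, with the random effects integrated out. -/
noncomputable def logLik {N : ℕ} (E : Matrix (Fin N) (Fin N) ℝ) (D : Obs N p) (φ : Param p) : ℝ :=
  gaussLogLik (covMat E φ.varY φ.varBY) D.Y (designY E D.C D.A D.M *ᵥ φ.beta)
    + gaussLogLik (covMat E φ.varM φ.varBM) D.M (designM E D.C D.A *ᵥ φ.gamma)
    + (∑ i, D.A i * Real.log (propensity (D.C i) φ.alpha / (1 - propensity (D.C i) φ.alpha))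
      + ∑ i, Real.log (1 - propensity (D.C i) φ.alpha))

/-- The gradient of `g` at `φ`. -/
noncomputable def grad (g : Param p → ℝ) (φ : Param p) : Idx p → ℝ :=
  fun k => fderiv ℝ g φ (Pi.single k 1)

/-- The Hessian matrix of `g` at `φ`. -/
noncomputable def hessian (g : Param p → ℝ) (φ : Param p) : Matrix (Idx p) (Idx p) ℝ :=
  Matrix.of fun k l => fderiv ℝ (fun ψ => fderiv ℝ g ψ (Pi.single l 1)) φ (Pi.single k 1)

/-- The observed information `J_N(φ)` computed from the data `D`. -/
noncomputable def obsInfo {N : ℕ} (E : Matrix (Fin N) (Fin N) ℝ) (D : Obs N p) (φ : Param p) :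
    Matrix (Idx p) (Idx p) ℝ :=
  -hessian (logLik E D) φ

/-- The mosaic observed information `J_N(Φ)`: its `k`-th row is that of `J_N(φ_k)`. -/
noncomputable def mosaicInfo {N : ℕ} (E : Matrix (Fin N) (Fin N) ℝ) (D : Obs N p)
    (Φ : Idx p → Param p) : Matrix (Idx p) (Idx p) ℝ :=
  Matrix.of fun k l => obsInfo E D (Φ k) k l

/-- The Fisher information `B_N(φ) = 𝔼_φ J_N(φ)`. -/
noncomputable def fisherInfo [MeasurableSpace Ω] (S : System p Ω) (P : Measure Ω) (N : ℕ)
    (φ : Param p) : Matrix (Idx p) (Idx p) ℝ :=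
  Matrix.of fun k l => ∫ ω, obsInfo (S.E N) (S.data N φ ω) φ k l ∂P

/-! ### Regularity conditions -/

/-- Frobenius norm. -/
noncomputable def frob (H : Matrix (Idx p) (Idx p) ℝ) : ℝ := Real.sqrt (Hᵀ * H).trace

/-- Euclidean norm. -/
noncomputable def eucl (v : Idx p → ℝ) : ℝ := Real.sqrt (v ⬝ᵥ v)

open scoped MatrixOrder in
/-- The positive semidefinite square root of a positive semidefinite matrix. -/
noncomputable def msqrt (B : Matrix (Idx p) (Idx p) ℝ) : Matrix (Idx p) (Idx p) ℝ := CFC.sqrt B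

section Conditions

variable [MeasurableSpace Ω] (S : System p Ω) (P : Measure Ω) (Θ : Set (Param p))

/-- For all large `N` the Fisher information exists, is positive definite and is continuous on
`Θ`; and `‖B_N⁻¹(φ)‖_F → 0` uniformly on `Θ`. -/
structure InfoGrowth : Prop where
  integrable : ∀ᶠ N : ℕ in atTop, ∀ φ ∈ Θ, ∀ k l,
    Integrable (fun ω => obsInfo (S.E N) (S.data N φ ω) φ k l) P
  posDef : ∀ᶠ N : ℕ in atTop, ∀ φ ∈ Θ, (fisherInfo S P N φ).PosDef
  continuousOn : ∀ᶠ N : ℕ in atTop, ContinuousOn (fisherInfo S P N) Θ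
  inv_tendsto : Tendsto
    (fun N : ℕ => ⨆ φ ∈ Θ, ENNReal.ofReal (frob (fisherInfo S P N φ)⁻¹)) atTop (𝓝 0)

/-- `sup_{φ ∈ Θ} 𝔼_φ ‖B_N^{-1/2}(φ) J_N(φ) B_N^{-1/2}(φ) - I‖_F² → 0`. -/
def InfoStability : Prop :=
  Tendsto (fun N : ℕ => ⨆ φ ∈ Θ, ∫⁻ ω, ENNReal.ofReal
    (frob ((msqrt (fisherInfo S P N φ))⁻¹ * obsInfo (S.E N) (S.data N φ ω) φ
      * (msqrt (fisherInfo S P N φ))⁻¹ - 1) ^ 2) ∂P) atTop (𝓝 0)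

/-- For every `ε > 0`, `‖B_N^{-1/2}(φ) B_N^{1/2}(φ') - I‖_F → 0` uniformly over `φ, φ' ∈ Θ` with
`‖B_N^{1/2}(φ)ᵀ (φ - φ')‖ ≤ ε`. -/
def FisherSmooth : Prop :=
  ∀ ε : ℝ, 0 < ε → Tendsto (fun N : ℕ => ⨆ φ ∈ Θ, ⨆ φ' ∈ Θ,
    ⨆ (_ : eucl ((msqrt (fisherInfo S P N φ))ᵀ *ᵥ (φ - φ')) ≤ ε),
      ENNReal.ofReal (frob ((msqrt (fisherInfo S P N φ))⁻¹ * msqrt (fisherInfo S P N φ') - 1)))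
    atTop (𝓝 0)

/-- For every `φ ∈ Θ` and `ε, η > 0`, under the model at `φ`, the probability that
`‖B_N^{-1/2}(φ) {J_N(Φ) - J_N(φ)} B_N^{-1/2}(φ)‖_F > η` for some `Φ = (φ_k)` in `Θ` with
`‖B_N(φ) (φ - φ_k)‖ ≤ ε` for all `k` tends to `0`. -/
def InfoSmooth : Prop :=
  ∀ φ ∈ Θ, ∀ ε : ℝ, 0 < ε → ∀ η : ℝ, 0 < η → Tendsto (fun N : ℕ => P {ω | ∃ Φ : Idx p → Param p,
    (∀ k, Φ k ∈ Θ ∧ eucl (fisherInfo S P N φ *ᵥ (φ - Φ k)) ≤ ε) ∧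
    η < frob ((msqrt (fisherInfo S P N φ))⁻¹
      * (mosaicInfo (S.E N) (S.data N φ ω) Φ - obsInfo (S.E N) (S.data N φ ω) φ)
      * (msqrt (fisherInfo S P N φ))⁻¹)}) atTop (𝓝 0)

end Conditions

/-! ### The six estimands and the variance estimators -/

/-- The estimands `τ₁, …, τ₆` as functions of the model parameter, for a change of the exposure
and of the neighbourhood exposure from `(a', s')` to `(a, s)`. -/
noncomputable def estimand {N : ℕ} (E : Matrix (Fin N) (Fin N) ℝ) (a a' s s' : ℝ) :
    Fin 6 → Param p → ℝ :=
  ![fun φ => φ (iBeta p 1) * (a - a'),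
    fun φ => φ (iBeta p 3) * φ (iGamma p 1) * (a - a'),
    fun φ => φ (iBeta p 4) * φ (iGamma p 2) * (a - a') * Delta1 E,
    fun φ => φ (iBeta p 2) * Delta2 E s s',
    fun φ => φ (iBeta p 3) * φ (iGamma p 2) * Delta2 E s s',
    fun φ => φ (iBeta p 4) * φ (iGamma p 1) * Delta2 E s s'
      + φ (iBeta p 4) * φ (iGamma p 2) * Delta3 E s s']

/-- The closed-form variance estimators of the six plug-in estimators, in terms of the estimate `φ`
and of the inverse observed information `j`. -/
noncomputable def varEstimator {N : ℕ} (E : Matrix (Fin N) (Fin N) ℝ) (a a' s s' : ℝ)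
    (j : Matrix (Idx p) (Idx p) ℝ) (φ : Param p) : Fin 6 → ℝ :=
  ![j (iBeta p 1) (iBeta p 1) * (a - a') ^ 2,
    (φ (iGamma p 1) ^ 2 * j (iBeta p 3) (iBeta p 3)
      + φ (iBeta p 3) ^ 2 * j (iGamma p 1) (iGamma p 1)) * (a - a') ^ 2,
    (φ (iGamma p 2) ^ 2 * j (iBeta p 4) (iBeta p 4)
      + φ (iBeta p 4) ^ 2 * j (iGamma p 2) (iGamma p 2)) * (a - a') ^ 2 * Delta1 E ^ 2,
    j (iBeta p 2) (iBeta p 2) * Delta2 E s s' ^ 2,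
    (φ (iGamma p 2) ^ 2 * j (iBeta p 3) (iBeta p 3)
      + φ (iBeta p 3) ^ 2 * j (iGamma p 2) (iGamma p 2)) * Delta2 E s s' ^ 2,
    j (iBeta p 4) (iBeta p 4)
        * (φ (iGamma p 1) * Delta2 E s s' + φ (iGamma p 2) * Delta3 E s s') ^ 2
      + φ (iBeta p 4) ^ 2 * (j (iGamma p 1) (iGamma p 1) * Delta2 E s s' ^ 2
        + j (iGamma p 2) (iGamma p 2) * Delta3 E s s' ^ 2)
      + 2 * φ (iBeta p 4) ^ 2 * j (iGamma p 1) (iGamma p 2) * Delta2 E s s' * Delta3 E s s']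

/-- The quadratic form `∇g(φ)ᵀ V ∇g(φ)`. -/
noncomputable def sandwich (g : Param p → ℝ) (V : Matrix (Idx p) (Idx p) ℝ) (φ : Param p) : ℝ :=
  grad g φ ⬝ᵥ (V *ᵥ grad g φ)

end RENSEM

/-! Part (1) is the chain rule together with block structure. Given the mediators, the outcome
likelihood involves only `β` and the outcome variances, while the remaining factors do not involve
these coordinates. The observed information is therefore block diagonal, its inverse has no `β`–`γ`
entries, and the quadratic form of each gradient collapses to the closed formula.

For part (2), both terms of the difference tend to zero. The coefficients `Delta1`, `Delta2`,
`Delta3` are at most 1 in absolute value and `Θ` is bounded, so each variance is at most a constant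
times the `β`-diagonal and `γ`-block entries of the inverse information (`abs_varEstimator_le`). For
`Q_N` these entries vanish because `B_N⁻¹ → 0`. For the estimator one shows that, for every `Λ`, the
entries of `J_N⁻¹(φhat)` are at most `2 / Λ` with probability close to one.

The latter rests on a likelihood-ratio argument. Rotating by the eigenvectors of `E Eᵀ` diagonalizes
all covariances at once, so each mixed equation becomes a sum of independent scalar Gaussian terms.
In units of the true standard deviations its log-likelihood ratio is a noise term, linear in the
shift `h` of the mean and the relative change `d` of the variances, minus a quadratic drift in `(h,
d)` (`gaussTerm_sub_le`, `mixed_logLik_le`). The noise is controlled uniformly in the variance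
components by expanding the inverse variances in a geometric series (`exists_sup_noise_bound`). The
exposure ratio is a linear score minus a convex Bregman divergence. Information stability and
smoothness make the divergence nearly quadratic at finitely many points, and convexity turns this
into an upper bound for the ratio that is tight in probability (`exists_logistic_sup_bound`).

Since the maximizer has a nonnegative total ratio, `‖h‖² + ‖d‖²` is bounded in probability
(`GoodEvent.mle_close`). The Fisher information exceeds any `Λ`, so a bounded whitened displacement
changes the information of the mixed equations by a small relative amount (`mixedForm_ge`). Hence
`J_N(φhat)` dominates `Λ / 2` on the regression and variance coordinates. No lower bound on the
exposure block is needed beyond positive definiteness of `J_N(φhat)` (`GoodEvent.abs_inv_le`). -/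

namespace RENSEM

/-! ### Second derivatives -/

/-- `g` is differentiable near `x`, with second derivative `H` at `x`. -/
def HasHessianAt {V : Type*} [NormedAddCommGroup V] [NormedSpace ℝ V] (g : V → ℝ) (x : V)
    (H : V → V → ℝ) : Prop :=
  ∃ g' : V → (V →L[ℝ] ℝ), (∀ᶠ y in 𝓝 x, HasFDerivAt g (g' y) y) ∧
    ∀ u, ∃ L : V →L[ℝ] ℝ, HasFDerivAt (fun y => g' y u) L x ∧ ∀ w, L w = H w u

section HasHessianAt

variable {V : Type*} [NormedAddCommGroup V] [NormedSpace ℝ V] {x : V}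

theorem HasHessianAt.add {f g : V → ℝ} {F G : V → V → ℝ} (hf : HasHessianAt f x F)
    (hg : HasHessianAt g x G) :
    HasHessianAt (fun y => f y + g y) x (fun w u => F w u + G w u) := by
  obtain ⟨f', hf1, hf2⟩ := hf
  obtain ⟨g', hg1, hg2⟩ := hg
  refine ⟨fun y => f' y + g' y, ?_, fun u => ?_⟩
  · filter_upwards [hf1, hg1] with y h1 h2 using h1.add h2
  · obtain ⟨L, hL, hL'⟩ := hf2 u
    obtain ⟨M, hM, hM'⟩ := hg2 u
    exact ⟨L + M, hL.add hM, fun w => by simp [hL', hM']⟩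

theorem HasHessianAt.const (c : ℝ) : HasHessianAt (fun _ : V => c) x (fun _ _ => 0) :=
  ⟨fun _ => 0, Eventually.of_forall fun y => hasFDerivAt_const c y,
    fun _ => ⟨0, by simpa using hasFDerivAt_const (0 : ℝ) x, fun _ => rfl⟩⟩

theorem HasHessianAt.sum {ι : Type*} (s : Finset ι) {f : ι → V → ℝ} {F : ι → V → V → ℝ}
    (h : ∀ i ∈ s, HasHessianAt (f i) x (F i)) :
    HasHessianAt (fun y => ∑ i ∈ s, f i y) x (fun w u => ∑ i ∈ s, F i w u) := by
  classical
  induction s using Finset.induction_on with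
  | empty => simpa using HasHessianAt.const 0
  | insert a s ha ih =>
    simp only [Finset.sum_insert ha]
    exact (h a (Finset.mem_insert_self a s)).add
      (ih fun i hi => h i (Finset.mem_insert_of_mem hi))

theorem HasHessianAt.congr {f g : V → ℝ} {F : V → V → ℝ} (hf : HasHessianAt f x F)
    (h : g =ᶠ[𝓝 x] f) : HasHessianAt g x F := by
  obtain ⟨f', hf1, hf2⟩ := hf
  refine ⟨f', ?_, hf2⟩
  filter_upwards [hf1, h.eventually_nhds] with y h1 h2 using h1.congr_of_eventuallyEq h2

/-- One coordinate of a diagonalized mixed equation. Mean and variance are both linear in the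
parameter, so no second derivatives of `m` or `v` appear. -/
theorem hasHessianAt_gaussTerm (v m : V →L[ℝ] ℝ) (y : ℝ) (hx : 0 < v x) :
    HasHessianAt (fun ψ => -(1 / 2) * Real.log (v ψ) - (1 / 2) * ((y - m ψ) ^ 2 / v ψ)) x
      (fun u w => -(m u * m w / v x + (y - m x) * (m u * v w + m w * v u) / v x ^ 2
        + ((y - m x) ^ 2 / v x - 1 / 2) * (v u * v w) / v x ^ 2)) := by
  have hpos : ∀ᶠ ψ in 𝓝 x, 0 < v ψ := v.continuous.continuousAt.eventually (lt_mem_nhds hx)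
  refine ⟨fun ψ => (-(1 / 2) * (v ψ)⁻¹ + (1 / 2) * ((y - m ψ) ^ 2 / v ψ ^ 2)) • v
    + ((y - m ψ) / v ψ) • m, ?_, fun w => ?_⟩
  · filter_upwards [hpos] with ψ hψ
    have h1 : HasFDerivAt (fun ψ => v ψ) v ψ := v.hasFDerivAt
    have h2 : HasFDerivAt (fun ψ => m ψ) m ψ := m.hasFDerivAt
    have h3 := ((h1.log hψ.ne').const_mul (-(1 / 2))).sub
      ((((h2.const_sub y).pow 2).mul
        ((hasDerivAt_inv hψ.ne').comp_hasFDerivAt ψ h1)).const_mul (1 / 2))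
    refine (h3.congr_of_eventuallyEq (Eventually.of_forall fun ψ => ?_)).congr_fderiv ?_
    · simp [div_eq_mul_inv]
    ext u
    simp
    field_simp
    ring
  · have h1 : HasFDerivAt (fun ψ => v ψ) v x := v.hasFDerivAt
    have h2 : HasFDerivAt (fun ψ => m ψ) m x := m.hasFDerivAt
    have h4 := (hasDerivAt_inv hx.ne').comp_hasFDerivAt x h1
    have h3 := (((h4.const_mul (-(1 / 2))).add
      ((((h2.const_sub y).pow 2).mul (h4.pow 2)).const_mul (1 / 2))).mul_const (v w)).add
      (((h2.const_sub y).mul h4).mul_const (m w))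
    refine ⟨_, h3.congr_of_eventuallyEq (Eventually.of_forall fun ψ => ?_), fun u => ?_⟩
    · simp [div_eq_mul_inv]
    · simp
      field_simp
      ring

/-- The logistic function. -/
noncomputable def logistic (x : ℝ) : ℝ := Real.exp x / (1 + Real.exp x)

theorem hasDerivAt_logistic (x : ℝ) :
    HasDerivAt logistic (logistic x * (1 - logistic x)) x := by
  have hp : (1 + Real.exp x) ≠ 0 := by positivity
  have h := (Real.hasDerivAt_exp x).div ((Real.hasDerivAt_exp x).const_add 1) hp
  refine h.congr_deriv ?_
  unfold logistic
  field_simp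

theorem hasDerivAt_log_one_add_exp (x : ℝ) :
    HasDerivAt (fun x => Real.log (1 + Real.exp x)) (logistic x) x :=
  ((Real.hasDerivAt_exp x).const_add 1).log (by positivity)

/-- The logit is the canonical link: the response enters linearly, so the Hessian is free of `A`.
The exposure information is thus a function of the confounders alone, which is used later to change
the parameter value without changing the data. -/
theorem hasHessianAt_logisticTerm (a : V →L[ℝ] ℝ) (A : ℝ) :
    HasHessianAt (fun ψ => A * a ψ - Real.log (1 + Real.exp (a ψ))) x
      (fun u w => -(logistic (a x) * (1 - logistic (a x)) * (a u * a w))) := by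
  refine ⟨fun ψ => (A - logistic (a ψ)) • a, Eventually.of_forall fun ψ => ?_, fun w => ?_⟩
  · have h := ((a.hasFDerivAt (x := ψ)).const_mul A).sub
      ((hasDerivAt_log_one_add_exp (a ψ)).comp_hasFDerivAt ψ a.hasFDerivAt)
    refine h.congr_fderiv ?_
    ext u
    simp
    ring
  · have h := (((hasDerivAt_logistic (a x)).comp_hasFDerivAt x
      (a.hasFDerivAt)).const_sub A).mul_const (a w)
    refine ⟨_, h.congr_of_eventuallyEq (Eventually.of_forall fun ψ => ?_), fun u => ?_⟩
    · simp
    · simp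
      ring

end HasHessianAt

variable {p : ℕ}

/-- `HasHessianAt` supplies a derivative for each direction separately. Linearity in the direction
is recovered from uniqueness of derivatives, after which the matrix may be tested against arbitrary
vectors instead of basis vectors. -/
theorem HasHessianAt.dotProduct_hessian {g : Param p → ℝ} {φ : Param p}
    {H : Param p → Param p → ℝ} (h : HasHessianAt g φ H) (u w : Param p) :
    u ⬝ᵥ (hessian g φ *ᵥ w) = H u w := by
  obtain ⟨g', h1, h2⟩ := h
  have h3 : ∀ l, (fun ψ => fderiv ℝ g ψ l) =ᶠ[𝓝 φ] fun ψ => g' ψ l := fun l => by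
    filter_upwards [h1] with ψ hψ
    rw [hψ.fderiv]
  choose L hL hL' using h2
  have h4 : ∀ k l, hessian g φ k l = L (Pi.single l 1) (Pi.single k 1) := fun k l => by
    simp only [hessian, Matrix.of_apply]
    rw [(h3 _).fderiv_eq, (hL _).fderiv]
  have hsum : ∀ v : Param p, v = ∑ k, v k • (Pi.single k 1 : Param p) := fun v => by
    rw [← Finset.univ_sum_single v]
    refine Finset.sum_congr rfl fun k _ => ?_
    ext j
    by_cases hj : j = k
    · subst hj; simp [Finset.sum_apply, Pi.single_apply]
    · simp [Pi.single_apply, hj]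
  have h5 : L w = ∑ l, w l • L (Pi.single l 1) := by
    refine (hL w).unique ?_
    have : (fun y => g' y w) = fun y => ∑ l, w l • g' y (Pi.single l 1) := by
      funext y
      conv_lhs => rw [hsum w]
      simp
    rw [this]
    exact HasFDerivAt.fun_sum fun l _ => (hL _).const_smul (w l)
  rw [← hL', h5]
  conv_rhs => rw [hsum u]
  simp only [dotProduct, mulVec, h4, map_sum, map_smul, smul_eq_mul, _root_.sum_apply,
    _root_.smul_apply]
  refine Finset.sum_congr rfl fun k _ => ?_
  congr 1
  exact Finset.sum_congr rfl fun l _ => mul_comm _ _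

/-! ### Diagonalization of the covariance matrices -/

section Spectral

variable {N : ℕ} (E : Matrix (Fin N) (Fin N) ℝ)

theorem isHermitian_gram : (E * Eᵀ).IsHermitian := by
  simpa [conjTranspose_eq_transpose_of_trivial] using isHermitian_mul_conjTranspose_self E

/-- The eigenvalues of `E Eᵀ`. -/
noncomputable def gramEig : Fin N → ℝ := (isHermitian_gram E).eigenvalues

/-- The rotation that diagonalizes `E Eᵀ`. -/
noncomputable def gramRot : Matrix (Fin N) (Fin N) ℝ :=
  ((isHermitian_gram E).eigenvectorUnitary : Matrix (Fin N) (Fin N) ℝ)ᵀ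

theorem gramRot_mul_transpose : gramRot E * (gramRot E)ᵀ = 1 := by
  have := Unitary.coe_star_mul_self (isHermitian_gram E).eigenvectorUnitary
  simpa [gramRot, star_eq_conjTranspose] using this

theorem transpose_mul_gramRot : (gramRot E)ᵀ * gramRot E = 1 := by
  have := Unitary.coe_mul_star_self (isHermitian_gram E).eigenvectorUnitary
  simpa [gramRot, star_eq_conjTranspose] using this

theorem gram_eq : E * Eᵀ = (gramRot E)ᵀ * diagonal (gramEig E) * gramRot E := by
  have h := (isHermitian_gram E).spectral_theorem
  rw [Unitary.conjStarAlgAut_apply] at h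
  simpa [gramRot, gramEig, star_eq_conjTranspose, Function.comp_def] using h

theorem gramEig_nonneg (i : Fin N) : 0 ≤ gramEig E i := by
  have : (E * Eᵀ).PosSemidef := by
    simpa [conjTranspose_eq_transpose_of_trivial] using posSemidef_self_mul_conjTranspose E
  exact this.eigenvalues_nonneg i

/-- The rotation does not depend on `(s, t)`: the whole family of covariances is diagonalized
simultaneously, with eigenvalues linear in the variance components. -/
theorem covMat_eq (s t : ℝ) : covMat E s t =
    (gramRot E)ᵀ * diagonal (fun i => s + t * gramEig E i) * gramRot E := by
  have h : diagonal (fun i => s + t * gramEig E i)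
      = s • (1 : Matrix (Fin N) (Fin N) ℝ) + t • diagonal (gramEig E) := by
    ext i j
    by_cases hij : i = j
    · subst hij; simp
    · simp [hij]
  rw [covMat, h, gram_eq]
  simp [Matrix.mul_add, Matrix.add_mul, transpose_mul_gramRot]

theorem det_covMat (s t : ℝ) : (covMat E s t).det = ∏ i, (s + t * gramEig E i) := by
  rw [covMat_eq, det_mul, det_mul, mul_right_comm, ← det_mul, transpose_mul_gramRot]
  simp

theorem inv_covMat {s t : ℝ} (h : ∀ i, s + t * gramEig E i ≠ 0) : (covMat E s t)⁻¹ =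
    (gramRot E)ᵀ * diagonal (fun i => (s + t * gramEig E i)⁻¹) * gramRot E := by
  refine inv_eq_right_inv ?_
  rw [covMat_eq]
  have h1 := gramRot_mul_transpose E
  have h2 : diagonal (fun i => s + t * gramEig E i)
      * diagonal (fun i => (s + t * gramEig E i)⁻¹) = 1 := by
    rw [diagonal_mul_diagonal, ← diagonal_one]
    congr 1
    funext i
    exact mul_inv_cancel₀ (h i)
  calc _ = (gramRot E)ᵀ * (diagonal (fun i => s + t * gramEig E i)
        * (gramRot E * (gramRot E)ᵀ) * diagonal (fun i => (s + t * gramEig E i)⁻¹))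
        * gramRot E := by simp only [Matrix.mul_assoc]
    _ = 1 := by rw [h1, Matrix.mul_one, h2, Matrix.mul_one, transpose_mul_gramRot]

theorem gaussLogLik_covMat {s t : ℝ} (h : ∀ i, 0 < s + t * gramEig E i) (y μ : Fin N → ℝ) :
    gaussLogLik (covMat E s t) y μ = -((N : ℝ) / 2) * Real.log (2 * Real.pi)
      + ∑ i, (-(1 / 2) * Real.log (s + t * gramEig E i)
        - (1 / 2) * (((gramRot E *ᵥ y) i - (gramRot E *ᵥ μ) i) ^ 2 / (s + t * gramEig E i))) := by
  have hq : (y - μ) ⬝ᵥ ((covMat E s t)⁻¹ *ᵥ (y - μ))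
      = ∑ i, ((gramRot E *ᵥ y) i - (gramRot E *ᵥ μ) i) ^ 2 / (s + t * gramEig E i) := by
    rw [inv_covMat E fun i => (h i).ne', ← mulVec_mulVec, ← mulVec_mulVec, dotProduct_mulVec,
      vecMul_transpose, mulVec_sub, dotProduct]
    refine Finset.sum_congr rfl fun i _ => ?_
    rw [mulVec_diagonal]
    simp only [Pi.sub_apply]
    rw [div_eq_mul_inv]
    ring
  rw [gaussLogLik, hq, det_covMat, Real.log_prod fun i _ => (h i).ne', Finset.sum_sub_distrib,
    ← Finset.mul_sum, ← Finset.mul_sum]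
  ring

end Spectral

/-! ### The observed information -/

/-- The contribution of a linear mixed equation to the observed information, for the coordinates
`m, m'` of the rotated regression directions and the variance directions `(ds, dt)`, `(ds', dt')`. -/
noncomputable def mixedForm {N : ℕ} (lam r : Fin N → ℝ) (s t : ℝ) (m : Fin N → ℝ) (ds dt : ℝ)
    (m' : Fin N → ℝ) (ds' dt' : ℝ) : ℝ :=
  ∑ i, (m i * m' i / (s + t * lam i)
    + r i * (m i * (ds' + dt' * lam i) + m' i * (ds + dt * lam i)) / (s + t * lam i) ^ 2
    + (r i ^ 2 / (s + t * lam i) - 1 / 2) * ((ds + dt * lam i) * (ds' + dt' * lam i))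
      / (s + t * lam i) ^ 2)

/-- The contribution of the exposure model to the observed information. -/
noncomputable def logisticForm {N : ℕ} (C : Fin N → Fin p → ℝ) (α x x' : Fin p → ℝ) : ℝ :=
  ∑ i, logistic (α ⬝ᵥ C i) * (1 - logistic (α ⬝ᵥ C i)) * ((x ⬝ᵥ C i) * (x' ⬝ᵥ C i))

theorem logOdds_add_log (A x : ℝ) :
    A * Real.log (logistic x / (1 - logistic x)) + Real.log (1 - logistic x)
      = A * x - Real.log (1 + Real.exp x) := by
  have h1 : 1 - logistic x = (1 + Real.exp x)⁻¹ := by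
    unfold logistic
    have : 1 + Real.exp x ≠ 0 := by positivity
    field_simp
    ring
  have h2 : logistic x / (1 - logistic x) = Real.exp x := by
    rw [h1, logistic]
    have : 1 + Real.exp x ≠ 0 := by positivity
    field_simp
  rw [h2, h1, Real.log_exp, Real.log_inv]
  ring

theorem hasHessianAt_logLik {N : ℕ} (E : Matrix (Fin N) (Fin N) ℝ) (D : Obs N p) {φ : Param p}
    (h1 : 0 < φ.varY) (h2 : 0 < φ.varBY) (h3 : 0 < φ.varM) (h4 : 0 < φ.varBM) :
    HasHessianAt (logLik E D) φ (fun u w =>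
      -mixedForm (gramEig E) (gramRot E *ᵥ (D.Y - designY E D.C D.A D.M *ᵥ φ.beta))
          φ.varY φ.varBY (gramRot E *ᵥ (designY E D.C D.A D.M *ᵥ u.beta)) u.varY u.varBY
          (gramRot E *ᵥ (designY E D.C D.A D.M *ᵥ w.beta)) w.varY w.varBY
      + -mixedForm (gramEig E) (gramRot E *ᵥ (D.M - designM E D.C D.A *ᵥ φ.gamma))
          φ.varM φ.varBM (gramRot E *ᵥ (designM E D.C D.A *ᵥ u.gamma)) u.varM u.varBM
          (gramRot E *ᵥ (designM E D.C D.A *ᵥ w.gamma)) w.varM w.varBM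
      + -logisticForm D.C φ.alpha u.alpha w.alpha) := by
  set lam := gramEig E
  set R := gramRot E
  have hlam : ∀ i, 0 ≤ lam i := gramEig_nonneg E
  let vY : Fin N → Param p →L[ℝ] ℝ := fun i => LinearMap.toContinuousLinearMap
    (LinearMap.proj (Sum.inl (Sum.inr 0)) + lam i • LinearMap.proj (Sum.inl (Sum.inr 1)))
  let vM : Fin N → Param p →L[ℝ] ℝ := fun i => LinearMap.toContinuousLinearMap
    (LinearMap.proj (Sum.inr (Sum.inl (Sum.inr 0)))
      + lam i • LinearMap.proj (Sum.inr (Sum.inl (Sum.inr 1))))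
  let mY : Fin N → Param p →L[ℝ] ℝ := fun i => LinearMap.toContinuousLinearMap
    (LinearMap.proj i ∘ₗ (R.mulVecLin ∘ₗ (designY E D.C D.A D.M).mulVecLin)
      ∘ₗ LinearMap.funLeft ℝ ℝ (fun k => Sum.inl (Sum.inl k)))
  let mM : Fin N → Param p →L[ℝ] ℝ := fun i => LinearMap.toContinuousLinearMap
    (LinearMap.proj i ∘ₗ (R.mulVecLin ∘ₗ (designM E D.C D.A).mulVecLin)
      ∘ₗ LinearMap.funLeft ℝ ℝ (fun k => Sum.inr (Sum.inl (Sum.inl k))))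
  let aA : Fin N → Param p →L[ℝ] ℝ := fun i => LinearMap.toContinuousLinearMap
    (∑ k, D.C i k • LinearMap.proj (Sum.inr (Sum.inr k)))
  have hvY : ∀ i ψ, vY i ψ = ψ.varY + ψ.varBY * lam i := fun i ψ => by
    simp [vY, Param.varY, Param.varBY, mul_comm]
  have hvM : ∀ i ψ, vM i ψ = ψ.varM + ψ.varBM * lam i := fun i ψ => by
    simp [vM, Param.varM, Param.varBM, mul_comm]
  have hmY : ∀ i ψ, mY i ψ = (R *ᵥ (designY E D.C D.A D.M *ᵥ ψ.beta)) i := fun i ψ => rfl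
  have hmM : ∀ i ψ, mM i ψ = (R *ᵥ (designM E D.C D.A *ᵥ ψ.gamma)) i := fun i ψ => rfl
  have haA : ∀ i ψ, aA i ψ = ψ.alpha ⬝ᵥ D.C i := fun i ψ => by
    simp [aA, Param.alpha, dotProduct, mul_comm]
  -- The spectral form of the likelihood is used where the variance components are positive, hence
  -- on a neighbourhood of `φ`; this is enough for derivatives at `φ`.
  have hev : ∀ᶠ ψ : Param p in 𝓝 φ, 0 < ψ.varY ∧ 0 < ψ.varBY ∧ 0 < ψ.varM ∧ 0 < ψ.varBM := by
    have hc : ∀ k : Idx p, 0 < φ k → ∀ᶠ ψ : Param p in 𝓝 φ, 0 < ψ k := fun k hk =>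
      (continuous_apply k).continuousAt.eventually (lt_mem_nhds hk)
    exact (hc _ h1).and ((hc _ h2).and ((hc _ h3).and (hc _ h4)))
  have hY := HasHessianAt.sum (x := φ) Finset.univ fun i _ =>
    hasHessianAt_gaussTerm (vY i) (mY i) ((R *ᵥ D.Y) i)
      (by rw [hvY]; exact add_pos_of_pos_of_nonneg h1 (mul_nonneg h2.le (hlam i)))
  have hM := HasHessianAt.sum (x := φ) Finset.univ fun i _ =>
    hasHessianAt_gaussTerm (vM i) (mM i) ((R *ᵥ D.M) i)
      (by rw [hvM]; exact add_pos_of_pos_of_nonneg h3 (mul_nonneg h4.le (hlam i)))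
  have hA := HasHessianAt.sum (x := φ) Finset.univ fun i _ =>
    hasHessianAt_logisticTerm (aA i) (D.A i)
  have hall := ((((HasHessianAt.const (-((N : ℝ) / 2) * Real.log (2 * Real.pi))).add hY).add
    ((HasHessianAt.const (-((N : ℝ) / 2) * Real.log (2 * Real.pi))).add hM)).add hA).congr
    (g := logLik E D) ?_
  · convert hall using 3 with u w
    simp only [hvY, hvM, hmY, hmM, haA, mixedForm, logisticForm, zero_add, Finset.sum_neg_distrib,
      mulVec_sub, Pi.sub_apply]
  · filter_upwards [hev] with ψ hψ
    rw [logLik, gaussLogLik_covMat E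
      (fun i => add_pos_of_pos_of_nonneg hψ.1 (mul_nonneg hψ.2.1.le (hlam i))),
      gaussLogLik_covMat E
      (fun i => add_pos_of_pos_of_nonneg hψ.2.2.1 (mul_nonneg hψ.2.2.2.le (hlam i)))]
    simp only [hvY, hvM, hmY, hmM, haA]
    congr 1
    rw [← Finset.sum_add_distrib]
    exact Finset.sum_congr rfl fun i _ => logOdds_add_log _ _

theorem obsInfo_form {N : ℕ} (E : Matrix (Fin N) (Fin N) ℝ) (D : Obs N p) {φ : Param p}
    (h : 0 < φ.varY ∧ 0 < φ.varBY ∧ 0 < φ.varM ∧ 0 < φ.varBM) (u w : Param p) :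
    u ⬝ᵥ (obsInfo E D φ *ᵥ w) =
      mixedForm (gramEig E) (gramRot E *ᵥ (D.Y - designY E D.C D.A D.M *ᵥ φ.beta))
          φ.varY φ.varBY (gramRot E *ᵥ (designY E D.C D.A D.M *ᵥ u.beta)) u.varY u.varBY
          (gramRot E *ᵥ (designY E D.C D.A D.M *ᵥ w.beta)) w.varY w.varBY
      + mixedForm (gramEig E) (gramRot E *ᵥ (D.M - designM E D.C D.A *ᵥ φ.gamma))
          φ.varM φ.varBM (gramRot E *ᵥ (designM E D.C D.A *ᵥ u.gamma)) u.varM u.varBM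
          (gramRot E *ᵥ (designM E D.C D.A *ᵥ w.gamma)) w.varM w.varBM
      + logisticForm D.C φ.alpha u.alpha w.alpha := by
  have := (hasHessianAt_logLik E D h.1 h.2.1 h.2.2.1 h.2.2.2).dotProduct_hessian u w
  rw [obsInfo, neg_mulVec, dotProduct_neg, this]
  ring

end RENSEM

namespace RENSEM

variable {p : ℕ}

/-! ### Block structure of the information -/

theorem mixedForm_comm {N : ℕ} (lam r : Fin N → ℝ) (s t : ℝ) (m : Fin N → ℝ) (ds dt : ℝ)
    (m' : Fin N → ℝ) (ds' dt' : ℝ) :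
    mixedForm lam r s t m ds dt m' ds' dt' = mixedForm lam r s t m' ds' dt' m ds dt := by
  unfold mixedForm
  exact Finset.sum_congr rfl fun i _ => by ring

theorem mixedForm_zero_left {N : ℕ} (lam r : Fin N → ℝ) (s t : ℝ) (m' : Fin N → ℝ)
    (ds' dt' : ℝ) : mixedForm lam r s t 0 0 0 m' ds' dt' = 0 := by
  simp [mixedForm]

theorem mixedForm_zero_right {N : ℕ} (lam r : Fin N → ℝ) (s t : ℝ) (m : Fin N → ℝ)
    (ds dt : ℝ) : mixedForm lam r s t m ds dt 0 0 0 = 0 := by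
  rw [mixedForm_comm, mixedForm_zero_left]

theorem logisticForm_comm {N : ℕ} (C : Fin N → Fin p → ℝ) (α x x' : Fin p → ℝ) :
    logisticForm C α x x' = logisticForm C α x' x := by
  unfold logisticForm
  exact Finset.sum_congr rfl fun i _ => by ring

theorem logisticForm_zero_left {N : ℕ} (C : Fin N → Fin p → ℝ) (α x' : Fin p → ℝ) :
    logisticForm C α 0 x' = 0 := by
  simp [logisticForm]

theorem single_dotProduct_mulVec_single (J : Matrix (Idx p) (Idx p) ℝ) (k l : Idx p) :
    (Pi.single k 1 : Param p) ⬝ᵥ (J *ᵥ Pi.single l 1) = J k l := by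
  simp

theorem ext_of_dotProduct_mulVec {J K : Matrix (Idx p) (Idx p) ℝ}
    (h : ∀ u w : Param p, u ⬝ᵥ (J *ᵥ w) = u ⬝ᵥ (K *ᵥ w)) : J = K := by
  ext k l
  have := h (Pi.single k 1) (Pi.single l 1)
  rwa [single_dotProduct_mulVec_single, single_dotProduct_mulVec_single] at this

theorem obsInfo_isSymm {N : ℕ} (E : Matrix (Fin N) (Fin N) ℝ) (D : Obs N p) {φ : Param p}
    (h : 0 < φ.varY ∧ 0 < φ.varBY ∧ 0 < φ.varM ∧ 0 < φ.varBM) : (obsInfo E D φ).IsSymm := by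
  refine ext_of_dotProduct_mulVec fun u w => ?_
  rw [mulVec_transpose, dotProduct_comm, ← dotProduct_mulVec, obsInfo_form E D h,
    obsInfo_form E D h]
  congr 1
  · congr 1
    · exact mixedForm_comm ..
    · exact mixedForm_comm ..
  · exact logisticForm_comm ..

/-- The coordinates of the outcome model are separated from the others. -/
def IsSplit (J : Matrix (Idx p) (Idx p) ℝ) : Prop :=
  J.IsSymm ∧ ∀ k l, J (Sum.inl k) (Sum.inr l) = 0

/-- The log-likelihood is a sum of functions of disjoint groups of coordinates, so a mixed second
derivative across the groups vanishes. This is why no `β`–`γ` covariance occurs in the variance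
formulas. -/
theorem obsInfo_isSplit {N : ℕ} (E : Matrix (Fin N) (Fin N) ℝ) (D : Obs N p) {φ : Param p}
    (h : 0 < φ.varY ∧ 0 < φ.varBY ∧ 0 < φ.varM ∧ 0 < φ.varBM) : IsSplit (obsInfo E D φ) := by
  refine ⟨obsInfo_isSymm E D h, fun k l => ?_⟩
  have hform := obsInfo_form E D h (Pi.single (Sum.inl k) 1) (Pi.single (Sum.inr l) 1)
  rw [single_dotProduct_mulVec_single] at hform
  rw [hform]
  have h1 : Param.gamma (Pi.single (Sum.inl k) 1 : Param p) = 0 := by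
    funext j; simp [Param.gamma]
  have h2 : Param.alpha (Pi.single (Sum.inl k) 1 : Param p) = 0 := by
    funext j; simp [Param.alpha]
  have h3 : Param.varM (Pi.single (Sum.inl k) 1 : Param p) = 0 := by simp [Param.varM]
  have h4 : Param.varBM (Pi.single (Sum.inl k) 1 : Param p) = 0 := by simp [Param.varBM]
  have h5 : Param.beta (Pi.single (Sum.inr l) 1 : Param p) = 0 := by
    funext j; simp [Param.beta]
  have h6 : Param.varY (Pi.single (Sum.inr l) 1 : Param p) = 0 := by simp [Param.varY]
  have h7 : Param.varBY (Pi.single (Sum.inr l) 1 : Param p) = 0 := by simp [Param.varBY]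
  simp [h1, h2, h3, h4, h5, h6, h7, mixedForm_zero_left, mixedForm_zero_right,
    logisticForm_zero_left]

/-- Block diagonality is commutation with the coordinate projection `Q`, and whatever commutes with
`J` commutes with `J⁻¹`. -/
theorem IsSplit.inv {J : Matrix (Idx p) (Idx p) ℝ} (hJ : IsSplit J) : IsSplit J⁻¹ := by
  refine ⟨hJ.1.inv, fun k l => ?_⟩
  by_cases hu : IsUnit J.det
  · set Q : Matrix (Idx p) (Idx p) ℝ := diagonal (Sum.elim (fun _ => 1) (fun _ => 0)) with hQ
    have hcomm : Q * J = J * Q := by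
      ext i j
      rw [hQ, diagonal_mul, mul_diagonal]
      rcases i with i | i <;> rcases j with j | j
      · simp
      · simp [hJ.2]
      · have := hJ.1.apply (Sum.inl j) (Sum.inr i)
        simp [this, hJ.2]
      · simp
    have hinv : Q * J⁻¹ = J⁻¹ * Q := by
      calc Q * J⁻¹ = J⁻¹ * (J * Q) * J⁻¹ := by
            rw [← Matrix.mul_assoc, nonsing_inv_mul _ hu, Matrix.one_mul]
        _ = J⁻¹ * Q := by
            rw [← hcomm, Matrix.mul_assoc, Matrix.mul_assoc, mul_nonsing_inv _ hu, Matrix.mul_one]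
    have := congrFun (congrFun hinv (Sum.inl k)) (Sum.inr l)
    rw [hQ, diagonal_mul, mul_diagonal] at this
    simpa using this
  -- The inverse of a singular matrix is zero by convention.
  · rw [nonsing_inv_apply_not_isUnit _ hu]
    rfl

/-! ### The delta method -/

theorem hasFDerivAt_coord (k : Idx p) (φ : Param p) :
    HasFDerivAt (fun φ : Param p => φ k)
      (ContinuousLinearMap.proj k : Param p →L[ℝ] ℝ) φ :=
  hasFDerivAt_apply k φ

theorem grad_of_hasFDerivAt {g : Param p → ℝ} {φ : Param p} {L : Param p →L[ℝ] ℝ}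
    (h : HasFDerivAt g L φ) : grad g φ = fun k => L (Pi.single k 1) := by
  funext k
  rw [grad, h.fderiv]

theorem sandwich_estimand {N : ℕ} (E : Matrix (Fin N) (Fin N) ℝ) (a a' s s' : ℝ)
    {V : Matrix (Idx p) (Idx p) ℝ} (hV : IsSplit V) (φ : Param p) (k : Fin 6) :
    sandwich (estimand E a a' s s' k) V φ = varEstimator E a a' s s' V φ k := by
  have h0 : ∀ i j, V (Sum.inl i) (Sum.inr j) = 0 := hV.2
  have h1 : ∀ i j, V (Sum.inr j) (Sum.inl i) = 0 := fun i j => by rw [hV.1.apply]; exact h0 i j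
  have h2 := hV.1.apply (iGamma p 1) (iGamma p 2)
  have hsingle : ∀ k, (fun l : Idx p => (Pi.single l (1 : ℝ) : Param p) k) = Pi.single k 1 := by
    intro k
    funext l
    simp only [Pi.single_apply]
    by_cases h : k = l
    · subst h; simp
    · rw [if_neg h, if_neg (Ne.symm h)]
  have hc := fun k => hasFDerivAt_coord (p := p) k φ
  -- Every estimand depends on at most three coordinates, so one expansion serves all six. Unused
  -- slots carry the coefficient 0 and the dummy index `iBeta p 1`.
  have key : ∀ (g : Param p → ℝ) (c1 c2 c3 : ℝ) (k1 k2 k3 : Idx p),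
      HasFDerivAt g (c1 • (ContinuousLinearMap.proj k1 : Param p →L[ℝ] ℝ)
        + c2 • (ContinuousLinearMap.proj k2 : Param p →L[ℝ] ℝ)
        + c3 • (ContinuousLinearMap.proj k3 : Param p →L[ℝ] ℝ)) φ →
      sandwich g V φ = c1 * (c1 * V k1 k1 + c2 * V k1 k2 + c3 * V k1 k3)
        + c2 * (c1 * V k2 k1 + c2 * V k2 k2 + c3 * V k2 k3)
        + c3 * (c1 * V k3 k1 + c2 * V k3 k2 + c3 * V k3 k3) := by
    intro g c1 c2 c3 k1 k2 k3 hg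
    have : grad g φ = c1 • (Pi.single k1 1 : Param p) + c2 • (Pi.single k2 1 : Param p)
        + c3 • (Pi.single k3 1 : Param p) := by
      rw [grad_of_hasFDerivAt hg, ← hsingle k1, ← hsingle k2, ← hsingle k3]
      funext l
      simp
    rw [sandwich, this]
    simp only [mulVec_add, mulVec_smul, add_dotProduct, dotProduct_add, smul_dotProduct,
      dotProduct_smul, single_dotProduct_mulVec_single, smul_eq_mul]
    ring
  have hb1 : HasFDerivAt (estimand E a a' s s' 0)
      ((a - a') • (ContinuousLinearMap.proj (iBeta p 1) : Param p →L[ℝ] ℝ)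
        + (0 : ℝ) • (ContinuousLinearMap.proj (iBeta p 1) : Param p →L[ℝ] ℝ)
        + (0 : ℝ) • (ContinuousLinearMap.proj (iBeta p 1) : Param p →L[ℝ] ℝ)) φ := by
    refine ((hc (iBeta p 1)).mul_const (a - a')).congr_fderiv ?_
    ext; simp
  have hb2 : HasFDerivAt (estimand E a a' s s' 1)
      ((φ (iGamma p 1) * (a - a')) • (ContinuousLinearMap.proj (iBeta p 3) : Param p →L[ℝ] ℝ)
        + (φ (iBeta p 3) * (a - a')) •
          (ContinuousLinearMap.proj (iGamma p 1) : Param p →L[ℝ] ℝ)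
        + (0 : ℝ) • (ContinuousLinearMap.proj (iBeta p 1) : Param p →L[ℝ] ℝ)) φ := by
    refine (((hc (iBeta p 3)).mul (hc (iGamma p 1))).mul_const (a - a')).congr_fderiv ?_
    ext; simp; ring
  have hb3 : HasFDerivAt (estimand E a a' s s' 2)
      ((φ (iGamma p 2) * ((a - a') * Delta1 E)) •
          (ContinuousLinearMap.proj (iBeta p 4) : Param p →L[ℝ] ℝ)
        + (φ (iBeta p 4) * ((a - a') * Delta1 E)) •
          (ContinuousLinearMap.proj (iGamma p 2) : Param p →L[ℝ] ℝ)
        + (0 : ℝ) • (ContinuousLinearMap.proj (iBeta p 1) : Param p →L[ℝ] ℝ)) φ := by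
    refine ((((hc (iBeta p 4)).mul (hc (iGamma p 2))).mul_const (a - a')).mul_const
      (Delta1 E)).congr_fderiv ?_
    ext; simp; ring
  have hb4 : HasFDerivAt (estimand E a a' s s' 3)
      (Delta2 E s s' • (ContinuousLinearMap.proj (iBeta p 2) : Param p →L[ℝ] ℝ)
        + (0 : ℝ) • (ContinuousLinearMap.proj (iBeta p 1) : Param p →L[ℝ] ℝ)
        + (0 : ℝ) • (ContinuousLinearMap.proj (iBeta p 1) : Param p →L[ℝ] ℝ)) φ := by
    refine ((hc (iBeta p 2)).mul_const (Delta2 E s s')).congr_fderiv ?_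
    ext; simp
  have hb5 : HasFDerivAt (estimand E a a' s s' 4)
      ((φ (iGamma p 2) * Delta2 E s s') •
          (ContinuousLinearMap.proj (iBeta p 3) : Param p →L[ℝ] ℝ)
        + (φ (iBeta p 3) * Delta2 E s s') •
          (ContinuousLinearMap.proj (iGamma p 2) : Param p →L[ℝ] ℝ)
        + (0 : ℝ) • (ContinuousLinearMap.proj (iBeta p 1) : Param p →L[ℝ] ℝ)) φ := by
    refine (((hc (iBeta p 3)).mul (hc (iGamma p 2))).mul_const (Delta2 E s s')).congr_fderiv ?_
    ext; simp; ring
  have hb6 : HasFDerivAt (estimand E a a' s s' 5)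
      ((φ (iGamma p 1) * Delta2 E s s' + φ (iGamma p 2) * Delta3 E s s') •
          (ContinuousLinearMap.proj (iBeta p 4) : Param p →L[ℝ] ℝ)
        + (φ (iBeta p 4) * Delta2 E s s') •
          (ContinuousLinearMap.proj (iGamma p 1) : Param p →L[ℝ] ℝ)
        + (φ (iBeta p 4) * Delta3 E s s') •
          (ContinuousLinearMap.proj (iGamma p 2) : Param p →L[ℝ] ℝ)) φ := by
    refine ((((hc (iBeta p 4)).mul (hc (iGamma p 1))).mul_const (Delta2 E s s')).add
      (((hc (iBeta p 4)).mul (hc (iGamma p 2))).mul_const (Delta3 E s s'))).congr_fderiv ?_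
    ext; simp; ring
  fin_cases k
  · exact (key _ _ _ _ _ _ _ hb1).trans (by simp [varEstimator]; ring)
  · exact (key _ _ _ _ _ _ _ hb2).trans (by simp [varEstimator, h0, h1]; ring)
  · exact (key _ _ _ _ _ _ _ hb3).trans (by simp [varEstimator, h0, h1]; ring)
  · exact (key _ _ _ _ _ _ _ hb4).trans (by simp [varEstimator]; ring)
  · exact (key _ _ _ _ _ _ _ hb5).trans (by simp [varEstimator, h0, h1]; ring)
  · exact (key _ _ _ _ _ _ _ hb6).trans (by
      simp only [varEstimator, h0, h1, h2]
      simp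
      ring)

/-! ### Boundedness of the network averages -/

section Network

variable {N : ℕ} {E : Matrix (Fin N) (Fin N) ℝ}

theorem IsAdjacency.nonneg (hE : IsAdjacency E) (i j : Fin N) : 0 ≤ E i j := by
  rcases hE.binary i j with h | h <;> simp [h]

theorem IsAdjacency.degree_eq_natCast (hE : IsAdjacency E) (i : Fin N) :
    ∃ n : ℕ, degree E i = n := by
  refine ⟨((Finset.univ.filter (fun j => j ≠ i)).filter (fun j => E i j = 1)).card, ?_⟩
  rw [degree, Finset.card_filter, Nat.cast_sum]
  refine Finset.sum_congr rfl fun j _ => ?_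
  rcases hE.binary i j with h | h <;> simp [h]

/-- The degree is an integer `n`, so for `s ∈ [0, 1]` rounding `s n` cannot leave `{0, …, n}`, and
both plausible exposures lie in `[0, 1]`. -/
theorem abs_plausible_sub_le_one (hE : IsAdjacency E) {s s' : ℝ}
    (hs : s ∈ Set.Icc (0 : ℝ) 1) (hs' : s' ∈ Set.Icc (0 : ℝ) 1) (i : Fin N) :
    |plausible E s i - plausible E s' i| ≤ 1 := by
  have key : ∀ s ∈ Set.Icc (0 : ℝ) 1, 0 ≤ plausible E s i ∧ plausible E s i ≤ 1 := by
    rintro s ⟨h0, h1⟩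
    obtain ⟨n, hn⟩ := hE.degree_eq_natCast i
    have hn0 : (0 : ℝ) ≤ n := Nat.cast_nonneg n
    rw [plausible, hn]
    have h2 : 0 ≤ round (s * n) := by
      rw [round_eq]
      exact Int.floor_nonneg.mpr (by positivity)
    have h3 : round (s * n) ≤ (n : ℤ) := by
      rw [round_eq, ← Int.lt_add_one_iff, Int.floor_lt]
      push_cast
      nlinarith
    constructor
    · have : (0 : ℝ) ≤ (round (s * n) : ℝ) := by exact_mod_cast h2
      positivity
    · refine div_le_one_of_le₀ ?_ hn0
      exact_mod_cast h3
  have h1 := key s hs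
  have h2 := key s' hs'
  rw [abs_le]
  constructor <;> linarith

theorem abs_mean_le_one {f : Fin N → ℝ} (h : ∀ i, |f i| ≤ 1) : |(1 / (N : ℝ)) * ∑ i, f i| ≤ 1 := by
  rw [abs_mul, abs_of_nonneg (by positivity : (0 : ℝ) ≤ 1 / N)]
  have : |∑ i, f i| ≤ N := by
    refine (Finset.abs_sum_le_sum_abs _ _).trans ((Finset.sum_le_sum fun i _ => h i).trans ?_)
    simp
  rw [one_div_mul_eq_div]
  exact div_le_one_of_le₀ this (Nat.cast_nonneg N)

/-- A positive integer degree is at least 1, so the factor `1 / n_j` may be dropped; what remains is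
the row sum `n_i / n_i`. -/
theorem abs_Delta1_le_one (hE : IsAdjacency E) (hdeg : ∀ i, 0 < degree E i) :
    |Delta1 E| ≤ 1 := by
  refine abs_mean_le_one fun i => ?_
  have hone : ∀ j, 1 ≤ degree E j := fun j => by
    obtain ⟨n, hn⟩ := hE.degree_eq_natCast j
    have := hdeg j
    rw [hn] at this ⊢
    exact_mod_cast this
  have hle : ∑ j ∈ Finset.univ.filter (fun j => j ≠ i), E i j / (degree E i * degree E j)
      ≤ ∑ j ∈ Finset.univ.filter (fun j => j ≠ i), E i j / degree E i := by
    refine Finset.sum_le_sum fun j _ => ?_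
    refine div_le_div_of_nonneg_left (hE.nonneg i j) (hdeg i) ?_
    nlinarith [hone j, hdeg i]
  rw [abs_of_nonneg (Finset.sum_nonneg fun j _ =>
    div_nonneg (hE.nonneg i j) (mul_pos (hdeg i) (hdeg j)).le)]
  refine hle.trans ?_
  rw [← Finset.sum_div]
  exact (div_self (hdeg i).ne').le

theorem abs_Delta2_le_one (hE : IsAdjacency E) {s s' : ℝ}
    (hs : s ∈ Set.Icc (0 : ℝ) 1) (hs' : s' ∈ Set.Icc (0 : ℝ) 1) : |Delta2 E s s'| ≤ 1 :=
  abs_mean_le_one fun i => abs_plausible_sub_le_one hE hs hs' i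

/-- The inner sum over `k` is at most `E_ij n_j`, which cancels `1 / n_j`; the sum over `j` is then
again `n_i / n_i`. -/
theorem abs_Delta3_le_one (hE : IsAdjacency E) (hdeg : ∀ i, 0 < degree E i) {s s' : ℝ}
    (hs : s ∈ Set.Icc (0 : ℝ) 1) (hs' : s' ∈ Set.Icc (0 : ℝ) 1) : |Delta3 E s s'| ≤ 1 := by
  refine abs_mean_le_one fun i => ?_
  have hpl := abs_plausible_sub_le_one hE hs hs' i
  have hterm : ∀ j, |1 / (degree E i * degree E j) *
      ∑ k ∈ Finset.univ.filter (fun k => k ≠ j ∧ k ≠ i ∧ E i k = 1),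
        E i j * E j k * (plausible E s i - plausible E s' i)| ≤ E i j / degree E i := by
    intro j
    have hsum : |∑ k ∈ Finset.univ.filter (fun k => k ≠ j ∧ k ≠ i ∧ E i k = 1),
        E i j * E j k * (plausible E s i - plausible E s' i)| ≤ E i j * degree E j := by
      rw [degree, Finset.mul_sum]
      refine (Finset.abs_sum_le_sum_abs _ _).trans ?_
      refine (Finset.sum_le_sum (g := fun k => E i j * E j k) fun k _ => ?_).trans ?_
      · rw [abs_mul, abs_of_nonneg (mul_nonneg (hE.nonneg i j) (hE.nonneg j k))]
        exact mul_le_of_le_one_right (mul_nonneg (hE.nonneg i j) (hE.nonneg j k)) hpl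
      · refine Finset.sum_le_sum_of_subset_of_nonneg ?_ fun k _ _ =>
          mul_nonneg (hE.nonneg i j) (hE.nonneg j k)
        intro k hk
        simp only [Finset.mem_filter, Finset.mem_univ, true_and] at hk ⊢
        exact hk.1
    have hi := hdeg i
    have hj := hdeg j
    rw [abs_mul, abs_of_nonneg (by positivity)]
    calc 1 / (degree E i * degree E j) * _ ≤ 1 / (degree E i * degree E j)
          * (E i j * degree E j) := by gcongr
      _ = E i j / degree E i := by field_simp
  refine (Finset.abs_sum_le_sum_abs _ _).trans ((Finset.sum_le_sum fun j _ => hterm j).trans ?_)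
  rw [← Finset.sum_div]
  exact (div_self (hdeg i).ne').le

end Network

/-- Only the `β`-diagonal and the `γ`-block of `j` have to be small; nothing is required of the
exposure block. The worst case is the sixth formula, which gives `(4 + 2 + 2) K² e`. -/
theorem abs_varEstimator_le {N : ℕ} {E : Matrix (Fin N) (Fin N) ℝ} (hE : IsAdjacency E)
    (hdeg : ∀ i, 0 < degree E i) {a a' s s' : ℝ} (ha : a = 0 ∨ a = 1) (ha' : a' = 0 ∨ a' = 1)
    (hs : s ∈ Set.Icc (0 : ℝ) 1) (hs' : s' ∈ Set.Icc (0 : ℝ) 1)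
    {j : Matrix (Idx p) (Idx p) ℝ} {φ : Param p} {K e : ℝ} (hK : 1 ≤ K)
    (hφ : ∀ k, |φ k| ≤ K) (hb : ∀ k, |j (iBeta p k) (iBeta p k)| ≤ e)
    (hg : ∀ k l, |j (iGamma p k) (iGamma p l)| ≤ e) (k : Fin 6) :
    |varEstimator E a a' s s' j φ k| ≤ 10 * K ^ 2 * e := by
  have he : 0 ≤ e := (abs_nonneg _).trans (hb 0)
  have hK0 : 0 ≤ K := by linarith
  have hda : |a - a'| ≤ 1 := by rcases ha with rfl | rfl <;> rcases ha' with rfl | rfl <;> norm_num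
  have h1 := abs_Delta1_le_one hE hdeg
  have h2 := abs_Delta2_le_one hE hs hs'
  have h3 := abs_Delta3_le_one hE hdeg hs hs'
  have hsq : ∀ {x c : ℝ}, |x| ≤ c → |x ^ 2| ≤ c ^ 2 := fun {x c} h => by
    rw [abs_pow]; exact pow_le_pow_left₀ (abs_nonneg _) h 2
  have hmul : ∀ {x y c d : ℝ}, |x| ≤ c → |y| ≤ d → |x * y| ≤ c * d := fun {x y c d} hx hy => by
    rw [abs_mul]; exact mul_le_mul hx hy (abs_nonneg _) ((abs_nonneg _).trans hx)
  have hadd : ∀ {x y c d : ℝ}, |x| ≤ c → |y| ≤ d → |x + y| ≤ c + d := fun {x y c d} hx hy =>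
    (abs_add_le x y).trans (add_le_add hx hy)
  have hKK : 1 ≤ K ^ 2 := one_le_pow₀ hK
  have hKe : 0 ≤ K ^ 2 * e := by positivity
  have heK : e ≤ K ^ 2 * e := le_mul_of_one_le_left he hKK
  fin_cases k
  · exact (hmul (hb 1) (hsq hda)).trans (by nlinarith)
  · exact (hmul (hadd (hmul (hsq (hφ _)) (hb 3)) (hmul (hsq (hφ _)) (hg 1 1)))
      (hsq hda)).trans (by nlinarith)
  · exact (hmul (hmul (hadd (hmul (hsq (hφ _)) (hb 4)) (hmul (hsq (hφ _)) (hg 2 2)))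
      (hsq hda)) (hsq h1)).trans (by nlinarith)
  · exact (hmul (hb 2) (hsq h2)).trans (by nlinarith)
  · exact (hmul (hadd (hmul (hsq (hφ _)) (hb 3)) (hmul (hsq (hφ _)) (hg 2 2)))
      (hsq h2)).trans (by nlinarith)
  · exact (hadd (hadd (hmul (hb 4) (hsq (hadd (hmul (hφ _) h2) (hmul (hφ _) h3))))
      (hmul (hsq (hφ _)) (hadd (hmul (hg 1 1) (hsq h2)) (hmul (hg 2 2) (hsq h3)))))
      (hmul (hmul (hmul (hmul (abs_le.mpr ⟨by norm_num, le_rfl⟩ : |(2 : ℝ)| ≤ 2) (hsq (hφ _)))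
        (hg 1 2)) h2) h3)).trans (by nlinarith)

end RENSEM

namespace RENSEM

/-! ### Second moments under product laws -/

theorem lintegral_sq_eq_of_integral_eq_zero {X : Type*} [MeasurableSpace X] {μ : Measure X}
    [IsProbabilityMeasure μ] {f : X → ℝ} (hf : MemLp f 2 μ) :
    ∫⁻ x, ENNReal.ofReal (f x ^ 2) ∂μ = ENNReal.ofReal (∫ x, f x ^ 2 ∂μ) := by
  rw [ofReal_integral_eq_lintegral_ofReal hf.integrable_sq
    (Eventually.of_forall fun x => sq_nonneg _)]

theorem lintegral_sq_sum_pi {N : ℕ} {X : Fin N → Type*} [∀ i, MeasurableSpace (X i)]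
    {μ : ∀ i, Measure (X i)} [∀ i, IsProbabilityMeasure (μ i)] {f : ∀ i, X i → ℝ}
    (hf : ∀ i, MemLp (f i) 2 (μ i)) (h0 : ∀ i, ∫ x, f i x ∂μ i = 0) (a : Fin N → ℝ) :
    ∫⁻ x, ENNReal.ofReal ((∑ i, a i * f i (x i)) ^ 2) ∂Measure.pi μ
      = ENNReal.ofReal (∑ i, a i ^ 2 * ∫ x, f i x ^ 2 ∂μ i) := by
  have hg : ∀ i, MemLp (fun x => a i * f i x) 2 (μ i) := fun i => (hf i).const_mul (a i)
  have hge : ∀ i, MemLp (fun x : ∀ i, X i => a i * f i (x i)) 2 (Measure.pi μ) := fun i =>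
    (hg i).comp_measurePreserving (measurePreserving_eval μ i)
  have hL : MemLp (fun x : ∀ i, X i => ∑ i, a i * f i (x i)) 2 (Measure.pi μ) :=
    memLp_finsetSum _ fun i _ => hge i
  have hmean : ∫ x : ∀ i, X i, ∑ i, a i * f i (x i) ∂Measure.pi μ = 0 := by
    rw [integral_finsetSum _ fun i _ => (hge i).integrable one_le_two]
    refine Finset.sum_eq_zero fun i _ => ?_
    rw [integral_const_mul, integral_comp_eval (hf i).1, h0, mul_zero]
  rw [lintegral_sq_eq_of_integral_eq_zero hL,
    ← variance_of_integral_eq_zero hL.1.aemeasurable hmean]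
  have h1 := variance_sum_pi hg
  have h2 : (∑ i, fun ω : ∀ i, X i => a i * f i (ω i)) = fun x => ∑ i, a i * f i (x i) := by
    funext x
    simp
  rw [h2] at h1
  rw [h1]
  congr 1
  refine Finset.sum_congr rfl fun i _ => ?_
  rw [variance_const_mul, variance_of_integral_eq_zero (hf i).1.aemeasurable (h0 i)]

instance isProbabilityMeasure_stdNormal (N : ℕ) : IsProbabilityMeasure (stdNormal N) := by
  unfold stdNormal; infer_instance

instance isProbabilityMeasure_unitInterval :
    IsProbabilityMeasure ((volume : Measure ℝ).restrict (Set.Icc 0 1)) :=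
  ⟨by simp⟩

instance isProbabilityMeasure_stdUniform (N : ℕ) : IsProbabilityMeasure (stdUniform N) := by
  unfold stdUniform; infer_instance

theorem integral_sq_stdGaussian : ∫ x, x ^ 2 ∂gaussianReal 0 1 = 1 := by
  have h := variance_fun_id_gaussianReal (μ := 0) (v := 1)
  rw [variance_of_integral_eq_zero aemeasurable_id' (by simp)] at h
  simpa using h

theorem memLp_sq_sub_one : MemLp (fun x : ℝ => x ^ 2 - 1) 2 (gaussianReal 0 1) := by
  have h4 : MemLp (id : ℝ → ℝ) 4 (gaussianReal 0 1) := memLp_id_gaussianReal 4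
  have h : MemLp (fun x : ℝ => x ^ 2) 2 (gaussianReal 0 1) := by
    have := h4.mul (p := 4) (q := 4) (r := 2) h4 (hpqr := ⟨by
      rw [← two_mul, show (4 : ENNReal) = 2 * 2 by norm_num, ENNReal.mul_inv (by simp) (by simp),
        ← mul_assoc, ENNReal.mul_inv_cancel (by simp) (by simp), one_mul]⟩)
    refine this.congr_norm (by fun_prop) (Eventually.of_forall fun x => ?_)
    simp [sq]
  exact h.sub (memLp_const 1)

/-- The variance of the square of a standard normal variable. -/
noncomputable def sqVariance : ℝ := ∫ x, (x ^ 2 - 1) ^ 2 ∂gaussianReal 0 1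

theorem sqVariance_nonneg : 0 ≤ sqVariance := integral_nonneg fun _ => sq_nonneg _

theorem lintegral_sq_sum_stdNormal {N : ℕ} (a : Fin N → ℝ) :
    ∫⁻ z, ENNReal.ofReal ((∑ i, a i * z i) ^ 2) ∂stdNormal N
      = ENNReal.ofReal (1 * ∑ i, a i ^ 2) := by
  have h := lintegral_sq_sum_pi (N := N) (μ := fun _ => gaussianReal 0 1) (f := fun _ x => x)
    (fun _ => memLp_id_gaussianReal 2) (fun _ => by simp) a
  rw [stdNormal, h]
  simp [integral_sq_stdGaussian]

theorem lintegral_sq_sum_stdNormal_sq {N : ℕ} (a : Fin N → ℝ) :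
    ∫⁻ z, ENNReal.ofReal ((∑ i, a i * (z i ^ 2 - 1)) ^ 2) ∂stdNormal N
      = ENNReal.ofReal (sqVariance * ∑ i, a i ^ 2) := by
  have h := lintegral_sq_sum_pi (N := N) (μ := fun _ => gaussianReal 0 1)
    (f := fun _ x => x ^ 2 - 1) (fun _ => memLp_sq_sub_one) (fun _ => by
      have hi : Integrable (fun x : ℝ => x ^ 2) (gaussianReal 0 1) :=
        (memLp_id_gaussianReal 2).integrable_sq
      rw [integral_sub hi (integrable_const _)]
      simp [integral_sq_stdGaussian]) a
  rw [stdNormal, h, Finset.mul_sum]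
  simp_rw [sqVariance, mul_comm]

/-! ### Linear images of standard normal vectors -/

theorem integral_cexp_dotProduct_stdNormal {N : ℕ} (c : Fin N → ℝ) :
    ∫ x, Complex.exp (((c ⬝ᵥ x : ℝ) : ℂ) * Complex.I) ∂stdNormal N
      = Complex.exp (-((c ⬝ᵥ c : ℝ) : ℂ) / 2) := by
  have h : ∀ x : Fin N → ℝ, Complex.exp (((c ⬝ᵥ x : ℝ) : ℂ) * Complex.I)
      = ∏ i, Complex.exp (((c i : ℂ) * (x i : ℂ)) * Complex.I) := fun x => by
    rw [← Complex.exp_sum, ← Finset.sum_mul]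
    congr 2
    simp [dotProduct]
  simp_rw [h, stdNormal]
  rw [integral_fintype_prod_eq_prod (f := fun i (x : ℝ) =>
    Complex.exp (((c i : ℂ) * (x : ℂ)) * Complex.I))]
  simp_rw [← charFun_apply_real, charFun_gaussianReal]
  rw [← Complex.exp_sum]
  congr 1
  simp [dotProduct, Finset.sum_div, neg_div, sq]

/-- Comparison of characteristic functions: the exponent at `c` is `-(|Aᵀc|² + |Bᵀc|²) / 2`, which
equals `-|c|² / 2` by hypothesis. -/
theorem map_linear_stdNormal {N : ℕ} {A B : Matrix (Fin N) (Fin N) ℝ}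
    (h : A * Aᵀ + B * Bᵀ = 1) :
    ((stdNormal N).prod (stdNormal N)).map (fun x => A *ᵥ x.1 + B *ᵥ x.2) = stdNormal N := by
  have hmeas : Measurable fun x : (Fin N → ℝ) × (Fin N → ℝ) => A *ᵥ x.1 + B *ᵥ x.2 := by
    refine measurable_pi_lambda _ fun i => ?_
    simp only [Pi.add_apply, mulVec, dotProduct]
    fun_prop
  have : IsProbabilityMeasure (((stdNormal N).prod (stdNormal N)).map
      (fun x => A *ᵥ x.1 + B *ᵥ x.2)) := Measure.isProbabilityMeasure_map hmeas.aemeasurable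
  refine Measure.ext_of_charFunDual ?_
  funext L
  obtain ⟨c, hc⟩ : ∃ c : Fin N → ℝ, ∀ x, L x = c ⬝ᵥ x := by
    refine ⟨fun i => L (Pi.single i 1), fun x => ?_⟩
    have := LinearMap.pi_apply_eq_sum_univ (L : (Fin N → ℝ) →ₗ[ℝ] ℝ) x
    have h2 : ∀ i : Fin N, (fun j => if i = j then (1 : ℝ) else 0) = Pi.single i 1 := fun i => by
      funext j
      simp [Pi.single_apply, eq_comm]
    simp only [h2] at this
    rw [dotProduct]
    refine this.trans (Finset.sum_congr rfl fun i _ => ?_)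
    simp [mul_comm]
  rw [charFunDual_apply, charFunDual_apply, integral_map hmeas.aemeasurable (by fun_prop)]
  simp only [hc]
  have hsplit : ∀ x : (Fin N → ℝ) × (Fin N → ℝ),
      Complex.exp (((c ⬝ᵥ (A *ᵥ x.1 + B *ᵥ x.2) : ℝ) : ℂ) * Complex.I)
      = Complex.exp (((c ᵥ* A ⬝ᵥ x.1 : ℝ) : ℂ) * Complex.I)
        * Complex.exp (((c ᵥ* B ⬝ᵥ x.2 : ℝ) : ℂ) * Complex.I) := fun x => by
    rw [dotProduct_add, dotProduct_mulVec, dotProduct_mulVec, ← Complex.exp_add]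
    push_cast
    rw [add_mul]
  simp_rw [hsplit]
  rw [integral_prod_mul (fun x => Complex.exp (((c ᵥ* A ⬝ᵥ x : ℝ) : ℂ) * Complex.I))
    (fun x => Complex.exp (((c ᵥ* B ⬝ᵥ x : ℝ) : ℂ) * Complex.I)),
    integral_cexp_dotProduct_stdNormal, integral_cexp_dotProduct_stdNormal,
    integral_cexp_dotProduct_stdNormal, ← Complex.exp_add]
  congr 1
  have hq : c ᵥ* A ⬝ᵥ c ᵥ* A + c ᵥ* B ⬝ᵥ c ᵥ* B = c ⬝ᵥ c := by
    have h1 : ∀ D : Matrix (Fin N) (Fin N) ℝ, c ᵥ* D ⬝ᵥ c ᵥ* D = c ⬝ᵥ ((D * Dᵀ) *ᵥ c) :=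
      fun D => by rw [← mulVec_mulVec, mulVec_transpose, dotProduct_mulVec]
    rw [h1, h1, ← dotProduct_add, ← add_mulVec, h, one_mulVec]
  rw [← hq]
  push_cast
  ring

/-! ### A uniform bound for linear functionals of white noise -/

/-- Coordinates in which `B` becomes the identity: `M` passes to them, and the columns of `T` are
`B`-orthonormal. -/
theorem exists_factor_of_posDef {q : Type*} [Fintype q] [DecidableEq q] {B : Matrix q q ℝ}
    (hB : B.PosDef) : ∃ M T : Matrix q q ℝ, Mᵀ * M = B ∧ T * M = 1 ∧ M * T = 1 := by
  obtain ⟨M, hM⟩ : ∃ M : Matrix q q ℝ, B = star M * M := by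
    open scoped MatrixOrder in
    exact CStarAlgebra.nonneg_iff_eq_star_mul_self.mp hB.posSemidef.nonneg
  have hM' : Mᵀ * M = B := by
    rw [hM, star_eq_conjTranspose, conjTranspose_eq_transpose_of_trivial]
  have hdet : IsUnit M.det := by
    have h := hB.det_pos
    rw [← hM', det_mul, det_transpose] at h
    exact isUnit_iff_ne_zero.mpr fun h0 => by simp [h0] at h
  exact ⟨M, M⁻¹, hM', nonsing_inv_mul _ hdet, mul_nonsing_inv _ hdet⟩

theorem dotProduct_transpose_mul_mulVec {n q : Type*} [Fintype n] [Fintype q] (M : Matrix n q ℝ)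
    (b : q → ℝ) :
    b ⬝ᵥ ((Mᵀ * M) *ᵥ b) = ∑ k, (M *ᵥ b) k ^ 2 := by
  rw [← mulVec_mulVec, dotProduct_mulVec, vecMul_transpose, dotProduct]
  simp [sq]

/-- Conditionally on the design `x`, the second moment of the sum is at most `c ∑ a_i²`; the first
moment follows from `|r| ≤ 1 + r²`. -/
theorem lintegral_enorm_sum_mul_le {N : ℕ} {X Z : Type*} [MeasurableSpace X] [MeasurableSpace Z]
    (μ : Measure X) [IsProbabilityMeasure μ] (ν : Measure Z) [IsProbabilityMeasure ν]
    {a : X → Fin N → ℝ} (ha : ∀ i, Measurable fun x => a x i) {ξ : Z → Fin N → ℝ}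
    (hξ : ∀ i, Measurable fun z => ξ z i) {c D : ℝ} (hc : 0 ≤ c) (hD : 0 ≤ D)
    (hwhite : ∀ a : Fin N → ℝ, ∫⁻ z, ENNReal.ofReal ((∑ i, a i * ξ z i) ^ 2) ∂ν
      ≤ ENNReal.ofReal (c * ∑ i, a i ^ 2))
    (haD : ∫⁻ x, ENNReal.ofReal (∑ i, a x i ^ 2) ∂μ ≤ ENNReal.ofReal D) :
    ∫⁻ w, ‖∑ i, a w.1 i * ξ w.2 i‖ₑ ∂(μ.prod ν) ≤ ENNReal.ofReal (1 + c * D) := by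
  have hm : Measurable fun w : X × Z => ∑ i, a w.1 i * ξ w.2 i :=
    Finset.measurable_sum _ fun i _ =>
      ((ha i).comp measurable_fst).mul ((hξ i).comp measurable_snd)
  have h1 : ∀ r : ℝ, ‖r‖ₑ ≤ 1 + ENNReal.ofReal (r ^ 2) := fun r => by
    rw [Real.enorm_eq_ofReal_abs, ← ENNReal.ofReal_one, ← ENNReal.ofReal_add zero_le_one
      (sq_nonneg _)]
    refine ENNReal.ofReal_le_ofReal ?_
    nlinarith [sq_nonneg (|r| - 1), sq_abs r]
  have h2 : ∫⁻ w : X × Z, ENNReal.ofReal ((∑ i, a w.1 i * ξ w.2 i) ^ 2) ∂(μ.prod ν)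
      ≤ ENNReal.ofReal (c * D) := by
    rw [lintegral_prod _ (hm.pow_const 2).ennreal_ofReal.aemeasurable]
    calc _ ≤ ∫⁻ x, ENNReal.ofReal c * ENNReal.ofReal (∑ i, a x i ^ 2) ∂μ := by
          refine lintegral_mono fun x => ?_
          rw [← ENNReal.ofReal_mul hc]
          exact hwhite (a x)
      _ = ENNReal.ofReal c * ∫⁻ x, ENNReal.ofReal (∑ i, a x i ^ 2) ∂μ :=
          lintegral_const_mul' _ _ ENNReal.ofReal_ne_top
      _ ≤ ENNReal.ofReal c * ENNReal.ofReal D := mul_le_mul' le_rfl haD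
      _ = _ := (ENNReal.ofReal_mul hc).symm
  calc _ ≤ ∫⁻ w : X × Z, (1 + ENNReal.ofReal ((∑ i, a w.1 i * ξ w.2 i) ^ 2)) ∂(μ.prod ν) :=
        lintegral_mono fun w => h1 _
    _ = 1 + ∫⁻ w : X × Z, ENNReal.ofReal ((∑ i, a w.1 i * ξ w.2 i) ^ 2) ∂(μ.prod ν) := by
        rw [lintegral_add_left measurable_const]; simp
    _ ≤ 1 + ENNReal.ofReal (c * D) := add_le_add le_rfl h2
    _ = _ := by
        rw [ENNReal.ofReal_add zero_le_one (by positivity), ENNReal.ofReal_one]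

/-- Expanding `1 / (1 + κ y_i)` geometrically moves `κ` into the scalars `(-κ)^n`, and `M *ᵥ b`
collects the dependence on `b`. What is left is a series of fixed linear functionals of the noise,
so the bound holds for all `κ` and `b` simultaneously. -/
theorem abs_sum_le_tsum {N : ℕ} {q : Type*} [Fintype q] [DecidableEq q]
    (H : Matrix (Fin N) q ℝ) (ξ : Fin N → ℝ) {M T : Matrix q q ℝ} (hTM : T * M = 1)
    {g y : Fin N → ℝ} {κ₀ : ℝ} (hy : ∀ i, |y i| ≤ 1) (hκ₁ : κ₀ < 1)
    (b : q → ℝ) {κ s : ℝ} (hκ : |κ| ≤ κ₀) (hMb : ∀ k, |(M *ᵥ b) k| ≤ s) :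
    ENNReal.ofReal |∑ i, ξ i * (g i / (1 + κ * y i)) * (H *ᵥ b) i|
      ≤ (∑' n, ENNReal.ofReal (κ₀ ^ n) * ∑ k, ‖∑ i, (g i * y i ^ n * (H * T) i k) * ξ i‖ₑ)
        * ENNReal.ofReal s := by
  have hsum : HasSum (fun n => (-κ) ^ n * ∑ k, (M *ᵥ b) k *
        ∑ i, (g i * y i ^ n * (H * T) i k) * ξ i)
      (∑ i, ξ i * (g i / (1 + κ * y i)) * (H *ᵥ b) i) := by
    have h1 : ∀ i, HasSum (fun n => ξ i * (g i * (-κ * y i) ^ n) * (H *ᵥ b) i)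
        (ξ i * (g i / (1 + κ * y i)) * (H *ᵥ b) i) := fun i => by
      have hlt : |-κ * y i| < 1 := by
        rw [abs_mul, abs_neg]
        exact (mul_le_of_le_one_right (abs_nonneg _) (hy i)).trans_lt (hκ.trans_lt hκ₁)
      have h2 := ((hasSum_geometric_of_abs_lt_one hlt).mul_left (g i)).mul_left (ξ i)
      rw [show 1 - -κ * y i = 1 + κ * y i by ring, ← div_eq_mul_inv] at h2
      exact h2.mul_right _
    have hHb : ∀ i, (H *ᵥ b) i = ∑ k, (H * T) i k * (M *ᵥ b) k := fun i => by
      have : H *ᵥ b = (H * T) *ᵥ (M *ᵥ b) := by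
        rw [mulVec_mulVec, Matrix.mul_assoc, hTM, Matrix.mul_one]
      rw [this]
      rfl
    convert hasSum_sum fun i (_ : i ∈ Finset.univ) => h1 i using 2 with n
    simp only [hHb, Finset.mul_sum]
    rw [Finset.sum_comm]
    refine Finset.sum_congr rfl fun i _ => Finset.sum_congr rfl fun k _ => ?_
    rw [mul_pow]
    ring
  rw [← Real.enorm_eq_ofReal_abs, ← hsum.tsum_eq, ← ENNReal.tsum_mul_right]
  refine enorm_tsum_le_tsum_enorm.trans (ENNReal.tsum_le_tsum fun n => ?_)
  rw [enorm_mul, mul_assoc]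
  refine mul_le_mul' ?_ ?_
  · rw [Real.enorm_eq_ofReal_abs, abs_pow, abs_neg]
    exact ENNReal.ofReal_le_ofReal (pow_le_pow_left₀ (abs_nonneg _) hκ n)
  · refine (enorm_sum_le _ _).trans ?_
    rw [Finset.sum_mul]
    refine Finset.sum_le_sum fun k _ => ?_
    rw [enorm_mul, mul_comm]
    refine mul_le_mul' le_rfl ?_
    rw [Real.enorm_eq_ofReal_abs]
    exact ENNReal.ofReal_le_ofReal (hMb k)

/-- `W` is the series from `abs_sum_le_tsum`. Each functional is taken along a `B`-orthonormal
column of `T`, hence has mean modulus at most `1 + c G²`; the weights `κ₀^n` sum to `1 / (1 - κ₀)`.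
-/
theorem exists_sup_noise_bound {N : ℕ} {q X Z : Type*} [Fintype q] [DecidableEq q]
    [MeasurableSpace X] [MeasurableSpace Z] (μ : Measure X) [IsProbabilityMeasure μ]
    (ν : Measure Z) [IsProbabilityMeasure ν] {H : X → Matrix (Fin N) q ℝ}
    (hH : ∀ i k, Measurable fun x => H x i k) {ξ : Z → Fin N → ℝ}
    (hξ : ∀ i, Measurable fun z => ξ z i) {c : ℝ} (hc : 0 ≤ c)
    (hwhite : ∀ a : Fin N → ℝ, ∫⁻ z, ENNReal.ofReal ((∑ i, a i * ξ z i) ^ 2) ∂ν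
      ≤ ENNReal.ofReal (c * ∑ i, a i ^ 2)) {B : Matrix q q ℝ} (hB : B.PosDef)
    (hHB : ∀ b : q → ℝ, ∫⁻ x, ENNReal.ofReal (∑ i, (H x *ᵥ b) i ^ 2) ∂μ
      ≤ ENNReal.ofReal (b ⬝ᵥ (B *ᵥ b))) {g y : Fin N → ℝ} {G κ₀ : ℝ} (hg : ∀ i, |g i| ≤ G)
    (hy : ∀ i, |y i| ≤ 1) (hκ₀ : 0 ≤ κ₀) (hκ₁ : κ₀ < 1) :
    ∃ W : X × Z → ENNReal, Measurable W ∧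
      ∫⁻ w, W w ∂(μ.prod ν) ≤ ENNReal.ofReal (Fintype.card q * (1 + c * G ^ 2) / (1 - κ₀)) ∧
      ∀ w (b : q → ℝ) κ, |κ| ≤ κ₀ →
        ENNReal.ofReal |∑ i, ξ w.2 i * (g i / (1 + κ * y i)) * (H w.1 *ᵥ b) i|
          ≤ W w * ENNReal.ofReal (Real.sqrt (b ⬝ᵥ (B *ᵥ b))) := by
  obtain ⟨M, T, hMB, hTM, hMT⟩ := exists_factor_of_posDef hB
  let a : ℕ → q → X → Fin N → ℝ := fun n k x i => g i * y i ^ n * (H x * T) i k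
  let Φ : ℕ → q → X × Z → ℝ := fun n k w => ∑ i, a n k w.1 i * ξ w.2 i
  have ham : ∀ n k i, Measurable fun x => a n k x i := fun n k i => by
    simp only [a, Matrix.mul_apply]
    exact measurable_const.mul (Finset.measurable_sum _ fun j _ => (hH i j).mul_const _)
  have hΦm : ∀ n k, Measurable (Φ n k) := fun n k =>
    Finset.measurable_sum _ fun i _ =>
      ((ham n k i).comp measurable_fst).mul ((hξ i).comp measurable_snd)
  have hsm : ∀ n, Measurable fun w => ENNReal.ofReal (κ₀ ^ n) * ∑ k, ‖Φ n k w‖ₑ := fun n =>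
    (Finset.measurable_sum _ fun k _ => (hΦm n k).enorm).const_mul _
  have hΦ : ∀ n k, ∫⁻ w, ‖Φ n k w‖ₑ ∂(μ.prod ν) ≤ ENNReal.ofReal (1 + c * G ^ 2) := by
    intro n k
    refine lintegral_enorm_sum_mul_le μ ν (ham n k) hξ hc (sq_nonneg G) hwhite ?_
    have hcol : T.col k ⬝ᵥ (B *ᵥ T.col k) = 1 := by
      rw [← hMB, dotProduct_transpose_mul_mulVec]
      have : M *ᵥ T.col k = Pi.single k 1 := by
        have h := mulVec_mulVec (Pi.single k 1 : q → ℝ) M T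
        rw [hMT, one_mulVec, mulVec_single_one] at h
        exact h
      rw [this]
      simp [Pi.single_apply]
    calc _ ≤ ∫⁻ x, ENNReal.ofReal (G ^ 2) * ENNReal.ofReal (∑ i, (H x *ᵥ T.col k) i ^ 2)
          ∂μ := by
          refine lintegral_mono fun x => ?_
          rw [← ENNReal.ofReal_mul (by positivity)]
          refine ENNReal.ofReal_le_ofReal ?_
          rw [Finset.mul_sum]
          refine Finset.sum_le_sum fun i _ => ?_
          have hi : (H x * T) i k = (H x *ᵥ T.col k) i := rfl
          simp only [a]
          rw [hi, mul_pow]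
          refine mul_le_mul_of_nonneg_right ?_ (sq_nonneg _)
          rw [← sq_abs, abs_mul, abs_pow]
          have hle : |g i| * |y i| ^ n ≤ G :=
            (mul_le_of_le_one_right (abs_nonneg _) (pow_le_one₀ (abs_nonneg _) (hy i))).trans
              (hg i)
          exact pow_le_pow_left₀ (by positivity) hle 2
      _ = ENNReal.ofReal (G ^ 2) * ∫⁻ x, ENNReal.ofReal (∑ i, (H x *ᵥ T.col k) i ^ 2) ∂μ :=
          lintegral_const_mul' _ _ ENNReal.ofReal_ne_top
      _ ≤ ENNReal.ofReal (G ^ 2) * ENNReal.ofReal 1 :=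
          mul_le_mul' le_rfl ((hHB _).trans_eq (by rw [hcol]))
      _ = _ := by simp
  refine ⟨fun w => ∑' n, ENNReal.ofReal (κ₀ ^ n) * ∑ k, ‖Φ n k w‖ₑ,
    Measurable.tsum hsm, ?_, ?_⟩
  · rw [lintegral_tsum fun n => (hsm n).aemeasurable]
    calc _ ≤ ∑' n, ENNReal.ofReal (κ₀ ^ n) *
            ENNReal.ofReal (Fintype.card q * (1 + c * G ^ 2)) := by
          refine ENNReal.tsum_le_tsum fun n => ?_
          rw [lintegral_const_mul' _ _ ENNReal.ofReal_ne_top,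
            lintegral_finsetSum _ fun k _ => (hΦm n k).enorm]
          refine mul_le_mul' le_rfl ?_
          refine (Finset.sum_le_sum fun k _ => hΦ n k).trans ?_
          rw [Finset.sum_const, nsmul_eq_mul, ENNReal.ofReal_mul (by positivity)]
          simp
      _ = ENNReal.ofReal (1 / (1 - κ₀)) *
          ENNReal.ofReal (Fintype.card q * (1 + c * G ^ 2)) := by
          rw [ENNReal.tsum_mul_right, ← ENNReal.ofReal_tsum_of_nonneg (fun n => by positivity)
            (summable_geometric_of_lt_one hκ₀ hκ₁), tsum_geometric_of_lt_one hκ₀ hκ₁, one_div]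
      _ ≤ _ := by
          rw [← ENNReal.ofReal_mul (one_div_nonneg.mpr (by linarith))]
          refine ENNReal.ofReal_le_ofReal (le_of_eq ?_)
          ring
  · intro w b κ hκ
    refine abs_sum_le_tsum (H w.1) (ξ w.2) hTM hy hκ₁ b hκ fun k => ?_
    rw [← hMB, dotProduct_transpose_mul_mulVec]
    exact Real.abs_le_sqrt (Finset.single_le_sum (f := fun k => (M *ᵥ b) k ^ 2)
      (fun i _ => sq_nonneg _) (Finset.mem_univ k))

/-- Markov's inequality for the measurable dominating variable `W`; the event itself quantifies over
uncountably many `b` and `κ` and is not required to be measurable. -/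
theorem measure_sup_noise_le {Ω : Type*} [MeasurableSpace Ω] (P : Measure Ω)
    [IsProbabilityMeasure P] {N : ℕ} {q X Z : Type*} [Fintype q] [DecidableEq q]
    [MeasurableSpace X] [MeasurableSpace Z] (μ : Measure X) [IsProbabilityMeasure μ]
    (ν : Measure Z) [IsProbabilityMeasure ν] {V : Ω → X × Z} (hV : Measurable V)
    (hlaw : P.map V = μ.prod ν) {H : X → Matrix (Fin N) q ℝ}
    (hH : ∀ i k, Measurable fun x => H x i k) {ξ : Z → Fin N → ℝ}
    (hξ : ∀ i, Measurable fun z => ξ z i) {c : ℝ} (hc : 0 ≤ c)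
    (hwhite : ∀ a : Fin N → ℝ, ∫⁻ z, ENNReal.ofReal ((∑ i, a i * ξ z i) ^ 2) ∂ν
      ≤ ENNReal.ofReal (c * ∑ i, a i ^ 2)) {B : Matrix q q ℝ} (hB : B.PosDef)
    (hHB : ∀ b : q → ℝ, ∫⁻ x, ENNReal.ofReal (∑ i, (H x *ᵥ b) i ^ 2) ∂μ
      ≤ ENNReal.ofReal (b ⬝ᵥ (B *ᵥ b))) {g y : Fin N → ℝ} {G κ₀ K : ℝ} (hg : ∀ i, |g i| ≤ G)
    (hy : ∀ i, |y i| ≤ 1) (hκ₀ : 0 ≤ κ₀) (hκ₁ : κ₀ < 1) (hK : 0 < K) :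
    P {ω | ¬ ∀ (b : q → ℝ) κ, |κ| ≤ κ₀ →
        |∑ i, ξ (V ω).2 i * (g i / (1 + κ * y i)) * (H (V ω).1 *ᵥ b) i|
          ≤ K * Real.sqrt (b ⬝ᵥ (B *ᵥ b))}
      ≤ ENNReal.ofReal (Fintype.card q * (1 + c * G ^ 2) / (1 - κ₀) / K) := by
  obtain ⟨W, hWm, hW, hWb⟩ :=
    exists_sup_noise_bound μ ν hH hξ hc hwhite hB hHB hg hy hκ₀ hκ₁
  have hK' : ENNReal.ofReal K ≠ 0 := by simpa using hK
  calc _ ≤ P {ω | ENNReal.ofReal K ≤ W (V ω)} := by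
        refine measure_mono fun ω hω => ?_
        simp only [Set.mem_ofPred_eq] at hω ⊢
        by_contra hlt
        refine hω fun b κ hκ => ?_
        have h1 := (hWb (V ω) b κ hκ).trans (mul_le_mul' (not_le.mp hlt).le le_rfl)
        rw [← ENNReal.ofReal_mul hK.le] at h1
        exact (ENNReal.ofReal_le_ofReal_iff (by positivity)).mp h1
    _ ≤ (∫⁻ ω, W (V ω) ∂P) / ENNReal.ofReal K :=
        meas_ge_le_lintegral_div (hWm.comp hV).aemeasurable hK' ENNReal.ofReal_ne_top
    _ = (∫⁻ w, W w ∂(μ.prod ν)) / ENNReal.ofReal K := by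
        rw [← hlaw, lintegral_map hWm hV]
    _ ≤ _ := by
        rw [ENNReal.ofReal_div_of_pos hK]
        gcongr

end RENSEM

namespace RENSEM

/-! ### Deterministic estimates for a linear mixed equation -/

/-- With `u = √x`, the inequality `log u ≤ u - 1` gives `x - 1 - log x ≥ (u - 1)²`, and `(u + 1)² ≤
2 (u² + 1)` converts this into a bound by `(x - 1)²`. -/
theorem sq_div_le_sub_one_sub_log {x : ℝ} (hx : 0 < x) :
    (x - 1) ^ 2 / (2 * (x + 1)) ≤ x - 1 - Real.log x := by
  have hu : 0 < Real.sqrt x := Real.sqrt_pos.mpr hx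
  have hsq : Real.sqrt x ^ 2 = x := Real.sq_sqrt hx.le
  have hlog : Real.log x = 2 * Real.log (Real.sqrt x) := by
    rw [Real.log_sqrt hx.le]; ring
  have h1 := Real.log_le_sub_one_of_pos hu
  rw [div_le_iff₀ (by positivity), hlog]
  set u := Real.sqrt x
  rw [← hsq]
  have h2 : (u - 1) ^ 2 ≤ u ^ 2 - 1 - 2 * Real.log u := by nlinarith
  have h3 : (u ^ 2 - 1) ^ 2 ≤ (u - 1) ^ 2 * (2 * (u ^ 2 + 1)) := by
    nlinarith [mul_nonneg (sq_nonneg (u - 1)) (sq_nonneg (u - 1))]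
  exact h3.trans (mul_le_mul_of_nonneg_right h2 (by positivity))

/-- With `ρ = v₀ / v`, the difference equals `½ (log ρ - (ρ - 1)) - ½ (ρ - 1)(z² - 1) - ρ z h - ½ ρ
h²`. The first and last terms are the negative drift, the middle ones are centred noise when `z` is
standard normal. Since `ρ - 1 = -ρ d` and `ρ ∈ [1/L, L]`, the drift in `d` is at least `ρ² d² / (4
(ρ + 1)) ≥ d² / (4 L² (L + 1))`. -/
theorem gaussTerm_sub_le {v v₀ L z h d : ℝ} (hv : 0 < v) (hv₀ : 0 < v₀) (hL : 1 ≤ L)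
    (h1 : 1 / L ≤ v₀ / v) (h2 : v₀ / v ≤ L) (hd : v₀ / v - 1 = -(v₀ / v * d)) :
    (-(1 / 2) * Real.log v - 1 / 2 * ((Real.sqrt v₀ * (z + h)) ^ 2 / v))
      - (-(1 / 2) * Real.log v₀ - 1 / 2 * ((Real.sqrt v₀ * z) ^ 2 / v₀))
      ≤ 1 / 2 * ((z ^ 2 - 1) * (v₀ / v) * d) - z * (v₀ / v) * h
        - 1 / (4 * L ^ 2 * (L + 1)) * h ^ 2 - 1 / (4 * L ^ 2 * (L + 1)) * d ^ 2 := by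
  have hL0 : 0 < L := by linarith
  have hsq := Real.sq_sqrt hv₀.le
  have hlog : Real.log (v₀ / v) = Real.log v₀ - Real.log v := Real.log_div hv₀.ne' hv.ne'
  have e1 : (Real.sqrt v₀ * (z + h)) ^ 2 / v = v₀ / v * (z + h) ^ 2 := by
    rw [mul_pow, hsq]; ring
  have e2 : (Real.sqrt v₀ * z) ^ 2 / v₀ = z ^ 2 := by
    rw [mul_pow, hsq]; field_simp
  have hρ0 : 0 < v₀ / v := div_pos hv₀ hv
  have h3 := sq_div_le_sub_one_sub_log hρ0
  rw [e1, e2]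
  generalize v₀ / v = ρ at *
  set c := 1 / (4 * L ^ 2 * (L + 1)) with hc
  have hc0 : 0 < c := by positivity
  have h4 : 2 * (c * d ^ 2) ≤ (ρ - 1) ^ 2 / (2 * (ρ + 1)) := by
    have h5 : 1 ≤ L * ρ := by
      have := mul_le_mul_of_nonneg_left h1 hL0.le
      rwa [mul_one_div_cancel hL0.ne'] at this
    have h5' : 1 ≤ L ^ 2 * ρ ^ 2 := by rw [← mul_pow]; exact one_le_pow₀ h5
    have h6 : 4 * c * (ρ + 1) ≤ ρ ^ 2 := by
      rw [hc, mul_one_div, div_mul_eq_mul_div, div_le_iff₀ (by positivity)]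
      have : (L + 1) * 1 ≤ (L + 1) * (L ^ 2 * ρ ^ 2) :=
        mul_le_mul_of_nonneg_left h5' (by positivity)
      linarith
    rw [hd, neg_sq, mul_pow, le_div_iff₀ (by positivity)]
    have := mul_le_mul_of_nonneg_right h6 (sq_nonneg d)
    linarith
  have h7 : c * h ^ 2 ≤ 1 / 2 * (ρ * h ^ 2) := by
    have hcL : c ≤ 1 / (2 * L) := by
      rw [hc]
      apply one_div_le_one_div_of_le (by positivity)
      have : L * 1 ≤ L * (L * (L + 1)) :=
        mul_le_mul_of_nonneg_left (one_le_mul_of_one_le_of_one_le hL (by linarith)) hL0.le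
      linarith
    have : c ≤ ρ / 2 := by
      refine hcL.trans ?_
      rw [one_div, mul_inv, ← one_div L]
      linarith
    have := mul_le_mul_of_nonneg_right this (sq_nonneg h)
    linarith
  have h8 : (z ^ 2 - 1) * ρ * d = -((ρ - 1) * (z ^ 2 - 1)) := by rw [hd]; ring
  rw [h8]
  linear_combination 1 / 2 * h3 + 1 / 2 * h4 + h7 - 1 / 2 * hlog

/-- Half of the quadratic drift absorbs the linear noise by completing squares; the other half stays
on the left to localize the maximizer. -/
theorem quadratic_drift_le {c k a b X Y D : ℝ} (hc : 0 < c) (hX : -(k * (2 * a)) ≤ X)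
    (hY : Y ≤ k * b) (hD : D ≤ 1 / 2 * Y - X - c * a ^ 2 - c * b ^ 2) :
    D + c / 2 * (a ^ 2 + b ^ 2) ≤ 4 * k ^ 2 / c := by
  rw [le_div_iff₀ hc]
  have h1 : D + c / 2 * (a ^ 2 + b ^ 2) ≤ k * b / 2 + k * (2 * a) - c / 2 * (a ^ 2 + b ^ 2) := by
    linarith
  have h2 := mul_le_mul_of_nonneg_right h1 hc.le
  nlinarith [sq_nonneg (c * a - 2 * k), sq_nonneg (c * b - k / 2), sq_nonneg k]

/-- The perturbed square is `(A + δ)²` with `A = w + d z` and `δ = (ρ - 1) d z + ρ d h`. Young's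
inequality with weight `1/100` gives `(A + δ)² ≥ 0.99 A² - 99 δ²`. -/
theorem perturbed_term_ge {ρ w d z h : ℝ} (hρ : |ρ - 1| ≤ 1 / 100) :
    (1 - 1 / 100) ^ 2 * (w + d * z) ^ 2
      - 100 * (2 * (1 / 100) ^ 2 * (d * z) ^ 2 + 4 * (d * h) ^ 2)
      - 1 / 2 * ((1 + 1 / 100) ^ 2 * d ^ 2)
      ≤ ρ * (w + ρ * d * (z + h)) ^ 2 - 1 / 2 * (ρ * d) ^ 2 := by
  obtain ⟨h1, h2⟩ := abs_le.mp hρ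
  have hF : w + ρ * d * (z + h) = (w + d * z) + ((ρ - 1) * (d * z) + ρ * (d * h)) := by ring
  have hδ2 : ((ρ - 1) * (d * z) + ρ * (d * h)) ^ 2
      ≤ 2 * (1 / 100) ^ 2 * (d * z) ^ 2 + 4 * (d * h) ^ 2 := by
    have e1 : ((ρ - 1) * (d * z) + ρ * (d * h)) ^ 2 ≤ 2 * ((ρ - 1) ^ 2 * (d * z) ^ 2)
        + 2 * (ρ ^ 2 * (d * h) ^ 2) := by
      linarith [sq_nonneg ((ρ - 1) * (d * z) - ρ * (d * h))]
    have e2 : (ρ - 1) ^ 2 ≤ (1 / 100) ^ 2 := sq_le_sq.mpr (by rwa [abs_of_pos (a := 1 / 100) (by norm_num)])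
    have e3 : ρ ^ 2 ≤ 2 := by nlinarith
    linarith [mul_le_mul_of_nonneg_right e2 (sq_nonneg (d * z)),
      mul_le_mul_of_nonneg_right e3 (sq_nonneg (d * h))]
  have hρd : (ρ * d) ^ 2 ≤ (1 + 1 / 100) ^ 2 * d ^ 2 := by
    rw [mul_pow]
    exact mul_le_mul_of_nonneg_right (by nlinarith) (sq_nonneg _)
  rw [hF]
  generalize w + d * z = A at *
  generalize (ρ - 1) * (d * z) + ρ * (d * h) = δ at *
  have hF2 : (1 - 1 / 100) * A ^ 2 - 99 * δ ^ 2 ≤ (A + δ) ^ 2 := by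
    linarith [sq_nonneg (A / 10 + 10 * δ)]
  have hF3 : (1 - 1 / 100) * (A + δ) ^ 2 ≤ ρ * (A + δ) ^ 2 :=
    mul_le_mul_of_nonneg_right (by linarith) (sq_nonneg _)
  linarith [sq_nonneg δ]

section Mixed

variable {N : ℕ} {lam : Fin N → ℝ} {m M s t s₀ t₀ : ℝ}

/-- Relative perturbation of the variances in the direction `(ds, dt)`. -/
noncomputable def relVar (lam : Fin N → ℝ) (s₀ t₀ ds dt : ℝ) (i : Fin N) : ℝ :=
  (ds + dt * lam i) / (s₀ + t₀ * lam i)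

/-- Ratio of the true variances to the variances at `(s, t)`. -/
noncomputable def varRatio (lam : Fin N → ℝ) (s₀ t₀ s t : ℝ) (i : Fin N) : ℝ :=
  (s₀ + t₀ * lam i) / (s + t * lam i)

theorem rotVar_pos (hlam : ∀ i, 0 ≤ lam i) (hm : 0 < m) (hs : s ∈ Set.Icc m M)
    (ht : t ∈ Set.Icc m M) (i : Fin N) : 0 < s + t * lam i :=
  add_pos_of_pos_of_nonneg (hm.trans_le hs.1) (mul_nonneg (hm.le.trans ht.1) (hlam i))

theorem varRatio_mem (hlam : ∀ i, 0 ≤ lam i) (hm : 0 < m) (hs : s ∈ Set.Icc m M)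
    (ht : t ∈ Set.Icc m M) (hs₀ : s₀ ∈ Set.Icc m M) (ht₀ : t₀ ∈ Set.Icc m M) (i : Fin N) :
    m / M ≤ varRatio lam s₀ t₀ s t i ∧ varRatio lam s₀ t₀ s t i ≤ M / m := by
  have hM : 0 < M := hm.trans_le (hs.1.trans hs.2)
  have hv := rotVar_pos hlam hm hs ht i
  have hl := hlam i
  rw [varRatio, div_le_div_iff₀ hM hv, div_le_div_iff₀ hv hm]
  have e1 : m * (s + t * lam i) ≤ (s₀ + t₀ * lam i) * M := by
    have a1 : m * s ≤ s₀ * M := mul_le_mul hs₀.1 hs.2 (hm.le.trans hs.1) (hm.le.trans hs₀.1)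
    have a2 : m * t ≤ t₀ * M := mul_le_mul ht₀.1 ht.2 (hm.le.trans ht.1) (hm.le.trans ht₀.1)
    nlinarith [mul_le_mul_of_nonneg_right a2 hl]
  have e2 : (s₀ + t₀ * lam i) * m ≤ M * (s + t * lam i) := by
    have a1 : s₀ * m ≤ M * s := mul_le_mul hs₀.2 hs.1 hm.le hM.le
    have a2 : t₀ * m ≤ M * t := mul_le_mul ht₀.2 ht.1 hm.le hM.le
    nlinarith [mul_le_mul_of_nonneg_right a2 hl]
  exact ⟨e1, e2⟩

theorem varRatio_sub_one (hlam : ∀ i, 0 ≤ lam i) (hm : 0 < m) (hs : s ∈ Set.Icc m M)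
    (ht : t ∈ Set.Icc m M) (hs₀ : s₀ ∈ Set.Icc m M) (ht₀ : t₀ ∈ Set.Icc m M) (i : Fin N) :
    varRatio lam s₀ t₀ s t i - 1
      = -(varRatio lam s₀ t₀ s t i * relVar lam s₀ t₀ (s - s₀) (t - t₀) i) := by
  have hv := (rotVar_pos hlam hm hs ht i).ne'
  have hv₀ := (rotVar_pos hlam hm hs₀ ht₀ i).ne'
  rw [varRatio, relVar, show s - s₀ + (t - t₀) * lam i = (s + t * lam i) - (s₀ + t₀ * lam i) by ring]
  generalize s + t * lam i = v at *
  generalize s₀ + t₀ * lam i = v₀ at *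
  field_simp
  ring

/-- The variance factors as `s + t λ = (s + t)/2 · (1 + λ) · (1 + κ y)` with `κ = (s - t)/(s + t)`
and `y = (1 - λ)/(1 + λ) ∈ [-1, 1]`. Up to a common scale, the two variance components thus enter
only through one scalar `κ`, which stays away from `±1` on `[m, M]²`. This is the form needed for
the geometric expansion. -/
theorem varRatio_eq (hlam : ∀ i, 0 ≤ lam i) (hm : 0 < m) (hs : s ∈ Set.Icc m M)
    (ht : t ∈ Set.Icc m M) (i : Fin N) :
    varRatio lam s₀ t₀ s t i = 2 / (s + t) *
      ((s₀ + t₀ * lam i) / (1 + lam i) / (1 + (s - t) / (s + t) * ((1 - lam i) / (1 + lam i)))) := by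
  have hl := hlam i
  have hst : 0 < s + t := add_pos (hm.trans_le hs.1) (hm.trans_le ht.1)
  have hv := rotVar_pos hlam hm hs ht i
  have h1 : 1 + (s - t) / (s + t) * ((1 - lam i) / (1 + lam i))
      = 2 * (s + t * lam i) / ((s + t) * (1 + lam i)) := by
    field_simp
    ring
  rw [h1, varRatio]
  field_simp

theorem abs_sub_div_add_le (hm : 0 < m) (hs : s ∈ Set.Icc m M) (ht : t ∈ Set.Icc m M) :
    |(s - t) / (s + t)| ≤ (M - m) / (M + m) := by
  have hM : 0 < M := hm.trans_le (hs.1.trans hs.2)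
  have hst : 0 < s + t := add_pos (hm.trans_le hs.1) (hm.trans_le ht.1)
  rw [abs_div, abs_of_pos hst, div_le_div_iff₀ hst (by positivity)]
  have h1 := mul_le_mul hs.2 ht.1 hm.le hM.le
  have h2 := mul_le_mul ht.2 hs.1 hm.le hM.le
  rcases abs_cases (s - t) with ⟨h, _⟩ | ⟨h, _⟩ <;> rw [h] <;> nlinarith

theorem abs_relVar_le (hlam : ∀ i, 0 ≤ lam i) (hm : 0 < m) (hs₀ : s₀ ∈ Set.Icc m M)
    (ht₀ : t₀ ∈ Set.Icc m M) (ds dt : ℝ) (i : Fin N) :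
    |relVar lam s₀ t₀ ds dt i| ≤ (|ds| + |dt|) / m := by
  have hl := hlam i
  have hv₀ := rotVar_pos hlam hm hs₀ ht₀ i
  rw [relVar, abs_div, abs_of_pos hv₀, div_le_div_iff₀ hv₀ hm]
  have h1 : |ds + dt * lam i| ≤ |ds| + |dt| * lam i := by
    refine (abs_add_le _ _).trans ?_
    rw [abs_mul, abs_of_nonneg hl]
  have h2 : |ds| * m ≤ |ds| * s₀ := mul_le_mul_of_nonneg_left hs₀.1 (abs_nonneg _)
  have h3 : |dt| * lam i * m ≤ |dt| * (t₀ * lam i) := by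
    rw [mul_assoc, mul_comm (lam i)]
    exact mul_le_mul_of_nonneg_left (mul_le_mul_of_nonneg_right ht₀.1 hl) (abs_nonneg _)
  have h4 : 0 ≤ |ds| * (t₀ * lam i) :=
    mul_nonneg (abs_nonneg _) (mul_nonneg (hm.le.trans ht₀.1) hl)
  have h5 : 0 ≤ |dt| * s₀ := mul_nonneg (abs_nonneg _) (hm.le.trans hs₀.1)
  nlinarith [mul_le_mul_of_nonneg_right h1 hm.le]

/-- Completing the square in the form of `mixedForm`; the only negative contribution left is the
deterministic one from the log-determinant. -/
theorem mixedForm_whitened (hlam : ∀ i, 0 ≤ lam i) (hm : 0 < m) (hs : s ∈ Set.Icc m M)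
    (ht : t ∈ Set.Icc m M) (hs₀ : s₀ ∈ Set.Icc m M) (ht₀ : t₀ ∈ Set.Icc m M)
    {r x w e : Fin N → ℝ} (hr : ∀ i, r i = Real.sqrt (s₀ + t₀ * lam i) * e i)
    (hx : ∀ i, x i = Real.sqrt (s₀ + t₀ * lam i) * w i) (ds dt : ℝ) :
    mixedForm lam r s t x ds dt x ds dt =
      ∑ i, varRatio lam s₀ t₀ s t i *
        (w i + varRatio lam s₀ t₀ s t i * relVar lam s₀ t₀ ds dt i * e i) ^ 2
      - 1 / 2 * ∑ i, (varRatio lam s₀ t₀ s t i * relVar lam s₀ t₀ ds dt i) ^ 2 := by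
  rw [mixedForm, Finset.mul_sum, ← Finset.sum_sub_distrib]
  refine Finset.sum_congr rfl fun i _ => ?_
  have hv := (rotVar_pos hlam hm hs ht i).ne'
  have hv₀ := (rotVar_pos hlam hm hs₀ ht₀ i).ne'
  have hsq := Real.sq_sqrt (rotVar_pos hlam hm hs₀ ht₀ i).le
  rw [hr, hx, varRatio, relVar]
  generalize ds + dt * lam i = D at *
  generalize s + t * lam i = v at *
  generalize Real.sqrt (s₀ + t₀ * lam i) = σ at *
  rw [← hsq] at hv₀ ⊢
  have hσ : σ ≠ 0 := fun h => hv₀ (by rw [h]; norm_num)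
  field_simp
  ring

/-- The noise is of the order of `‖h‖ + ‖d‖`, the drift of the order of `‖h‖² + ‖d‖²`. The ratio
plus half of the drift is therefore bounded by a constant free of the parameter value. -/
theorem mixed_logLik_le (hlam : ∀ i, 0 ≤ lam i) (hm : 0 < m) (hs : s ∈ Set.Icc m M)
    (ht : t ∈ Set.Icc m M) (hs₀ : s₀ ∈ Set.Icc m M) (ht₀ : t₀ ∈ Set.Icc m M)
    {r₀ r z h : Fin N → ℝ} (hr₀ : ∀ i, r₀ i = Real.sqrt (s₀ + t₀ * lam i) * z i)
    (hr : ∀ i, r i = Real.sqrt (s₀ + t₀ * lam i) * (z i + h i)) {Q K : ℝ} (hK : 0 ≤ K)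
    (hQ : Q ≤ 2 * ∑ i, h i ^ 2)
    (hz : ∀ κ, |κ| ≤ (M - m) / (M + m) →
      |∑ i, z i * ((s₀ + t₀ * lam i) / (1 + lam i) / (1 + κ * ((1 - lam i) / (1 + lam i)))) * h i|
        ≤ K * Real.sqrt Q)
    (hζ : ∀ κ, |κ| ≤ (M - m) / (M + m) →
      |∑ i, (z i ^ 2 - 1) * ((s₀ + t₀ * lam i) / (1 + lam i) /
          (1 + κ * ((1 - lam i) / (1 + lam i)))) * relVar lam s₀ t₀ (s - s₀) (t - t₀) i|
        ≤ K * Real.sqrt (∑ i, relVar lam s₀ t₀ (s - s₀) (t - t₀) i ^ 2)) :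
    (∑ i, (-(1 / 2) * Real.log (s + t * lam i) - 1 / 2 * (r i ^ 2 / (s + t * lam i))))
      - (∑ i, (-(1 / 2) * Real.log (s₀ + t₀ * lam i) - 1 / 2 * (r₀ i ^ 2 / (s₀ + t₀ * lam i))))
      + 1 / (8 * (M / m) ^ 2 * (M / m + 1)) *
        (∑ i, h i ^ 2 + ∑ i, relVar lam s₀ t₀ (s - s₀) (t - t₀) i ^ 2)
      ≤ 16 * (M / m) ^ 2 * (M / m + 1) * (K / m) ^ 2 := by
  set L := M / m with hL
  set ρ := varRatio lam s₀ t₀ s t with hρ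
  set d := relVar lam s₀ t₀ (s - s₀) (t - t₀) with hd
  have hM : m ≤ M := hs.1.trans hs.2
  have hL1 : 1 ≤ L := by rw [hL, le_div_iff₀ hm]; linarith
  have hL0 : 0 < L := by linarith
  have hρm : ∀ i, 1 / L ≤ ρ i ∧ ρ i ≤ L := fun i => by
    have := varRatio_mem hlam hm hs ht hs₀ ht₀ i
    rw [hL, one_div_div]
    exact this
  set c := 1 / (4 * L ^ 2 * (L + 1)) with hc
  have hc0 : 0 < c := by positivity
  have hterm : ∀ i, (-(1 / 2) * Real.log (s + t * lam i) - 1 / 2 * (r i ^ 2 / (s + t * lam i)))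
      - (-(1 / 2) * Real.log (s₀ + t₀ * lam i) - 1 / 2 * (r₀ i ^ 2 / (s₀ + t₀ * lam i)))
      ≤ 1 / 2 * ((z i ^ 2 - 1) * ρ i * d i) - z i * ρ i * h i - c * h i ^ 2 - c * d i ^ 2 := by
    intro i
    rw [hr, hr₀]
    exact gaussTerm_sub_le (rotVar_pos hlam hm hs ht i) (rotVar_pos hlam hm hs₀ ht₀ i) hL1
      (hρm i).1 (hρm i).2 (varRatio_sub_one hlam hm hs ht hs₀ ht₀ i)
  have hst : 0 < s + t := add_pos (hm.trans_le hs.1) (hm.trans_le ht.1)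
  have hfac : 2 / (s + t) ≤ 1 / m := by
    rw [div_le_div_iff₀ hst hm]; linarith [hs.1, ht.1]
  have hκ := abs_sub_div_add_le hm hs ht
  have hn1 : |∑ i, z i * ρ i * h i| ≤ 1 / m * (K * Real.sqrt Q) := by
    have : ∑ i, z i * ρ i * h i = 2 / (s + t) * ∑ i, z i * ((s₀ + t₀ * lam i) / (1 + lam i) /
        (1 + (s - t) / (s + t) * ((1 - lam i) / (1 + lam i)))) * h i := by
      rw [Finset.mul_sum]
      refine Finset.sum_congr rfl fun i _ => ?_
      rw [hρ, varRatio_eq hlam hm hs ht i]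
      ring
    rw [this, abs_mul, abs_of_pos (by positivity)]
    exact mul_le_mul hfac (hz _ hκ) (abs_nonneg _) (by positivity)
  have hn2 : |∑ i, (z i ^ 2 - 1) * ρ i * d i| ≤ 1 / m * (K * Real.sqrt (∑ i, d i ^ 2)) := by
    have : ∑ i, (z i ^ 2 - 1) * ρ i * d i = 2 / (s + t) * ∑ i, (z i ^ 2 - 1) *
        ((s₀ + t₀ * lam i) / (1 + lam i) /
        (1 + (s - t) / (s + t) * ((1 - lam i) / (1 + lam i)))) * d i := by
      rw [Finset.mul_sum]
      refine Finset.sum_congr rfl fun i _ => ?_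
      rw [hρ, varRatio_eq hlam hm hs ht i]
      ring
    rw [this, abs_mul, abs_of_pos (by positivity)]
    exact mul_le_mul hfac (hζ _ hκ) (abs_nonneg _) (by positivity)
  have hsum := Finset.sum_le_sum fun i (_ : i ∈ Finset.univ) => hterm i
  simp only [Finset.sum_sub_distrib, ← Finset.mul_sum] at hsum
  set a := Real.sqrt (∑ i, h i ^ 2)
  set b := Real.sqrt (∑ i, d i ^ 2)
  have ha : a ^ 2 = ∑ i, h i ^ 2 := Real.sq_sqrt (Finset.sum_nonneg fun i _ => sq_nonneg _)
  have hb : b ^ 2 = ∑ i, d i ^ 2 := Real.sq_sqrt (Finset.sum_nonneg fun i _ => sq_nonneg _)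
  -- `Q` is the expected squared length, which `hQ` compares with the realized one: `Q ≤ 2 a² ≤ (2
  -- a)²`.
  have hQa : Real.sqrt Q ≤ 2 * a := by
    rw [Real.sqrt_le_left (by positivity)]
    nlinarith [sq_nonneg a]
  have hQa' : 1 / m * (K * Real.sqrt Q) ≤ K / m * (2 * a) := by
    rw [← mul_assoc, one_div_mul_eq_div]
    exact mul_le_mul_of_nonneg_left hQa (by positivity)
  have hb' : 1 / m * (K * b) = K / m * b := by ring
  set k := K / m
  have hck : 16 * L ^ 2 * (L + 1) * k ^ 2 = 4 * k ^ 2 / c := by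
    rw [hc]; field_simp; ring
  have hc8 : 1 / (8 * L ^ 2 * (L + 1)) = c / 2 := by rw [hc]; field_simp; ring
  rw [hck, hc8, ← ha, ← hb]
  rw [← ha, ← hb] at hsum
  refine quadratic_drift_le hc0 (neg_le_of_abs_le (hn1.trans hQa'))
    ((le_abs_self _).trans (hn2.trans_eq hb')) ?_
  simp only [Finset.sum_sub_distrib, ← Finset.mul_sum]
  exact hsum

/-- Stability of the information of a mixed equation under small perturbations. -/
theorem mixedForm_ge (hlam : ∀ i, 0 ≤ lam i) (hm : 0 < m) (hs : s ∈ Set.Icc m M)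
    (ht : t ∈ Set.Icc m M) (hs₀ : s₀ ∈ Set.Icc m M) (ht₀ : t₀ ∈ Set.Icc m M)
    {r x z h w : Fin N → ℝ} (hr : ∀ i, r i = Real.sqrt (s₀ + t₀ * lam i) * (z i + h i))
    {Λ R : ℝ} (hR : 0 ≤ R) (hΛ : 0 < Λ)
    (hΛd : ∀ ds dt, Λ * (ds ^ 2 + dt ^ 2) ≤ 1 / 2 * ∑ i, relVar lam s₀ t₀ ds dt i ^ 2)
    (hh : ∑ i, h i ^ 2 ≤ R) (hd : ∑ i, relVar lam s₀ t₀ (s - s₀) (t - t₀) i ^ 2 ≤ R)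
    (hΛR : 10000 * ((M / m) ^ 2 + 1) * (R / m ^ 2) ≤ Λ)
    (hx : ∀ i, x i = Real.sqrt (s₀ + t₀ * lam i) * w i) (ds dt : ℝ) {Q : ℝ} (hQ : 0 ≤ Q)
    (hstab₀ : |∑ i, (relVar lam s₀ t₀ ds dt i * z i) ^ 2
      - ∑ i, relVar lam s₀ t₀ ds dt i ^ 2| ≤ 1 / 200 * ∑ i, relVar lam s₀ t₀ ds dt i ^ 2)
    (hstab : |∑ i, (w i + relVar lam s₀ t₀ ds dt i * z i) ^ 2
      - 1 / 2 * ∑ i, relVar lam s₀ t₀ ds dt i ^ 2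
      - (Q + 1 / 2 * ∑ i, relVar lam s₀ t₀ ds dt i ^ 2)|
      ≤ 1 / 100 * (Q + 1 / 2 * ∑ i, relVar lam s₀ t₀ ds dt i ^ 2)) :
    1 / 2 * (Q + 1 / 2 * ∑ i, relVar lam s₀ t₀ ds dt i ^ 2)
      ≤ mixedForm lam r s t x ds dt x ds dt := by
  rw [mixedForm_whitened hlam hm hs ht hs₀ ht₀ hr hx]
  set ρ := varRatio lam s₀ t₀ s t with hρ
  set d := relVar lam s₀ t₀ ds dt with hdd
  set L := M / m with hL
  have hL0 : 0 < L := div_pos (hm.trans_le (hs.1.trans hs.2)) hm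
  -- the variance ratios are close to one
  have hsmall : ∀ ds dt : ℝ, ∀ i,
      relVar lam s₀ t₀ ds dt i ^ 2 * (m ^ 2 * Λ) ≤ ∑ i, relVar lam s₀ t₀ ds dt i ^ 2 := by
    intro ds dt i
    have h1 := abs_relVar_le hlam hm hs₀ ht₀ ds dt i
    rw [le_div_iff₀ hm] at h1
    have h2 : relVar lam s₀ t₀ ds dt i ^ 2 * m ^ 2 ≤ 2 * (ds ^ 2 + dt ^ 2) := by
      have := pow_le_pow_left₀ (by positivity) h1 2
      rw [mul_pow, sq_abs] at this
      nlinarith [sq_nonneg (|ds| - |dt|), sq_abs ds, sq_abs dt]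
    have h3 := mul_le_mul_of_nonneg_right h2 hΛ.le
    nlinarith [hΛd ds dt]
  have hmΛ : 0 < m ^ 2 * Λ := by positivity
  have hRΛ : 10000 * (L ^ 2 + 1) * R ≤ m ^ 2 * Λ := by
    have := mul_le_mul_of_nonneg_left hΛR (sq_nonneg m)
    refine le_trans (le_of_eq ?_) this
    field_simp
  have hρ1 : ∀ i, |ρ i - 1| ≤ 1 / 100 := fun i => by
    refine abs_le_of_sq_le_sq ?_ (by norm_num)
    have h1 := varRatio_sub_one hlam hm hs ht hs₀ ht₀ i
    have h2 := (varRatio_mem hlam hm hs ht hs₀ ht₀ i)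
    have h3 : 0 ≤ ρ i := (div_pos hm (hm.trans_le (hs.1.trans hs.2))).le.trans h2.1
    rw [← hρ] at h1 h2
    rw [h1, neg_sq, mul_pow]
    have h4 := (hsmall (s - s₀) (t - t₀) i).trans hd
    have h5 : ρ i ^ 2 ≤ L ^ 2 := pow_le_pow_left₀ h3 h2.2 2
    set D := relVar lam s₀ t₀ (s - s₀) (t - t₀) i
    have h6 : L ^ 2 * D ^ 2 * (m ^ 2 * Λ) ≤ (1 / 100) ^ 2 * (m ^ 2 * Λ) := by
      nlinarith [mul_le_mul_of_nonneg_left h4 (sq_nonneg L)]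
    exact (mul_le_mul_of_nonneg_right h5 (sq_nonneg D)).trans (le_of_mul_le_mul_right h6 hmΛ)
  -- Large information spreads `d` over many coordinates: none carries more than the fraction `1 /
  -- (m² Λ)` of `∑ d_i²`. The mean shift has `∑ h_i² ≤ R`, so the product is negligible once `Λ` is
  -- large compared with `R / m²`.
  have hdh : ∑ i, (d i * h i) ^ 2 ≤ (1 / 100) ^ 2 * ∑ i, d i ^ 2 := by
    have h1 : ∀ i, d i ^ 2 ≤ (∑ i, d i ^ 2) / (m ^ 2 * Λ) := fun i => by
      rw [le_div_iff₀ hmΛ]; exact hsmall ds dt i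
    have hS : 0 ≤ ∑ i, d i ^ 2 := Finset.sum_nonneg fun i _ => sq_nonneg _
    calc ∑ i, (d i * h i) ^ 2 ≤ ∑ i, (∑ i, d i ^ 2) / (m ^ 2 * Λ) * h i ^ 2 := by
          refine Finset.sum_le_sum fun i _ => ?_
          rw [mul_pow]
          exact mul_le_mul_of_nonneg_right (h1 i) (sq_nonneg _)
      _ = (∑ i, d i ^ 2) / (m ^ 2 * Λ) * ∑ i, h i ^ 2 := by rw [← Finset.mul_sum]
      _ ≤ (∑ i, d i ^ 2) / (m ^ 2 * Λ) * R := by gcongr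
      _ ≤ _ := by
          rw [div_mul_eq_mul_div, div_le_iff₀ hmΛ]
          nlinarith [mul_le_mul_of_nonneg_left hRΛ hS, mul_nonneg hS (mul_nonneg (sq_nonneg L) hR)]
  set S := ∑ i, d i ^ 2 with hS
  have hS0 : 0 ≤ S := Finset.sum_nonneg fun i _ => sq_nonneg _
  have hpt : ∀ i, (1 - 1 / 100) ^ 2 * (w i + d i * z i) ^ 2
      - 100 * (2 * (1 / 100) ^ 2 * (d i * z i) ^ 2 + 4 * (d i * h i) ^ 2)
      - 1 / 2 * ((1 + 1 / 100) ^ 2 * d i ^ 2)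
      ≤ ρ i * (w i + ρ i * d i * (z i + h i)) ^ 2 - 1 / 2 * (ρ i * d i) ^ 2 := by
    exact fun i => perturbed_term_ge (hρ1 i)
  have hsum := Finset.sum_le_sum fun i (_ : i ∈ Finset.univ) => hpt i
  simp only [Finset.sum_sub_distrib, ← Finset.mul_sum, Finset.sum_add_distrib] at hsum
  rw [← hS] at hsum
  -- The numerical margins: about `0.97 Q + 0.40 S` survives the error terms, where `Q / 2 + S / 4`
  -- is needed.
  have h1 := (abs_le.mp hstab₀).2
  have h2 := (abs_le.mp hstab).1
  linarith

end Mixed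

end RENSEM

namespace RENSEM

variable {p : ℕ}

/-! ### Frobenius norms and square roots -/

theorem frob_sq (H : Matrix (Idx p) (Idx p) ℝ) : frob H ^ 2 = ∑ l, ∑ k, H k l ^ 2 := by
  have h : (Hᵀ * H).trace = ∑ l, ∑ k, H k l ^ 2 := by
    simp [Matrix.trace, Matrix.mul_apply, sq]
  rw [frob, h, Real.sq_sqrt (Finset.sum_nonneg fun l _ => Finset.sum_nonneg fun k _ => sq_nonneg _)]

theorem frob_nonneg (H : Matrix (Idx p) (Idx p) ℝ) : 0 ≤ frob H := Real.sqrt_nonneg _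

theorem frob_transpose (H : Matrix (Idx p) (Idx p) ℝ) : frob Hᵀ = frob H := by
  rw [frob, frob, transpose_transpose, trace_mul_comm]

theorem abs_apply_le_frob (H : Matrix (Idx p) (Idx p) ℝ) (k l : Idx p) : |H k l| ≤ frob H := by
  refine abs_le_of_sq_le_sq ?_ (frob_nonneg H)
  rw [frob_sq]
  exact (Finset.single_le_sum (f := fun k => H k l ^ 2) (fun _ _ => sq_nonneg _)
    (Finset.mem_univ k)).trans (Finset.single_le_sum (f := fun l => ∑ k, H k l ^ 2)
    (fun _ _ => Finset.sum_nonneg fun _ _ => sq_nonneg _) (Finset.mem_univ l))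

theorem mulVec_sq_le (H : Matrix (Idx p) (Idx p) ℝ) (x : Idx p → ℝ) :
    (H *ᵥ x) ⬝ᵥ (H *ᵥ x) ≤ frob H ^ 2 * (x ⬝ᵥ x) := by
  rw [frob_sq, Finset.sum_comm, dotProduct, Finset.sum_mul]
  refine Finset.sum_le_sum fun k _ => ?_
  have h := Finset.sum_mul_sq_le_sq_mul_sq Finset.univ (fun l => H k l) x
  rw [← sq]
  refine h.trans (le_of_eq ?_)
  simp [dotProduct, sq]

theorem dotProduct_self_nonneg (x : Idx p → ℝ) : 0 ≤ x ⬝ᵥ x :=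
  Finset.sum_nonneg fun _ _ => mul_self_nonneg _

theorem abs_dotProduct_mulVec_le (H : Matrix (Idx p) (Idx p) ℝ) (x : Idx p → ℝ) :
    |x ⬝ᵥ (H *ᵥ x)| ≤ frob H * (x ⬝ᵥ x) := by
  refine abs_le_of_sq_le_sq ?_ (mul_nonneg (frob_nonneg H) (dotProduct_self_nonneg x))
  have h := Finset.sum_mul_sq_le_sq_mul_sq Finset.univ x (H *ᵥ x)
  have h2 := mulVec_sq_le H x
  have e : ∀ v : Idx p → ℝ, ∑ i, v i ^ 2 = v ⬝ᵥ v := fun v => by simp [dotProduct, sq]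
  rw [e, e] at h
  rw [mul_pow]
  exact h.trans ((mul_le_mul_of_nonneg_left h2 (dotProduct_self_nonneg x)).trans
    (le_of_eq (by ring)))

section Sqrt

variable {B : Matrix (Idx p) (Idx p) ℝ}

theorem msqrt_mul_self (hB : B.PosDef) : msqrt B * msqrt B = B := by
  open scoped MatrixOrder in
  exact CFC.sqrt_mul_sqrt_self B hB.posSemidef.nonneg

theorem msqrt_transpose (B : Matrix (Idx p) (Idx p) ℝ) : (msqrt B)ᵀ = msqrt B := by
  open scoped MatrixOrder in
  have h := (CFC.sqrt_nonneg B).posSemidef.isHermitian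
  rwa [IsHermitian, conjTranspose_eq_transpose_of_trivial] at h

theorem isUnit_det_msqrt (hB : B.PosDef) : IsUnit (msqrt B).det := by
  have h := hB.det_pos
  rw [← msqrt_mul_self hB, det_mul] at h
  exact isUnit_iff_ne_zero.mpr fun h0 => by simp [h0] at h

theorem dotProduct_msqrt (B : Matrix (Idx p) (Idx p) ℝ) (x y : Idx p → ℝ) :
    x ⬝ᵥ (msqrt B *ᵥ y) = (msqrt B *ᵥ x) ⬝ᵥ y := by
  rw [dotProduct_mulVec, ← mulVec_transpose, msqrt_transpose]

theorem msqrt_sq_form (hB : B.PosDef) (u : Idx p → ℝ) :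
    (msqrt B *ᵥ u) ⬝ᵥ (msqrt B *ᵥ u) = u ⬝ᵥ (B *ᵥ u) := by
  rw [← dotProduct_msqrt, mulVec_mulVec, msqrt_mul_self hB]

/-- The Frobenius condition on the normalized information is read as a relative error of quadratic
forms, by substituting `B^{1/2} u`. -/
theorem abs_form_sub_le (hB : B.PosDef) (J : Matrix (Idx p) (Idx p) ℝ) (u : Idx p → ℝ) :
    |u ⬝ᵥ (J *ᵥ u) - u ⬝ᵥ (B *ᵥ u)|
      ≤ frob ((msqrt B)⁻¹ * J * (msqrt B)⁻¹ - 1) * (u ⬝ᵥ (B *ᵥ u)) := by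
  have hu := isUnit_det_msqrt hB
  have h := abs_dotProduct_mulVec_le ((msqrt B)⁻¹ * J * (msqrt B)⁻¹ - 1) (msqrt B *ᵥ u)
  rw [msqrt_sq_form hB, sub_mulVec, one_mulVec, dotProduct_sub, msqrt_sq_form hB] at h
  convert h using 3
  rw [← dotProduct_msqrt, mulVec_mulVec, mulVec_mulVec]
  congr 2
  rw [← Matrix.mul_assoc, ← Matrix.mul_assoc, mul_nonsing_inv _ hu, Matrix.one_mul,
    Matrix.mul_assoc, nonsing_inv_mul _ hu, Matrix.mul_one]

/-- Writing `B'^{1/2} u = (I + D) B^{1/2} u` with `‖D‖_F ≤ f`, the squared lengths differ relatively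
by at most `2 f + f²`. -/
theorem abs_form_sub_le_of_sqrt {B' : Matrix (Idx p) (Idx p) ℝ} (hB : B.PosDef) (hB' : B'.PosDef)
    {f : ℝ} (hf : frob ((msqrt B)⁻¹ * msqrt B' - 1) ≤ f) (u : Idx p → ℝ) :
    |u ⬝ᵥ (B' *ᵥ u) - u ⬝ᵥ (B *ᵥ u)| ≤ (2 * f + f ^ 2) * (u ⬝ᵥ (B *ᵥ u)) := by
  have hu := isUnit_det_msqrt hB
  set D := ((msqrt B)⁻¹ * msqrt B' - 1)ᵀ with hD
  have hf0 : 0 ≤ frob D := frob_nonneg D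
  have hDf : frob D ≤ f := by rw [hD, frob_transpose]; exact hf
  have h1 : msqrt B' *ᵥ u = msqrt B *ᵥ u + D *ᵥ (msqrt B *ᵥ u) := by
    rw [mulVec_mulVec, ← add_mulVec]
    congr 1
    have : D * msqrt B = (msqrt B * ((msqrt B)⁻¹ * msqrt B' - 1))ᵀ := by
      rw [transpose_mul, msqrt_transpose]
    rw [this, Matrix.mul_sub, ← Matrix.mul_assoc, mul_nonsing_inv _ hu, Matrix.one_mul,
      Matrix.mul_one, transpose_sub, msqrt_transpose, msqrt_transpose]
    abel
  rw [← msqrt_sq_form hB, ← msqrt_sq_form hB', h1]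
  set v := msqrt B *ᵥ u
  have h2 := abs_dotProduct_mulVec_le D v
  have h3 := mulVec_sq_le D v
  have h4 := dotProduct_self_nonneg v
  have h5 := dotProduct_self_nonneg (D *ᵥ v)
  rw [add_dotProduct, dotProduct_add, dotProduct_add, dotProduct_comm (D *ᵥ v) v]
  have h6 : frob D * (v ⬝ᵥ v) ≤ f * (v ⬝ᵥ v) := mul_le_mul_of_nonneg_right hDf h4
  have h7 : frob D ^ 2 * (v ⬝ᵥ v) ≤ f ^ 2 * (v ⬝ᵥ v) :=
    mul_le_mul_of_nonneg_right (pow_le_pow_left₀ hf0 hDf 2) h4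
  rw [abs_le] at h2 ⊢
  have h8 : 0 ≤ f ^ 2 * (v ⬝ᵥ v) := mul_nonneg (sq_nonneg f) h4
  constructor <;> linarith

/-- A small inverse means a large form: this turns `‖B_N⁻¹‖_F → 0` into `B_N ≥ Λ I` eventually, for
every `Λ`. -/
theorem dotProduct_self_le_frob_inv (hB : B.PosDef) (u : Idx p → ℝ) :
    u ⬝ᵥ u ≤ frob B⁻¹ * (u ⬝ᵥ (B *ᵥ u)) := by
  have hu := isUnit_det_msqrt hB
  have hinv : msqrt B * B⁻¹ * msqrt B = 1 := by
    have h1 : B⁻¹ = (msqrt B)⁻¹ * (msqrt B)⁻¹ := by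
      conv_lhs => rw [← msqrt_mul_self hB]
      exact Matrix.mul_inv_rev _ _
    rw [h1, ← Matrix.mul_assoc, mul_nonsing_inv _ hu, Matrix.one_mul, nonsing_inv_mul _ hu]
  have h := abs_dotProduct_mulVec_le B⁻¹ (msqrt B *ᵥ u)
  rw [msqrt_sq_form hB, ← dotProduct_msqrt, mulVec_mulVec, mulVec_mulVec, hinv, one_mulVec] at h
  exact (le_abs_self _).trans h

end Sqrt

theorem form_nonneg {B : Matrix (Idx p) (Idx p) ℝ} (hB : B.PosDef) (u : Idx p → ℝ) :
    0 ≤ u ⬝ᵥ (B *ᵥ u) := by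
  rw [← msqrt_sq_form hB]; exact dotProduct_self_nonneg _

end RENSEM

namespace RENSEM

variable {p : ℕ}

/-! ### Convex functions close to a quadratic -/

/-- The cube is the convex hull of its corners, and a convex function on a hull is dominated by its
value at some generating point. -/
theorem convexOn_le_of_corners {d : ℕ} {D : (Fin d → ℝ) → ℝ} (hD : ConvexOn ℝ Set.univ D)
    {r K : ℝ} (hr : 0 ≤ r)
    (hcorner : ∀ σ : Fin d → Bool, D (fun i => if σ i then r else -r) ≤ K) {y : Fin d → ℝ}
    (hy : ‖y‖ ≤ r) : D y ≤ K := by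
  have hmem : y ∈ convexHull ℝ (Set.univ.pi fun _ : Fin d => ({-r, r} : Set ℝ)) := by
    rw [convexHull_pi]
    intro i _
    rw [convexHull_pair, segment_eq_Icc (by linarith)]
    have := (norm_le_pi_norm y i).trans hy
    rw [Real.norm_eq_abs, abs_le] at this
    exact this
  obtain ⟨c, hc, hle⟩ := hD.exists_ge_of_mem_convexHull (Set.subset_univ _) hmem
  refine hle.trans ?_
  have : c = fun i => if (decide (c i = r) : Bool) then r else -r := by
    funext i
    have := hc i (Set.mem_univ i)
    simp only [Set.mem_insert_iff, Set.mem_singleton_iff] at this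
    rcases this with h | h
    · by_cases h' : c i = r <;> simp [h', h]
    · simp [h]
  rw [this]
  exact hcorner _

/-- Finitely many points at which approximation of a convex function by a quadratic forces
quadratic growth on the sphere of radius `r`. -/
theorem exists_finite_test_points (d : ℕ) {r : ℝ} (hr : 0 < r) :
    ∃ F : Finset (Fin d → ℝ), ∀ D : (Fin d → ℝ) → ℝ, ConvexOn ℝ Set.univ D → (∀ y, 0 ≤ D y) →
      (∀ y ∈ F, |D y - 1 / 2 * ∑ i, y i ^ 2| ≤ r ^ 2 / 16) →
      ∀ y, ‖y‖ = r → r ^ 2 / 4 ≤ D y := by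
  classical
  -- Chosen so that `θ (2 d + 1) ≤ 1/8`, where `(2 d + 1) r²` bounds `D` on the cube of radius `2
  -- r`. The test points are a `θ r`-net of the sphere and the corners of that cube.
  set θ : ℝ := 1 / (16 * (d + 1)) with hθ
  have hd : (0 : ℝ) ≤ d := Nat.cast_nonneg d
  have hθ0 : 0 < θ := by positivity
  have hθ1 : θ ≤ 1 := by
    rw [hθ, div_le_one (by positivity)]; linarith
  obtain ⟨t, ht, htf, hcov⟩ := (isCompact_sphere (0 : Fin d → ℝ) r).finite_cover_balls
    (mul_pos hθ0 hr)
  refine ⟨htf.toFinset ∪ Finset.univ.image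
    (fun (σ : Fin d → Bool) i => if σ i then 2 * r else -(2 * r)), ?_⟩
  intro D hD hD0 happ y hy
  have hcorner : ∀ σ : Fin d → Bool, D (fun i => if σ i then 2 * r else -(2 * r))
      ≤ (2 * d + 1) * r ^ 2 := fun σ => by
    have h := (abs_le.mp (happ _ (Finset.mem_union_right _ (Finset.mem_image_of_mem _
      (Finset.mem_univ σ))))).2
    have h2 : ∑ i : Fin d, (if σ i then 2 * r else -(2 * r)) ^ 2 = d * (4 * r ^ 2) := by
      have : ∀ i : Fin d, (if σ i then 2 * r else -(2 * r)) ^ 2 = 4 * r ^ 2 := fun i => by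
        split_ifs <;> ring
      simp only [this, Finset.sum_const, Finset.card_univ, Fintype.card_fin, nsmul_eq_mul]
    rw [h2] at h
    nlinarith [sq_nonneg r]
  have hys : y ∈ Metric.sphere (0 : Fin d → ℝ) r := by simpa using hy
  obtain ⟨f, hf, hyf⟩ : ∃ f ∈ t, dist y f < θ * r := by
    simpa using hcov hys
  have hfn : ‖f‖ = r := by simpa using ht hf
  have hfD := (abs_le.mp (happ f (Finset.mem_union_left _ (by simpa using hf)))).1
  have hfsq : r ^ 2 ≤ ∑ i, f i ^ 2 := by
    have h1 : ‖f‖ ≤ Real.sqrt (∑ i, f i ^ 2) := by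
      rw [pi_norm_le_iff_of_nonneg (Real.sqrt_nonneg _)]
      intro i
      exact Real.abs_le_sqrt (Finset.single_le_sum (f := fun i => f i ^ 2)
        (fun _ _ => sq_nonneg _) (Finset.mem_univ i))
    rw [hfn] at h1
    calc r ^ 2 ≤ Real.sqrt (∑ i, f i ^ 2) ^ 2 := pow_le_pow_left₀ hr.le h1 2
      _ = _ := Real.sq_sqrt (Finset.sum_nonneg fun _ _ => sq_nonneg _)
  -- Extrapolating from `y` through the nearby test point `f` gives `f = (1 - θ) y + θ z` with `z`
  -- still in the cube. Convexity then bounds `D y` from below: `(1 - θ) D y ≥ D f - θ D z ≥ 7 r²/16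
  -- - r²/8`.
  set z := y + θ⁻¹ • (f - y) with hz
  have hzn : ‖z‖ ≤ 2 * r := by
    have h1 : ‖θ⁻¹ • (f - y)‖ ≤ r := by
      rw [norm_smul, norm_inv, Real.norm_of_nonneg hθ0.le, ← dist_eq_norm, dist_comm,
        inv_mul_le_iff₀ hθ0]
      exact hyf.le
    linarith [norm_add_le y (θ⁻¹ • (f - y))]
  have hzD := convexOn_le_of_corners hD (by positivity) hcorner hzn
  have hconv := hD.2 (Set.mem_univ y) (Set.mem_univ z) (by linarith : 0 ≤ 1 - θ) hθ0.le
    (by ring)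
  have hfz : (1 - θ) • y + θ • z = f := by
    rw [hz, smul_add, smul_smul, mul_inv_cancel₀ hθ0.ne', one_smul, sub_smul, one_smul]
    abel
  rw [hfz, smul_eq_mul, smul_eq_mul] at hconv
  have h1 : θ * D z ≤ r ^ 2 / 8 := by
    refine (mul_le_mul_of_nonneg_left hzD hθ0.le).trans ?_
    have : θ * (2 * d + 1) ≤ 1 / 8 := by
      rw [hθ, div_mul_eq_mul_div, div_le_div_iff₀ (by positivity) (by norm_num)]
      linarith
    nlinarith [mul_le_mul_of_nonneg_right this (sq_nonneg r)]
  nlinarith [mul_nonneg hθ0.le (hD0 y), sq_nonneg r]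

/-- Within radius `r` the linear term is at most `K d r`. Beyond it, shrink `y` to the sphere: there
`D ≥ r²/4 ≥ K d r` beats the linear term, and since `D 0 = 0` convexity propagates this outward
along the ray. -/
theorem sub_le_of_quadratic_growth {d : ℕ} {D : (Fin d → ℝ) → ℝ} (hD : ConvexOn ℝ Set.univ D)
    (hD0 : D 0 = 0) (hDn : ∀ y, 0 ≤ D y) {U : Fin d → ℝ} {K r : ℝ} (hK : 0 ≤ K)
    (hU : ∀ k, |U k| ≤ K)
    (hr : 0 < r) (hrK : 4 * K * d ≤ r) (hgrow : ∀ y, ‖y‖ = r → r ^ 2 / 4 ≤ D y)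
    (y : Fin d → ℝ) : U ⬝ᵥ y - D y ≤ K * d * r := by
  have hUy : ∀ y : Fin d → ℝ, U ⬝ᵥ y ≤ K * d * ‖y‖ := fun y => by
    calc U ⬝ᵥ y ≤ ∑ _k : Fin d, K * ‖y‖ := by
          refine Finset.sum_le_sum fun k _ => (le_abs_self _).trans ?_
          rw [abs_mul]
          exact mul_le_mul (hU k) (norm_le_pi_norm y k) (abs_nonneg _) hK
      _ = _ := by simp; ring
  have hKd : 0 ≤ K * d := by positivity
  by_cases hy : ‖y‖ ≤ r
  · have := hUy y
    have h2 := mul_le_mul_of_nonneg_left hy hKd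
    linarith [hDn y]
  · push Not at hy
    have hy0 : 0 < ‖y‖ := hr.trans hy
    set c := r / ‖y‖ with hc
    have hc0 : 0 < c := div_pos hr hy0
    have hc1 : c ≤ 1 := (div_le_one hy0).mpr hy.le
    have hn : ‖c • y‖ = r := by
      rw [norm_smul, Real.norm_of_nonneg hc0.le, hc, div_mul_cancel₀ _ hy0.ne']
    have h1 := hgrow _ hn
    have h2 := hUy (c • y)
    rw [hn, dotProduct_smul, smul_eq_mul] at h2
    have hconv := hD.2 (Set.mem_univ y) (Set.mem_univ 0) hc0.le (by linarith : 0 ≤ 1 - c) (by ring)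
    rw [smul_zero, add_zero, hD0, smul_zero, add_zero, smul_eq_mul] at hconv
    have h3 : c * (U ⬝ᵥ y - D y) ≤ 0 := by nlinarith
    have h4 : U ⬝ᵥ y - D y ≤ 0 := by
      by_contra hlt
      push Not at hlt
      linarith [mul_pos hc0 hlt]
    have : 0 ≤ K * d * r := by positivity
    linarith

/-! ### The logistic log-likelihood -/

section Logistic

variable {N : ℕ}

/-- The Bregman divergence of the logistic log-partition function. -/
noncomputable def logisticBregman (C : Fin N → Fin p → ℝ) (α x : Fin p → ℝ) : ℝ :=
  ∑ i, (Real.log (1 + Real.exp ((α + x) ⬝ᵥ C i)) - Real.log (1 + Real.exp (α ⬝ᵥ C i))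
    - logistic (α ⬝ᵥ C i) * (x ⬝ᵥ C i))

theorem logistic_mem (x : ℝ) : 0 < logistic x ∧ logistic x < 1 := by
  have h := Real.exp_pos x
  unfold logistic
  exact ⟨by positivity, (div_lt_one (by positivity)).mpr (by linarith)⟩

theorem continuous_logistic : Continuous logistic := by
  unfold logistic
  exact Real.continuous_exp.div (by fun_prop) fun x => by positivity

theorem convexOn_log_one_add_exp :
    ConvexOn ℝ Set.univ (fun x => Real.log (1 + Real.exp x)) := by
  have hd : deriv (fun x => Real.log (1 + Real.exp x)) = logistic :=
    funext fun x => (hasDerivAt_log_one_add_exp x).deriv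
  refine convexOn_univ_of_deriv2_nonneg
    (fun x => (hasDerivAt_log_one_add_exp x).differentiableAt) ?_ fun x => ?_
  · rw [hd]
    exact fun x => (hasDerivAt_logistic x).differentiableAt
  · rw [Function.iterate_succ, Function.iterate_one, Function.comp_apply, hd,
      (hasDerivAt_logistic x).deriv]
    have := logistic_mem x
    exact mul_nonneg this.1.le (by linarith)

theorem convexOn_logisticBregman (C : Fin N → Fin p → ℝ) (α : Fin p → ℝ) :
    ConvexOn ℝ Set.univ (logisticBregman C α) := by
  refine ⟨convex_univ, fun x _ y _ a b ha hb hab => ?_⟩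
  simp only [logisticBregman, smul_eq_mul, Finset.mul_sum]
  rw [← Finset.sum_add_distrib]
  refine Finset.sum_le_sum fun i _ => ?_
  have h := convexOn_log_one_add_exp.2 (Set.mem_univ ((α + x) ⬝ᵥ C i))
    (Set.mem_univ ((α + y) ⬝ᵥ C i)) ha hb hab
  have e : a • ((α + x) ⬝ᵥ C i) + b • ((α + y) ⬝ᵥ C i) = (α + (a • x + b • y)) ⬝ᵥ C i := by
    simp only [add_dotProduct, smul_dotProduct, smul_eq_mul]
    have : b = 1 - a := by linarith
    rw [this]; ring
  rw [e] at h
  simp only [smul_eq_mul] at h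
  simp only [add_dotProduct (a • x), smul_dotProduct, smul_eq_mul]
  have hb' : b = 1 - a := by linarith
  subst hb'
  linarith

theorem logisticBregman_zero (C : Fin N → Fin p → ℝ) (α : Fin p → ℝ) :
    logisticBregman C α 0 = 0 := by
  simp [logisticBregman]

theorem continuous_logisticForm (C : Fin N → Fin p → ℝ) (α x : Fin p → ℝ) :
    Continuous fun t : ℝ => logisticForm C (α + t • x) x x := by
  unfold logisticForm
  simp only [add_dotProduct, smul_dotProduct, smul_eq_mul]
  have := continuous_logistic
  fun_prop

theorem logisticForm_nonneg (C : Fin N → Fin p → ℝ) (α x : Fin p → ℝ) :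
    0 ≤ logisticForm C α x x :=
  Finset.sum_nonneg fun i _ => mul_nonneg (mul_nonneg (logistic_mem _).1.le
    (by linarith [(logistic_mem (α ⬝ᵥ C i)).2])) (mul_self_nonneg _)

/-- Taylor's formula with integral remainder: it expresses the divergence through the information
along the segment, which is what the regularity conditions control. -/
theorem logisticBregman_eq_integral (C : Fin N → Fin p → ℝ) (α x : Fin p → ℝ) :
    logisticBregman C α x = ∫ t in (0 : ℝ)..1, (1 - t) * logisticForm C (α + t • x) x x := by
  have hG : ∀ t : ℝ, HasDerivAt (fun t : ℝ => ∑ i, ((1 - t) *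
      (logistic ((α + t • x) ⬝ᵥ C i) * (x ⬝ᵥ C i))
        + Real.log (1 + Real.exp ((α + t • x) ⬝ᵥ C i))))
      ((1 - t) * logisticForm C (α + t • x) x x) t := by
    intro t
    rw [logisticForm, Finset.mul_sum]
    refine HasDerivAt.fun_sum fun i _ => ?_
    have h1 : HasDerivAt (fun t : ℝ => (α + t • x) ⬝ᵥ C i) (x ⬝ᵥ C i) t := by
      simp only [add_dotProduct, smul_dotProduct, smul_eq_mul]
      simpa using ((hasDerivAt_id t).mul_const (x ⬝ᵥ C i)).const_add (α ⬝ᵥ C i)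
    have h2 := ((hasDerivAt_logistic _).comp t h1).mul_const (x ⬝ᵥ C i)
    have h3 := (hasDerivAt_log_one_add_exp _).comp t h1
    refine ((((hasDerivAt_id t).const_sub 1).mul h2).add h3).congr_deriv ?_
    simp only [id_eq, Function.comp_apply]
    ring
  rw [intervalIntegral.integral_eq_sub_of_hasDerivAt (fun t _ => hG t)
    (Continuous.intervalIntegrable (by
      have := continuous_logisticForm C α x
      fun_prop) _ _)]
  rw [← Finset.sum_sub_distrib, logisticBregman]
  refine Finset.sum_congr rfl fun i _ => ?_
  simp
  ring

theorem logisticBregman_nonneg (C : Fin N → Fin p → ℝ) (α x : Fin p → ℝ) :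
    0 ≤ logisticBregman C α x := by
  rw [logisticBregman_eq_integral]
  refine intervalIntegral.integral_nonneg zero_le_one fun t ht => ?_
  exact mul_nonneg (by linarith [ht.2]) (logisticForm_nonneg _ _ _)

/-- The weight `1 - t` has integral `1/2` and is at most 1 on `[0, 1]`. The right-hand side is in a
form that allows exchanging the integrals over `t` and `ω`. -/
theorem abs_logisticBregman_sub_le (C : Fin N → Fin p → ℝ) (α x : Fin p → ℝ) (b : ℝ) :
    ENNReal.ofReal |logisticBregman C α x - 1 / 2 * b|
      ≤ ∫⁻ t in Set.Icc (0 : ℝ) 1, ENNReal.ofReal |logisticForm C (α + t • x) x x - b| := by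
  have hc := continuous_logisticForm C α x
  have h1 : (1 / 2 : ℝ) * b = ∫ t in (0 : ℝ)..1, (1 - t) * b := by
    have h : ∫ t in (0 : ℝ)..1, (1 - t) = 1 / 2 := by
      rw [intervalIntegral.integral_sub (by simp) (by simp)]
      norm_num [integral_id]
    rw [intervalIntegral.integral_mul_const, h]
  have h2 : logisticBregman C α x - 1 / 2 * b
      = ∫ t in (0 : ℝ)..1, (1 - t) * (logisticForm C (α + t • x) x x - b) := by
    rw [logisticBregman_eq_integral, h1, ← intervalIntegral.integral_sub]
    · refine intervalIntegral.integral_congr fun t _ => ?_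
      ring
    · exact Continuous.intervalIntegrable (by fun_prop) _ _
    · exact Continuous.intervalIntegrable (by fun_prop) _ _
  rw [h2, intervalIntegral.integral_of_le zero_le_one, ← Real.enorm_eq_ofReal_abs]
  refine (enorm_integral_le_lintegral_enorm _).trans ?_
  rw [← restrict_Ioc_eq_restrict_Icc]
  refine setLIntegral_mono' measurableSet_Ioc fun t ht => ?_
  rw [Real.enorm_eq_ofReal_abs]
  refine ENNReal.ofReal_le_ofReal ?_
  rw [abs_mul]
  refine mul_le_of_le_one_left (abs_nonneg _) ?_
  rw [abs_le]
  constructor <;> linarith [ht.1, ht.2]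

end Logistic

end RENSEM

/-! ### Tightness of the exposure log-likelihood ratio -/

namespace RENSEM

variable {p : ℕ} {Ω : Type*}

theorem measure_lt_abs_le_of_lintegral_le [MeasurableSpace Ω] (P : Measure Ω) {f : Ω → ℝ}
    (hf : Measurable f) {c D : ℝ} (hc : 0 < c)
    (h : ∫⁻ ω, ENNReal.ofReal |f ω| ∂P ≤ ENNReal.ofReal D) :
    P {ω | c < |f ω|} ≤ ENNReal.ofReal (D / c) := by
  calc P {ω | c < |f ω|} ≤ P {ω | ENNReal.ofReal c ≤ ENNReal.ofReal |f ω|} :=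
        measure_mono fun ω hω => ENNReal.ofReal_le_ofReal (le_of_lt hω)
    _ ≤ (∫⁻ ω, ENNReal.ofReal |f ω| ∂P) / ENNReal.ofReal c :=
        meas_ge_le_lintegral_div (by fun_prop) (by simpa using hc) ENNReal.ofReal_ne_top
    _ ≤ _ := by
        rw [ENNReal.ofReal_div_of_pos hc]
        gcongr

theorem measurable_logisticForm [MeasurableSpace Ω] {N : ℕ} {C : Ω → Fin N → Fin p → ℝ}
    (hC : Measurable C) (α x : Fin p → ℝ) :
    Measurable fun w : Ω × ℝ => logisticForm (C w.1) (α + w.2 • x) x x := by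
  have hCi : ∀ i k, Measurable fun ω => C ω i k := fun i k =>
    (measurable_pi_apply k).comp ((measurable_pi_apply i).comp hC)
  have hl := continuous_logistic.measurable
  have h1 : ∀ i, Measurable fun w : Ω × ℝ => x ⬝ᵥ C w.1 i := fun i =>
    Finset.measurable_sum _ fun k _ => ((hCi i k).comp measurable_fst).const_mul _
  have h2 : ∀ i, Measurable fun w : Ω × ℝ => (α + w.2 • x) ⬝ᵥ C w.1 i := fun i => by
    refine Finset.measurable_sum _ fun k _ => Measurable.mul ?_ ((hCi i k).comp measurable_fst)
    simp only [Pi.add_apply, Pi.smul_apply, smul_eq_mul]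
    fun_prop
  unfold logisticForm
  refine Finset.measurable_sum _ fun i _ => ?_
  have h3 := hl.comp (h2 i)
  exact (h3.mul (measurable_const.sub h3)).mul ((h1 i).mul (h1 i))

theorem measurable_logisticBregman [MeasurableSpace Ω] {N : ℕ} {C : Ω → Fin N → Fin p → ℝ}
    (hC : Measurable C) (α x : Fin p → ℝ) :
    Measurable fun ω => logisticBregman (C ω) α x := by
  have hCi : ∀ i k, Measurable fun ω => C ω i k := fun i k =>
    (measurable_pi_apply k).comp ((measurable_pi_apply i).comp hC)
  have hd : ∀ (v : Fin p → ℝ) i, Measurable fun ω => v ⬝ᵥ C ω i := fun v i =>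
    Finset.measurable_sum _ fun k _ => (hCi i k).const_mul _
  have hl := continuous_logistic.measurable
  unfold logisticBregman
  refine Finset.measurable_sum _ fun i _ => ?_
  have h1 := hd (α + x) i
  have h2 := hd α i
  exact ((Real.measurable_log.comp (measurable_const.add (Real.measurable_exp.comp h1))).sub
    (Real.measurable_log.comp (measurable_const.add (Real.measurable_exp.comp h2)))).sub
    ((hl.comp h2).mul (hd x i))

/-- The score of the exposure model in the direction `x`. -/
noncomputable def logisticScore {N : ℕ} (C : Fin N → Fin p → ℝ) (A : Fin N → ℝ)
    (α x : Fin p → ℝ) : ℝ :=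
  ∑ i, (A i - logistic (α ⬝ᵥ C i)) * (x ⬝ᵥ C i)

theorem measurable_logisticScore [MeasurableSpace Ω] {N : ℕ} {C : Ω → Fin N → Fin p → ℝ}
    (hC : Measurable C) {A : Ω → Fin N → ℝ} (hA : Measurable A) (α x : Fin p → ℝ) :
    Measurable fun ω => logisticScore (C ω) (A ω) α x := by
  have hCi : ∀ i k, Measurable fun ω => C ω i k := fun i k =>
    (measurable_pi_apply k).comp ((measurable_pi_apply i).comp hC)
  have hd : ∀ (v : Fin p → ℝ) i, Measurable fun ω => v ⬝ᵥ C ω i := fun v i =>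
    Finset.measurable_sum _ fun k _ => (hCi i k).const_mul _
  unfold logisticScore
  exact Finset.measurable_sum _ fun i _ =>
    (((measurable_pi_apply i).comp hA).sub (continuous_logistic.measurable.comp (hd α i))).mul
      (hd x i)

theorem logisticScore_sum {N d : ℕ} (C : Fin N → Fin p → ℝ) (A : Fin N → ℝ) (α : Fin p → ℝ)
    (T : Matrix (Fin p) (Fin d) ℝ) (y : Fin d → ℝ) :
    logisticScore C A α (T *ᵥ y) = (fun k => logisticScore C A α (T.col k)) ⬝ᵥ y := by
  have h : ∀ i, (T *ᵥ y) ⬝ᵥ C i = ∑ k, (T.col k ⬝ᵥ C i) * y k := fun i => by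
    rw [dotProduct_comm, dotProduct_mulVec, dotProduct]
    refine Finset.sum_congr rfl fun k _ => ?_
    congr 1
    rw [dotProduct_comm]
    rfl
  simp only [logisticScore, h]
  rw [dotProduct]
  simp only [Finset.mul_sum, Finset.sum_mul]
  rw [Finset.sum_comm]
  simp only [mul_assoc]

/-- In `B`-orthonormal coordinates each score component has second moment at most 1, so all `p` stay
below `K₁` with probability at least `1 - δ/2`. The radius `r = 4 K₁ p + 1` is where quadratic
growth beats such a score. Its finitely many test points have `B`-form at most `R`, and `ε` is small
enough for Markov's inequality to give closeness to the quadratic at all of them with probability at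
least `1 - δ/2`. The constants depend on `p` and `δ` only, not on `N` or `B`. -/
theorem exists_logistic_sup_bound (p : ℕ) {δ : ℝ} (hδ : 0 < δ) :
    ∃ K R ε : ℝ, 0 ≤ K ∧ 0 < R ∧ 0 < ε ∧ ∀ {Ω : Type _} [MeasurableSpace Ω] (P : Measure Ω)
      [IsProbabilityMeasure P] {N : ℕ} {C : Ω → Fin N → Fin p → ℝ} (_ : Measurable C)
      {A : Ω → Fin N → ℝ} (_ : Measurable A) (α : Fin p → ℝ) {B : Matrix (Fin p) (Fin p) ℝ}
      (_ : B.PosDef),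
      (∀ x, x ⬝ᵥ (B *ᵥ x) ≤ R → ∀ t ∈ Set.Icc (0 : ℝ) 1,
        ∫⁻ ω, ENNReal.ofReal |logisticForm (C ω) (α + t • x) x x - x ⬝ᵥ (B *ᵥ x)| ∂P
          ≤ ENNReal.ofReal (ε * (x ⬝ᵥ (B *ᵥ x)))) →
      (∀ x, ∫⁻ ω, ENNReal.ofReal (logisticScore (C ω) (A ω) α x ^ 2) ∂P
        ≤ ENNReal.ofReal (x ⬝ᵥ (B *ᵥ x))) →
      P {ω | ¬ ∀ x, logisticScore (C ω) (A ω) α x - logisticBregman (C ω) α x ≤ K}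
        ≤ ENNReal.ofReal δ := by
  classical
  set K₁ : ℝ := 2 * p / δ + 1 with hK₁
  have hp0 : (0 : ℝ) ≤ p := Nat.cast_nonneg p
  have hK₁1 : 1 ≤ K₁ := by
    have : 0 ≤ 2 * p / δ := by positivity
    linarith
  set r : ℝ := 4 * K₁ * p + 1 with hr
  have hr0 : 0 < r := by positivity
  obtain ⟨F, hF⟩ := exists_finite_test_points p hr0
  set R : ℝ := ∑ f ∈ F, ∑ i, f i ^ 2 + 1 with hR
  have hFn : 0 ≤ ∑ f ∈ F, ∑ i, f i ^ 2 :=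
    Finset.sum_nonneg fun f _ => Finset.sum_nonneg fun i _ => sq_nonneg _
  have hR0 : 0 < R := by linarith
  set ε : ℝ := δ * r ^ 2 / (32 * R) with hε
  refine ⟨K₁ * p * r, R, ε, by positivity, hR0, by positivity, ?_⟩
  intro Ω _ P _ N C hC A hA α B hB h1 h2
  obtain ⟨M, T, hMB, hTM, hMT⟩ := exists_factor_of_posDef hB
  have hform : ∀ y, (T *ᵥ y) ⬝ᵥ (B *ᵥ (T *ᵥ y)) = ∑ k, y k ^ 2 := fun y => by
    rw [← hMB, dotProduct_transpose_mul_mulVec, mulVec_mulVec, hMT, one_mulVec]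
  -- the test points
  have hA1 : ∀ f ∈ F, P {ω | r ^ 2 / 16 < |logisticBregman (C ω) α (T *ᵥ f)
      - 1 / 2 * ∑ i, f i ^ 2|} ≤ ENNReal.ofReal (ε * (∑ i, f i ^ 2) / (r ^ 2 / 16)) := by
    intro f hf
    refine measure_lt_abs_le_of_lintegral_le P
      ((measurable_logisticBregman hC α _).sub_const _) (by positivity) ?_
    have hfR : ∑ i, f i ^ 2 ≤ R := by
      have := Finset.single_le_sum (f := fun f : Fin p → ℝ => ∑ i, f i ^ 2)
        (fun f _ => Finset.sum_nonneg fun i _ => sq_nonneg _) hf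
      linarith
    have hm := measurable_logisticForm hC α (T *ᵥ f)
    calc _ ≤ ∫⁻ ω, (∫⁻ t in Set.Icc (0 : ℝ) 1, ENNReal.ofReal
          |logisticForm (C ω) (α + t • (T *ᵥ f)) (T *ᵥ f) (T *ᵥ f) - ∑ i, f i ^ 2|) ∂P :=
          lintegral_mono fun ω => abs_logisticBregman_sub_le _ _ _ _
      _ = ∫⁻ t in Set.Icc (0 : ℝ) 1, (∫⁻ ω, ENNReal.ofReal
          |logisticForm (C ω) (α + t • (T *ᵥ f)) (T *ᵥ f) (T *ᵥ f) - ∑ i, f i ^ 2| ∂P) := by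
          refine lintegral_lintegral_swap (Measurable.aemeasurable ?_)
          exact ((hm.sub_const _).abs).ennreal_ofReal
      _ ≤ ∫⁻ _t in Set.Icc (0 : ℝ) 1, ENNReal.ofReal (ε * ∑ i, f i ^ 2) := by
          refine setLIntegral_mono' measurableSet_Icc fun t ht => ?_
          have := h1 (T *ᵥ f) (by rw [hform]; exact hfR) t ht
          rwa [hform] at this
      _ = _ := by simp
  have hA2 : P (⋃ f ∈ F, {ω | r ^ 2 / 16 < |logisticBregman (C ω) α (T *ᵥ f)
      - 1 / 2 * ∑ i, f i ^ 2|}) ≤ ENNReal.ofReal (δ / 2) := by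
    refine (measure_biUnion_finset_le _ _).trans ((Finset.sum_le_sum hA1).trans ?_)
    rw [← ENNReal.ofReal_sum_of_nonneg fun f _ => by positivity]
    refine ENNReal.ofReal_le_ofReal ?_
    rw [← Finset.sum_div, ← Finset.mul_sum, div_le_iff₀ (by positivity), hε]
    have : ∑ f ∈ F, ∑ i, f i ^ 2 ≤ R := by linarith
    calc _ ≤ δ * r ^ 2 / (32 * R) * R := by gcongr
      _ = _ := by field_simp; norm_num
  -- the score
  have hU1 : ∀ k : Fin p, P {ω | K₁ ^ 2 < |logisticScore (C ω) (A ω) α (T.col k) ^ 2|}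
      ≤ ENNReal.ofReal (1 / K₁ ^ 2) := by
    intro k
    refine measure_lt_abs_le_of_lintegral_le P
      ((measurable_logisticScore hC hA α _).pow_const 2) (by positivity) ?_
    simp only [abs_pow, sq_abs]
    refine (h2 _).trans (le_of_eq ?_)
    congr 1
    have : T.col k = T *ᵥ Pi.single k 1 := (mulVec_single_one T k).symm
    rw [this, hform]
    simp [Pi.single_apply]
  have hU2 : P (⋃ k ∈ (Finset.univ : Finset (Fin p)),
      {ω | K₁ ^ 2 < |logisticScore (C ω) (A ω) α (T.col k) ^ 2|}) ≤ ENNReal.ofReal (δ / 2) := by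
    refine (measure_biUnion_finset_le _ _).trans ((Finset.sum_le_sum fun k _ => hU1 k).trans ?_)
    rw [← ENNReal.ofReal_sum_of_nonneg fun f _ => by positivity]
    refine ENNReal.ofReal_le_ofReal ?_
    simp only [Finset.sum_const, Finset.card_univ, Fintype.card_fin, nsmul_eq_mul]
    rw [mul_one_div, div_le_iff₀ (by positivity)]
    have e1 : (p : ℝ) = δ / 2 * (2 * p / δ) := by field_simp
    have e2 : 2 * p / δ ≤ K₁ ^ 2 := by nlinarith
    calc (p : ℝ) = δ / 2 * (2 * p / δ) := e1
      _ ≤ δ / 2 * K₁ ^ 2 := by gcongr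
  calc _ ≤ P ((⋃ f ∈ F, {ω | r ^ 2 / 16 < |logisticBregman (C ω) α (T *ᵥ f)
      - 1 / 2 * ∑ i, f i ^ 2|}) ∪ (⋃ k ∈ (Finset.univ : Finset (Fin p)),
      {ω | K₁ ^ 2 < |logisticScore (C ω) (A ω) α (T.col k) ^ 2|})) := by
        refine measure_mono fun ω hω => ?_
        by_contra hnot
        simp only [Set.mem_union, Set.mem_iUnion, Set.mem_ofPred_eq, not_or, not_exists, not_lt,
          Finset.mem_univ, true_implies] at hnot hω
        refine hω fun x => ?_
        have hconv : ConvexOn ℝ Set.univ (fun y => logisticBregman (C ω) α (T *ᵥ y)) :=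
          (convexOn_logisticBregman (C ω) α).comp_linearMap T.mulVecLin
        have hgrow := hF _ hconv (fun y => logisticBregman_nonneg _ _ _) hnot.1
        have hU : ∀ k, |logisticScore (C ω) (A ω) α (T.col k)| ≤ K₁ := fun k => by
          have := hnot.2 k
          rw [abs_pow, sq_abs] at this
          exact abs_le_of_sq_le_sq this (by linarith)
        have := sub_le_of_quadratic_growth hconv
          (by simp [logisticBregman_zero]) (fun y => logisticBregman_nonneg _ _ _)
          (by linarith) hU hr0 (by rw [hr]; linarith) hgrow (M *ᵥ x)
        rw [← logisticScore_sum, mulVec_mulVec, hTM, one_mulVec] at this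
        exact this
    _ ≤ ENNReal.ofReal (δ / 2) + ENNReal.ofReal (δ / 2) :=
        (measure_union_le _ _).trans (add_le_add hA2 hU2)
    _ = _ := by
        rw [← ENNReal.ofReal_add (by positivity) (by positivity), add_halves]

end RENSEM

namespace RENSEM

variable {p : ℕ} {Ω : Type*}

/-! ### Whitening -/

section Whiten

variable {N : ℕ} (E : Matrix (Fin N) (Fin N) ℝ) {s t : ℝ}

/-- The linear map that whitens noise with covariance `covMat E s t`. -/
noncomputable def whiten (s t : ℝ) : Matrix (Fin N) (Fin N) ℝ :=
  diagonal (fun i => (Real.sqrt (s + t * gramEig E i))⁻¹) * gramRot E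

theorem gramVar_pos (hs : 0 < s) (ht : 0 < t) (i : Fin N) : 0 < s + t * gramEig E i :=
  add_pos_of_pos_of_nonneg hs (mul_nonneg ht.le (gramEig_nonneg E i))

theorem gramRot_mulVec_eq (hs : 0 < s) (ht : 0 < t) (v : Fin N → ℝ) (i : Fin N) :
    (gramRot E *ᵥ v) i = Real.sqrt (s + t * gramEig E i) * (whiten E s t *ᵥ v) i := by
  rw [whiten, ← mulVec_mulVec, mulVec_diagonal, ← mul_assoc,
    mul_inv_cancel₀ (Real.sqrt_pos.mpr (gramVar_pos E hs ht i)).ne', one_mul]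

theorem whiten_covMat (hs : 0 < s) (ht : 0 < t) :
    whiten E s t * covMat E s t * (whiten E s t)ᵀ = 1 := by
  rw [covMat_eq, whiten, transpose_mul, diagonal_transpose]
  set D := diagonal (fun i => (Real.sqrt (s + t * gramEig E i))⁻¹)
  calc _ = D * (gramRot E * (gramRot E)ᵀ) * diagonal (fun i => s + t * gramEig E i)
        * (gramRot E * (gramRot E)ᵀ) * D := by simp only [Matrix.mul_assoc]
    _ = 1 := by
        rw [gramRot_mul_transpose, Matrix.mul_one, Matrix.mul_one, diagonal_mul_diagonal,
          diagonal_mul_diagonal, ← diagonal_one]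
        congr 1
        funext i
        have h := gramVar_pos E hs ht i
        have h2 := Real.mul_self_sqrt h.le
        have h3 := (Real.sqrt_pos.mpr h).ne'
        field_simp
        rw [sq, h2]

/-- The whitened noise of a mixed equation, from the standardized random effects and errors. -/
noncomputable def whitenedNoise (s t : ℝ) (v : (Fin N → ℝ) × (Fin N → ℝ)) : Fin N → ℝ :=
  whiten E s t *ᵥ (E *ᵥ (Real.sqrt t • v.1) + Real.sqrt s • v.2)

theorem measurable_mulVec {m n : Type*} [Fintype n] (A : Matrix m n ℝ) :
    Measurable fun v : n → ℝ => A *ᵥ v := by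
  refine measurable_pi_lambda _ fun i => ?_
  simp only [mulVec, dotProduct]
  fun_prop

theorem measurable_whitenedNoise : Measurable (whitenedNoise E s t) := by
  unfold whitenedNoise
  have h1 : Measurable fun v : (Fin N → ℝ) × (Fin N → ℝ) => E *ᵥ (Real.sqrt t • v.1) :=
    (measurable_mulVec E).comp (by fun_prop)
  have h2 : Measurable fun v : (Fin N → ℝ) × (Fin N → ℝ) => Real.sqrt s • v.2 := by fun_prop
  exact (measurable_mulVec _).comp (h1.add h2)

/-- Random effects and errors together have covariance `covMat E s t`, which `whiten` reduces to the
identity. -/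
theorem measurePreserving_whitenedNoise (hs : 0 < s) (ht : 0 < t) :
    MeasurePreserving (whitenedNoise E s t) ((stdNormal N).prod (stdNormal N)) (stdNormal N) := by
  refine ⟨measurable_whitenedNoise E, ?_⟩
  have h : whitenedNoise E s t = fun v => (Real.sqrt t • (whiten E s t * E)) *ᵥ v.1
      + (Real.sqrt s • whiten E s t) *ᵥ v.2 := by
    funext v
    simp only [whitenedNoise, mulVec_add, mulVec_smul, smul_mulVec, mulVec_mulVec]
  rw [h]
  refine map_linear_stdNormal ?_
  rw [← whiten_covMat E hs ht, covMat]
  simp only [transpose_smul, transpose_mul, Matrix.smul_mul, Matrix.mul_smul, smul_smul,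
    Real.mul_self_sqrt hs.le, Real.mul_self_sqrt ht.le, Matrix.mul_add, Matrix.add_mul,
    Matrix.mul_one, Matrix.mul_assoc]
  rw [add_comm]

end Whiten

/-! ### The joint laws of designs and noises -/

section Laws

variable [MeasurableSpace Ω] {P : Measure Ω} {S : System p Ω}

/-- The variables that determine the mediator design. -/
abbrev PreM (N p : ℕ) := (Fin N → Fin p → ℝ) × (Fin N → ℝ)

/-- The variables that determine the outcome design. -/
abbrev PreY (N p : ℕ) := (Fin N → Fin p → ℝ) × ((Fin N → ℝ) × ((Fin N → ℝ) × (Fin N → ℝ)))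

theorem System.Valid.measurePreserving (hS : S.Valid P) (N : ℕ) :
    MeasurePreserving
      (fun ω => (S.C N ω, S.U N ω, S.ZbM N ω, S.ZM N ω, S.ZbY N ω, S.ZY N ω)) P
      ((P.map (S.C N)).prod ((stdUniform N).prod ((stdNormal N).prod
        ((stdNormal N).prod ((stdNormal N).prod (stdNormal N)))))) :=
  ⟨(hS.meas_C N).prodMk ((hS.meas_U N).prodMk ((hS.meas_ZbM N).prodMk ((hS.meas_ZM N).prodMk
    ((hS.meas_ZbY N).prodMk (hS.meas_ZY N))))), hS.law N⟩

variable [IsProbabilityMeasure P]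

theorem System.Valid.isProbabilityMeasure_map (hS : S.Valid P) (N : ℕ) :
    IsProbabilityMeasure (P.map (S.C N)) :=
  Measure.isProbabilityMeasure_map (hS.meas_C N).aemeasurable

/-- The mediator is a regressor of the outcome equation, so the mediator noises are grouped with the
design variables. The outcome noise is independent of the whole group, and reassociating the product
exhibits this. -/
theorem System.Valid.law_outcome (hS : S.Valid P) (N : ℕ) {s t : ℝ} (hs : 0 < s) (ht : 0 < t) :
    MeasurePreserving
      (fun ω => ((S.C N ω, S.U N ω, S.ZbM N ω, S.ZM N ω),
        whitenedNoise (S.E N) s t (S.ZbY N ω, S.ZY N ω))) P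
      (((P.map (S.C N)).prod ((stdUniform N).prod ((stdNormal N).prod (stdNormal N)))).prod
        (stdNormal N)) := by
  have := hS.isProbabilityMeasure_map N
  have h1 := (measurePreserving_prodAssoc (stdNormal N) (stdNormal N)
    ((stdNormal N).prod (stdNormal N))).symm
  have h2 := (MeasurePreserving.id (stdUniform N)).prod h1
  have h3 := (measurePreserving_prodAssoc (stdUniform N) ((stdNormal N).prod (stdNormal N))
    ((stdNormal N).prod (stdNormal N))).symm
  have h4 := (MeasurePreserving.id (P.map (S.C N))).prod (h3.comp h2)
  have h5 := (measurePreserving_prodAssoc (P.map (S.C N))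
    ((stdUniform N).prod ((stdNormal N).prod (stdNormal N)))
    ((stdNormal N).prod (stdNormal N))).symm
  have h6 := (MeasurePreserving.id ((P.map (S.C N)).prod
    ((stdUniform N).prod ((stdNormal N).prod (stdNormal N))))).prod
    (measurePreserving_whitenedNoise (S.E N) hs ht)
  exact h6.comp (h5.comp (h4.comp (hS.measurePreserving N)))

theorem System.Valid.law_mediator (hS : S.Valid P) (N : ℕ) {s t : ℝ} (hs : 0 < s) (ht : 0 < t) :
    MeasurePreserving
      (fun ω => ((S.C N ω, S.U N ω), whitenedNoise (S.E N) s t (S.ZbM N ω, S.ZM N ω))) P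
      (((P.map (S.C N)).prod (stdUniform N)).prod (stdNormal N)) := by
  have := hS.isProbabilityMeasure_map N
  have h1 := (measurePreserving_prodAssoc (stdNormal N) (stdNormal N)
    ((stdNormal N).prod (stdNormal N))).symm
  have h1' := (measurePreserving_fst (μ := (stdNormal N).prod (stdNormal N))
    (ν := (stdNormal N).prod (stdNormal N))).comp h1
  have h2 := (MeasurePreserving.id (stdUniform N)).prod h1'
  have h4 := (MeasurePreserving.id (P.map (S.C N))).prod h2
  have h5 := (measurePreserving_prodAssoc (P.map (S.C N)) (stdUniform N)
    ((stdNormal N).prod (stdNormal N))).symm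
  have h6 := (MeasurePreserving.id ((P.map (S.C N)).prod (stdUniform N))).prod
    (measurePreserving_whitenedNoise (S.E N) hs ht)
  exact h6.comp (h5.comp (h4.comp (hS.measurePreserving N)))

theorem System.Valid.law_exposure (hS : S.Valid P) (N : ℕ) :
    MeasurePreserving (fun ω => (S.C N ω, S.U N ω)) P
      ((P.map (S.C N)).prod (stdUniform N)) := by
  have := hS.isProbabilityMeasure_map N
  exact measurePreserving_fst.comp (hS.law_mediator N one_pos one_pos)

/-! ### Measurability of the designs -/

/-- Exposures as a function of the confounders and of the exposure noise. -/
noncomputable def exposureOf {N : ℕ} (α : Fin p → ℝ) (x : PreM N p) : Fin N → ℝ :=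
  fun i => if x.2 i ≤ propensity (x.1 i) α then 1 else 0

theorem propensity_eq (c α : Fin p → ℝ) : propensity c α = logistic (α ⬝ᵥ c) := rfl

theorem measurable_dotProduct_const {α : Fin p → ℝ} : Measurable fun c : Fin p → ℝ => α ⬝ᵥ c := by
  unfold dotProduct
  fun_prop

theorem measurable_exposureOf {N : ℕ} (α : Fin p → ℝ) :
    Measurable (exposureOf (N := N) α) := by
  refine measurable_pi_lambda _ fun i => ?_
  refine Measurable.ite (measurableSet_le ?_ ?_) measurable_const measurable_const
  · exact (measurable_pi_apply i).comp measurable_snd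
  · have h : Measurable fun x : PreM N p => x.1 i := (measurable_pi_apply i).comp measurable_fst
    exact continuous_logistic.measurable.comp (measurable_dotProduct_const.comp h)

theorem measurable_nbrAvg {N : ℕ} (E : Matrix (Fin N) (Fin N) ℝ) (i : Fin N) :
    Measurable fun v : Fin N → ℝ => nbrAvg E v i := by
  unfold nbrAvg
  fun_prop

theorem measurable_designM {N : ℕ} (E : Matrix (Fin N) (Fin N) ℝ) {X : Type*}
    [MeasurableSpace X] {C : X → Fin N → Fin p → ℝ} (hC : Measurable C) {A : X → Fin N → ℝ}
    (hA : Measurable A) (i : Fin N) (k : MIdx p) :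
    Measurable fun x => designM E (C x) (A x) i k := by
  have hCi : ∀ i k, Measurable fun x => C x i k := fun i k =>
    (measurable_pi_apply k).comp ((measurable_pi_apply i).comp hC)
  have hAi : Measurable fun x => A x i := (measurable_pi_apply i).comp hA
  have hAn : Measurable fun x => nbrAvg E (A x) i := (measurable_nbrAvg E i).comp hA
  have hCn : ∀ k, Measurable fun x => nbrAvg E (fun j => C x j k) i := fun k =>
    (measurable_nbrAvg E i).comp (measurable_pi_lambda _ fun j => hCi j k)
  rcases k with k | k | k
  · fin_cases k
    · exact measurable_const
    · exact hAi
    · exact hAn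
  · exact hCi i k
  · exact hCn k

theorem measurable_designY {N : ℕ} (E : Matrix (Fin N) (Fin N) ℝ) {X : Type*}
    [MeasurableSpace X] {C : X → Fin N → Fin p → ℝ} (hC : Measurable C) {A M : X → Fin N → ℝ}
    (hA : Measurable A) (hM : Measurable M) (i : Fin N) (k : YIdx p) :
    Measurable fun x => designY E (C x) (A x) (M x) i k := by
  have hCi : ∀ i k, Measurable fun x => C x i k := fun i k =>
    (measurable_pi_apply k).comp ((measurable_pi_apply i).comp hC)
  have hCn : ∀ k, Measurable fun x => nbrAvg E (fun j => C x j k) i := fun k =>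
    (measurable_nbrAvg E i).comp (measurable_pi_lambda _ fun j => hCi j k)
  rcases k with k | k | k
  · fin_cases k
    · exact measurable_const
    · exact (measurable_pi_apply i).comp hA
    · exact (measurable_nbrAvg E i).comp hA
    · exact (measurable_pi_apply i).comp hM
    · exact (measurable_nbrAvg E i).comp hM
  · exact hCi i k
  · exact hCn k

/-- Mediators as a function of the confounders and of the noises. -/
noncomputable def mediatorOf {N : ℕ} (E : Matrix (Fin N) (Fin N) ℝ) (φ : Param p)
    (x : PreY N p) : Fin N → ℝ :=
  designM E x.1 (exposureOf φ.alpha (x.1, x.2.1)) *ᵥ φ.gamma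
    + E *ᵥ (Real.sqrt φ.varBM • x.2.2.1) + Real.sqrt φ.varM • x.2.2.2

theorem measurable_exposureOf_preY {N : ℕ} (α : Fin p → ℝ) :
    Measurable fun x : PreY N p => exposureOf α (x.1, x.2.1) :=
  (measurable_exposureOf α).comp (measurable_fst.prodMk measurable_snd.fst)

theorem measurable_mediatorOf {N : ℕ} (E : Matrix (Fin N) (Fin N) ℝ) (φ : Param p) :
    Measurable (mediatorOf E φ) := by
  have h1 : Measurable fun x : PreY N p =>
      designM E x.1 (exposureOf φ.alpha (x.1, x.2.1)) *ᵥ φ.gamma := by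
    refine measurable_pi_lambda _ fun i => ?_
    simp only [mulVec, dotProduct]
    exact Finset.measurable_sum _ fun k _ =>
      (measurable_designM E measurable_fst (measurable_exposureOf_preY φ.alpha) i k).mul_const _
  have h2 : Measurable fun x : PreY N p => E *ᵥ (Real.sqrt φ.varBM • x.2.2.1) :=
    (measurable_mulVec E).comp (by fun_prop)
  have h3 : Measurable fun x : PreY N p => Real.sqrt φ.varM • x.2.2.2 := by fun_prop
  exact (h1.add h2).add h3

/-- The whitened mediator design. -/
noncomputable def whitenedM {N : ℕ} (E : Matrix (Fin N) (Fin N) ℝ) (φ : Param p)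
    (x : PreM N p) : Matrix (Fin N) (MIdx p) ℝ :=
  whiten E φ.varM φ.varBM * designM E x.1 (exposureOf φ.alpha x)

/-- The whitened outcome design. -/
noncomputable def whitenedY {N : ℕ} (E : Matrix (Fin N) (Fin N) ℝ) (φ : Param p)
    (x : PreY N p) : Matrix (Fin N) (YIdx p) ℝ :=
  whiten E φ.varY φ.varBY * designY E x.1 (exposureOf φ.alpha (x.1, x.2.1)) (mediatorOf E φ x)

theorem measurable_whitenedM {N : ℕ} (E : Matrix (Fin N) (Fin N) ℝ) (φ : Param p) (i : Fin N)
    (k : MIdx p) : Measurable fun x => whitenedM E φ x i k := by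
  simp only [whitenedM, Matrix.mul_apply]
  exact Finset.measurable_sum _ fun j _ =>
    (measurable_designM E measurable_fst (measurable_exposureOf φ.alpha) j k).const_mul _

theorem measurable_whitenedY {N : ℕ} (E : Matrix (Fin N) (Fin N) ℝ) (φ : Param p) (i : Fin N)
    (k : YIdx p) : Measurable fun x => whitenedY E φ x i k := by
  simp only [whitenedY, Matrix.mul_apply]
  exact Finset.measurable_sum _ fun j _ =>
    (measurable_designY E measurable_fst (measurable_exposureOf_preY φ.alpha)
      (measurable_mediatorOf E φ) j k).const_mul _

/-! ### The exposure score -/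

theorem lintegral_bernoulli_score {N : ℕ} {π : Fin N → ℝ} (hπ : ∀ i, 0 < π i ∧ π i < 1)
    (a : Fin N → ℝ) :
    ∫⁻ u, ENNReal.ofReal ((∑ i, a i * ((if u i ≤ π i then 1 else 0) - π i)) ^ 2) ∂stdUniform N
      = ENNReal.ofReal (∑ i, a i ^ 2 * (π i * (1 - π i))) := by
  set ν := (volume : Measure ℝ).restrict (Set.Icc 0 1)
  have hbd : ∀ i, MemLp (fun u : ℝ => (if u ≤ π i then (1 : ℝ) else 0)) 2 ν := fun i => by
    refine MemLp.of_bound (Measurable.aestronglyMeasurable ?_) 1 (Eventually.of_forall fun u => ?_)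
    · exact Measurable.ite measurableSet_Iic measurable_const measurable_const
    · split_ifs <;> simp
  have hmean : ∀ i, ∫ u, (if u ≤ π i then (1 : ℝ) else 0) ∂ν = π i := fun i => by
    have h1 : (fun u : ℝ => (if u ≤ π i then (1 : ℝ) else 0))
        = (Set.Iic (π i)).indicator 1 := by
      funext u
      simp [Set.indicator_apply]
    rw [h1, integral_indicator_one measurableSet_Iic, measureReal_restrict_apply measurableSet_Iic]
    have h2 : Set.Iic (π i) ∩ Set.Icc 0 1 = Set.Icc 0 (π i) := by
      ext u
      simp only [Set.mem_inter_iff, Set.mem_Iic, Set.mem_Icc]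
      constructor
      · rintro ⟨h, h0, _⟩; exact ⟨h0, h⟩
      · rintro ⟨h0, h⟩; exact ⟨h, h0, h.trans (hπ i).2.le⟩
    rw [h2]
    simp [measureReal_def, (hπ i).1.le]
  have hint : ∀ i, Integrable (fun u : ℝ => (if u ≤ π i then (1 : ℝ) else 0)) ν := fun i =>
    (hbd i).integrable one_le_two
  have h := lintegral_sq_sum_pi (N := N) (μ := fun _ => ν)
    (f := fun i u => (if u ≤ π i then (1 : ℝ) else 0) - π i)
    (fun i => (hbd i).sub (memLp_const _))
    (fun i => by
      rw [integral_sub (hint i) (integrable_const _), hmean]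
      simp) a
  rw [stdUniform, h]
  congr 1
  refine Finset.sum_congr rfl fun i _ => ?_
  congr 1
  have e : ∀ u : ℝ, ((if u ≤ π i then (1 : ℝ) else 0) - π i) ^ 2
      = (1 - 2 * π i) * (if u ≤ π i then (1 : ℝ) else 0) + π i ^ 2 := fun u => by
    split_ifs <;> ring
  simp only [e]
  rw [integral_add ((hint i).const_mul _) (integrable_const _), integral_const_mul, hmean]
  simp
  ring

/-- The information identity for the exposure model: given the confounders, the score is a sum of
independent centred Bernoulli terms with variances `π (1 - π)`. -/
theorem System.Valid.lintegral_score (hS : S.Valid P) (N : ℕ) (φ : Param p) (x : Fin p → ℝ) :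
    ∫⁻ ω, ENNReal.ofReal (logisticScore (S.C N ω) (S.exposure N φ ω) φ.alpha x ^ 2) ∂P
      = ∫⁻ ω, ENNReal.ofReal (logisticForm (S.C N ω) φ.alpha x x) ∂P := by
  have hm : Measurable fun w : PreM N p =>
      ENNReal.ofReal (logisticScore w.1 (exposureOf φ.alpha w) φ.alpha x ^ 2) :=
    ((measurable_logisticScore measurable_fst (measurable_exposureOf φ.alpha) _ _).pow_const
      2).ennreal_ofReal
  have hf : Measurable fun c : Fin N → Fin p → ℝ =>
      ENNReal.ofReal (logisticForm c φ.alpha x x) := by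
    have := (measurable_logisticForm (measurable_id (α := Fin N → Fin p → ℝ)) φ.alpha x).comp
      (measurable_id.prodMk (measurable_const (a := (0 : ℝ))))
    simpa [Function.comp_def] using this.ennreal_ofReal
  have h1 := (hS.law_exposure N).lintegral_comp hm
  have h2 : ∫⁻ ω, ENNReal.ofReal (logisticForm (S.C N ω) φ.alpha x x) ∂P
      = ∫⁻ c, ENNReal.ofReal (logisticForm c φ.alpha x x) ∂(P.map (S.C N)) :=
    (lintegral_map hf (hS.meas_C N)).symm
  refine h1.trans ?_
  rw [lintegral_prod _ hm.aemeasurable, h2]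
  refine lintegral_congr fun c => ?_
  have h3 := lintegral_bernoulli_score (π := fun i => logistic (φ.alpha ⬝ᵥ c i))
    (fun i => logistic_mem _) (fun i => x ⬝ᵥ c i)
  have h4 : ∑ i, (x ⬝ᵥ c i) ^ 2 * (logistic (φ.alpha ⬝ᵥ c i) * (1 - logistic (φ.alpha ⬝ᵥ c i)))
      = logisticForm c φ.alpha x x := by
    unfold logisticForm
    exact Finset.sum_congr rfl fun i _ => by ring
  rw [h4] at h3
  rw [← h3]
  refine lintegral_congr fun u => ?_
  congr 2
  unfold logisticScore
  refine Finset.sum_congr rfl fun i _ => ?_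
  rw [mul_comm]
  rfl

end Laws

/-! ### Fisher information of a mixed equation -/

/-- The cross terms vanish because the noise is centred and independent of the design, and each
noise coordinate has unit variance. -/
theorem integral_sum_sq_add {N : ℕ} {X : Type*} [MeasurableSpace X] [MeasurableSpace Ω]
    {P : Measure Ω} [IsProbabilityMeasure P] {μ : Measure X} [IsProbabilityMeasure μ]
    {V : Ω → X × (Fin N → ℝ)} (hV : MeasurePreserving V P (μ.prod (stdNormal N)))
    {w : X → Fin N → ℝ} (hw : ∀ i, Measurable fun x => w x i)
    (hint : Integrable (fun ω => ∑ i, w (V ω).1 i ^ 2) P) (d : Fin N → ℝ) :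
    ∫ ω, ∑ i, (w (V ω).1 i + d i * (V ω).2 i) ^ 2 ∂P
      = ∫ ω, ∑ i, w (V ω).1 i ^ 2 ∂P + ∑ i, d i ^ 2 := by
  have hfst : MeasurePreserving (fun ω => (V ω).1) P μ := measurePreserving_fst.comp hV
  have hsnd : MeasurePreserving (fun ω => (V ω).2) P (stdNormal N) :=
    measurePreserving_snd.comp hV
  have hcoord : ∀ i, MeasurePreserving (fun ω => (V ω).2 i) P (gaussianReal 0 1) := fun i =>
    (measurePreserving_eval (fun _ : Fin N => gaussianReal 0 1) i).comp hsnd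
  have hw2 : ∀ i, Integrable (fun ω => w (V ω).1 i ^ 2) P := fun i => by
    refine hint.mono (((hw i).comp hfst.measurable).pow_const 2).aestronglyMeasurable
      (Eventually.of_forall fun ω => ?_)
    rw [Real.norm_of_nonneg (sq_nonneg _),
      Real.norm_of_nonneg (Finset.sum_nonneg fun i _ => sq_nonneg _)]
    exact Finset.single_le_sum (f := fun i => w (V ω).1 i ^ 2) (fun _ _ => sq_nonneg _)
      (Finset.mem_univ i)
  have hwL : ∀ i, MemLp (fun ω => w (V ω).1 i) 2 P := fun i =>
    (memLp_two_iff_integrable_sq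
      ((hw i).comp hfst.measurable).aestronglyMeasurable).mpr (hw2 i)
  have hzL : ∀ i, MemLp (fun ω => (V ω).2 i) 2 P := fun i =>
    (memLp_id_gaussianReal 2).comp_measurePreserving (hcoord i)
  have hz2 : ∀ i, ∫ ω, (V ω).2 i ^ 2 ∂P = 1 := fun i => by
    rw [← integral_sq_stdGaussian, ← (hcoord i).map_eq,
      integral_map (hcoord i).measurable.aemeasurable (by fun_prop)]
  have hwz : ∀ i, Integrable (fun ω => w (V ω).1 i * (V ω).2 i) P := fun i =>
    (hwL i).integrable_mul (hzL i)
  have hwz0 : ∀ i, ∫ ω, w (V ω).1 i * (V ω).2 i ∂P = 0 := fun i => by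
    have hm : Measurable fun v : X × (Fin N → ℝ) => w v.1 i * v.2 i :=
      ((hw i).comp measurable_fst).mul ((measurable_pi_apply i).comp measurable_snd)
    have h1 : ∫ ω, w (V ω).1 i * (V ω).2 i ∂P
        = ∫ v, w v.1 i * v.2 i ∂(μ.prod (stdNormal N)) := by
      rw [← hV.map_eq, integral_map hV.measurable.aemeasurable hm.aestronglyMeasurable]
    rw [h1, integral_prod_mul (fun x => w x i) (fun z : Fin N → ℝ => z i)]
    have h2 : ∫ z : Fin N → ℝ, z i ∂stdNormal N = 0 := by
      have := integral_comp_eval (μ := fun _ : Fin N => gaussianReal 0 1) (i := i)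
        (f := fun x : ℝ => x) aestronglyMeasurable_id
      rw [stdNormal, this]
      simp
    rw [h2, mul_zero]
  have hexp : ∀ i, ∫ ω, (w (V ω).1 i + d i * (V ω).2 i) ^ 2 ∂P
      = ∫ ω, w (V ω).1 i ^ 2 ∂P + d i ^ 2 := fun i => by
    have e : ∀ ω, (w (V ω).1 i + d i * (V ω).2 i) ^ 2
        = (w (V ω).1 i ^ 2 + 2 * d i * (w (V ω).1 i * (V ω).2 i)) + d i ^ 2 * (V ω).2 i ^ 2 :=
      fun ω => by ring
    have hi : Integrable (fun ω => w (V ω).1 i ^ 2 + 2 * d i * (w (V ω).1 i * (V ω).2 i)) P :=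
      (hw2 i).add ((hwz i).const_mul _)
    simp only [e]
    rw [integral_add hi ((hzL i).integrable_sq.const_mul _),
      integral_add (hw2 i) ((hwz i).const_mul _), integral_const_mul, integral_const_mul, hwz0,
      hz2]
    ring
  have hLsq : ∀ i, Integrable (fun ω => (w (V ω).1 i + d i * (V ω).2 i) ^ 2) P := fun i =>
    ((hwL i).add ((hzL i).const_mul (d i))).integrable_sq
  rw [integral_finsetSum _ fun i _ => hLsq i, integral_finsetSum _ fun i _ => hw2 i,
    ← Finset.sum_add_distrib]
  exact Finset.sum_congr rfl fun i _ => hexp i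

end RENSEM

namespace RENSEM

variable {p : ℕ} {Ω : Type*}

/-! ### Whitened equations -/

section Whitened

variable (S : System p Ω) (N : ℕ) (φ : Param p) (ω : Ω)

/-- The variables that determine the mediator design. -/
def System.preM : PreM N p := (S.C N ω, S.U N ω)

/-- The variables that determine the outcome design. -/
def System.preY : PreY N p := (S.C N ω, S.U N ω, S.ZbM N ω, S.ZM N ω)

/-- The whitened noise of the mediator equation. -/
noncomputable def System.noiseM : Fin N → ℝ :=
  whitenedNoise (S.E N) φ.varM φ.varBM (S.ZbM N ω, S.ZM N ω)

/-- The whitened noise of the outcome equation. -/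
noncomputable def System.noiseY : Fin N → ℝ :=
  whitenedNoise (S.E N) φ.varY φ.varBY (S.ZbY N ω, S.ZY N ω)

variable {φ}

theorem gramRot_outcome_design (h : 0 < φ.varY ∧ 0 < φ.varBY) (b : YIdx p → ℝ) (i : Fin N) :
    (gramRot (S.E N) *ᵥ (designY (S.E N) (S.data N φ ω).C (S.data N φ ω).A (S.data N φ ω).M *ᵥ b)) i
      = Real.sqrt (φ.varY + φ.varBY * gramEig (S.E N) i)
        * (whitenedY (S.E N) φ (S.preY N ω) *ᵥ b) i := by
  rw [gramRot_mulVec_eq (S.E N) h.1 h.2, mulVec_mulVec]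
  rfl

theorem gramRot_mediator_design (h : 0 < φ.varM ∧ 0 < φ.varBM) (b : MIdx p → ℝ) (i : Fin N) :
    (gramRot (S.E N) *ᵥ (designM (S.E N) (S.data N φ ω).C (S.data N φ ω).A *ᵥ b)) i
      = Real.sqrt (φ.varM + φ.varBM * gramEig (S.E N) i)
        * (whitenedM (S.E N) φ (S.preM N ω) *ᵥ b) i := by
  rw [gramRot_mulVec_eq (S.E N) h.1 h.2, mulVec_mulVec]
  rfl

/-- At a trial coefficient `b` the residual is the true noise plus a mean shift. Both are measured
in true standard deviations, which is the shape `z + h` assumed by the deterministic estimates. -/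
theorem gramRot_outcome_residual (h : 0 < φ.varY ∧ 0 < φ.varBY) (b : YIdx p → ℝ) (i : Fin N) :
    (gramRot (S.E N) *ᵥ ((S.data N φ ω).Y
        - designY (S.E N) (S.data N φ ω).C (S.data N φ ω).A (S.data N φ ω).M *ᵥ b)) i
      = Real.sqrt (φ.varY + φ.varBY * gramEig (S.E N) i)
        * (S.noiseY N φ ω i + (whitenedY (S.E N) φ (S.preY N ω) *ᵥ (φ.beta - b)) i) := by
  have h1 : (S.data N φ ω).Y
        - designY (S.E N) (S.data N φ ω).C (S.data N φ ω).A (S.data N φ ω).M *ᵥ b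
      = (S.E N *ᵥ (Real.sqrt φ.varBY • S.ZbY N ω) + Real.sqrt φ.varY • S.ZY N ω)
        + designY (S.E N) (S.data N φ ω).C (S.data N φ ω).A (S.data N φ ω).M
          *ᵥ (φ.beta - b) := by
    rw [mulVec_sub]
    change S.outcome N φ ω - _ = _
    rw [System.outcome]
    change _ + _ + _ - _ = _ + (designY (S.E N) (S.C N ω) (S.exposure N φ ω) (S.mediator N φ ω)
      *ᵥ φ.beta - _)
    abel
  rw [h1, mulVec_add, Pi.add_apply, gramRot_outcome_design S N ω h, gramRot_mulVec_eq (S.E N) h.1 h.2,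
    ← mul_add]
  rfl

theorem gramRot_mediator_residual (h : 0 < φ.varM ∧ 0 < φ.varBM) (b : MIdx p → ℝ) (i : Fin N) :
    (gramRot (S.E N) *ᵥ ((S.data N φ ω).M
        - designM (S.E N) (S.data N φ ω).C (S.data N φ ω).A *ᵥ b)) i
      = Real.sqrt (φ.varM + φ.varBM * gramEig (S.E N) i)
        * (S.noiseM N φ ω i + (whitenedM (S.E N) φ (S.preM N ω) *ᵥ (φ.gamma - b)) i) := by
  have h1 : (S.data N φ ω).M - designM (S.E N) (S.data N φ ω).C (S.data N φ ω).A *ᵥ b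
      = (S.E N *ᵥ (Real.sqrt φ.varBM • S.ZbM N ω) + Real.sqrt φ.varM • S.ZM N ω)
        + designM (S.E N) (S.data N φ ω).C (S.data N φ ω).A *ᵥ (φ.gamma - b) := by
    rw [mulVec_sub]
    change S.mediator N φ ω - _ = _
    rw [System.mediator]
    change _ + _ + _ - _ = _ + (designM (S.E N) (S.C N ω) (S.exposure N φ ω) *ᵥ φ.gamma - _)
    abel
  rw [h1, mulVec_add, Pi.add_apply, gramRot_mediator_design S N ω h,
    gramRot_mulVec_eq (S.E N) h.1 h.2, ← mul_add]
  rfl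

end Whitened

/-! ### Directions in the parameter space -/

/-- A direction that moves the outcome equation only. -/
def dirY (b : YIdx p → ℝ) (ds dt : ℝ) : Param p := Sum.elim (Sum.elim b ![ds, dt]) 0

/-- A direction that moves the mediator equation only. -/
def dirM (b : MIdx p → ℝ) (ds dt : ℝ) : Param p := Sum.elim 0 (Sum.elim (Sum.elim b ![ds, dt]) 0)

/-- A direction that moves the exposure model only. -/
def dirA (x : Fin p → ℝ) : Param p := Sum.elim 0 (Sum.elim 0 x)

theorem obsInfo_dirY {N : ℕ} (E : Matrix (Fin N) (Fin N) ℝ) (D : Obs N p) {φ : Param p}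
    (h : 0 < φ.varY ∧ 0 < φ.varBY ∧ 0 < φ.varM ∧ 0 < φ.varBM) (b : YIdx p → ℝ) (ds dt : ℝ) :
    dirY b ds dt ⬝ᵥ (obsInfo E D φ *ᵥ dirY b ds dt) =
      mixedForm (gramEig E) (gramRot E *ᵥ (D.Y - designY E D.C D.A D.M *ᵥ φ.beta))
          φ.varY φ.varBY (gramRot E *ᵥ (designY E D.C D.A D.M *ᵥ b)) ds dt
          (gramRot E *ᵥ (designY E D.C D.A D.M *ᵥ b)) ds dt := by
  rw [obsInfo_form E D h]
  have e1 : (dirY b ds dt).beta = b := rfl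
  have e2 : (dirY b ds dt).gamma = 0 := rfl
  have e3 : (dirY b ds dt).alpha = 0 := rfl
  have e4 : (dirY b ds dt).varY = ds := rfl
  have e5 : (dirY b ds dt).varBY = dt := rfl
  have e6 : (dirY b ds dt).varM = 0 := rfl
  have e7 : (dirY b ds dt).varBM = 0 := rfl
  rw [e1, e2, e3, e4, e5, e6, e7, mulVec_zero, mulVec_zero, mixedForm_zero_left,
    logisticForm_zero_left, add_zero, add_zero]

theorem obsInfo_dirM {N : ℕ} (E : Matrix (Fin N) (Fin N) ℝ) (D : Obs N p) {φ : Param p}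
    (h : 0 < φ.varY ∧ 0 < φ.varBY ∧ 0 < φ.varM ∧ 0 < φ.varBM) (b : MIdx p → ℝ) (ds dt : ℝ) :
    dirM b ds dt ⬝ᵥ (obsInfo E D φ *ᵥ dirM b ds dt) =
      mixedForm (gramEig E) (gramRot E *ᵥ (D.M - designM E D.C D.A *ᵥ φ.gamma))
          φ.varM φ.varBM (gramRot E *ᵥ (designM E D.C D.A *ᵥ b)) ds dt
          (gramRot E *ᵥ (designM E D.C D.A *ᵥ b)) ds dt := by
  rw [obsInfo_form E D h]
  have e1 : (dirM b ds dt).beta = 0 := rfl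
  have e2 : (dirM b ds dt).gamma = b := rfl
  have e3 : (dirM b ds dt).alpha = 0 := rfl
  have e4 : (dirM b ds dt).varY = 0 := rfl
  have e5 : (dirM b ds dt).varBY = 0 := rfl
  have e6 : (dirM b ds dt).varM = ds := rfl
  have e7 : (dirM b ds dt).varBM = dt := rfl
  rw [e1, e2, e3, e4, e5, e6, e7, mulVec_zero, mulVec_zero, mixedForm_zero_left,
    logisticForm_zero_left, add_zero, zero_add]

theorem obsInfo_dirA {N : ℕ} (E : Matrix (Fin N) (Fin N) ℝ) (D : Obs N p) {φ : Param p}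
    (h : 0 < φ.varY ∧ 0 < φ.varBY ∧ 0 < φ.varM ∧ 0 < φ.varBM) (x : Fin p → ℝ) :
    dirA x ⬝ᵥ (obsInfo E D φ *ᵥ dirA x) = logisticForm D.C φ.alpha x x := by
  rw [obsInfo_form E D h]
  have e1 : (dirA x).beta = 0 := rfl
  have e2 : (dirA x).gamma = 0 := rfl
  have e3 : (dirA x).alpha = x := rfl
  have e4 : (dirA x).varY = 0 := rfl
  have e5 : (dirA x).varBY = 0 := rfl
  have e6 : (dirA x).varM = 0 := rfl
  have e7 : (dirA x).varBM = 0 := rfl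
  rw [e1, e2, e3, e4, e5, e6, e7]
  simp only [mulVec_zero, mixedForm_zero_left, zero_add]

theorem dotProduct_submatrix_mulVec {m n : Type*} [Fintype m] [Fintype n]
    (B : Matrix n n ℝ) {f : m → n} (hf : Function.Injective f) {u : n → ℝ}
    (hu : ∀ k, k ∉ Set.range f → u k = 0) :
    (u ∘ f) ⬝ᵥ (B.submatrix f f *ᵥ (u ∘ f)) = u ⬝ᵥ (B *ᵥ u) := by
  simp only [dotProduct, mulVec]
  refine Fintype.sum_of_injective f hf _ _ (fun k hk => by rw [hu k hk, zero_mul]) fun k => ?_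
  rw [Function.comp_apply]
  congr 1
  exact Fintype.sum_of_injective f hf _ _ (fun l hl => by rw [hu l hl, mul_zero]) fun l => rfl

theorem dirY_dotProduct_self (b : YIdx p → ℝ) (ds dt : ℝ) :
    dirY b ds dt ⬝ᵥ dirY b ds dt = b ⬝ᵥ b + (ds ^ 2 + dt ^ 2) := by
  simp only [dotProduct, Fintype.sum_sum_type (α₁ := YIdx p ⊕ Fin 2),
    Fintype.sum_sum_type (α₁ := YIdx p) (α₂ := Fin 2), dirY, Sum.elim_inl, Sum.elim_inr,
    Pi.zero_apply, mul_zero, Finset.sum_const_zero, add_zero, Fin.sum_univ_two]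
  simp [sq]

theorem dirM_dotProduct_self (b : MIdx p → ℝ) (ds dt : ℝ) :
    dirM b ds dt ⬝ᵥ dirM b ds dt = b ⬝ᵥ b + (ds ^ 2 + dt ^ 2) := by
  simp only [dotProduct, Fintype.sum_sum_type (α₁ := YIdx p ⊕ Fin 2),
    Fintype.sum_sum_type (α₁ := MIdx p ⊕ Fin 2),
    Fintype.sum_sum_type (α₁ := MIdx p) (α₂ := Fin 2), dirM, Sum.elim_inl, Sum.elim_inr,
    Pi.zero_apply, mul_zero, Finset.sum_const_zero, add_zero, zero_add, Fin.sum_univ_two]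
  simp [sq]

/-! ### Observed information at the true parameter -/

section SelfInfo

variable (S : System p Ω) {N : ℕ} {φ : Param p}

theorem varRatio_self {lam : Fin N → ℝ} {s t : ℝ} (hlam : ∀ i, 0 ≤ lam i) (hs : 0 < s)
    (ht : 0 < t) (i : Fin N) : varRatio lam s t s t i = 1 :=
  div_self (add_pos_of_pos_of_nonneg hs (mul_nonneg ht.le (hlam i))).ne'

theorem mixedForm_whitened_self {lam : Fin N → ℝ} {s t : ℝ} (hlam : ∀ i, 0 ≤ lam i) (hs : 0 < s)
    (ht : 0 < t) {r x w e : Fin N → ℝ} (hr : ∀ i, r i = Real.sqrt (s + t * lam i) * e i)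
    (hx : ∀ i, x i = Real.sqrt (s + t * lam i) * w i) (ds dt : ℝ) :
    mixedForm lam r s t x ds dt x ds dt =
      ∑ i, (w i + relVar lam s t ds dt i * e i) ^ 2 - 1 / 2 * ∑ i, relVar lam s t ds dt i ^ 2 := by
  -- The smallest interval containing both components lets the general formula apply with trial and
  -- true variances equal.
  have hs' : s ∈ Set.Icc (min s t) (max s t) := ⟨min_le_left _ _, le_max_left _ _⟩
  have ht' : t ∈ Set.Icc (min s t) (max s t) := ⟨min_le_right _ _, le_max_right _ _⟩
  rw [mixedForm_whitened hlam (lt_min hs ht) hs' ht' hs' ht' hr hx]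
  simp only [varRatio_self hlam hs ht, one_mul]

theorem obsInfo_dirY_self (ω : Ω) (b : YIdx p → ℝ) (ds dt : ℝ)
    (h : 0 < φ.varY ∧ 0 < φ.varBY ∧ 0 < φ.varM ∧ 0 < φ.varBM) :
    dirY b ds dt ⬝ᵥ (obsInfo (S.E N) (S.data N φ ω) φ *ᵥ dirY b ds dt) =
      ∑ i, ((whitenedY (S.E N) φ (S.preY N ω) *ᵥ b) i
        + relVar (gramEig (S.E N)) φ.varY φ.varBY ds dt i * S.noiseY N φ ω i) ^ 2
      - 1 / 2 * ∑ i, relVar (gramEig (S.E N)) φ.varY φ.varBY ds dt i ^ 2 := by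
  rw [obsInfo_dirY _ _ h]
  refine mixedForm_whitened_self (gramEig_nonneg _) h.1 h.2.1 (fun i => ?_)
    (gramRot_outcome_design S N ω ⟨h.1, h.2.1⟩ b) ds dt
  rw [gramRot_outcome_residual S N ω ⟨h.1, h.2.1⟩, sub_self, mulVec_zero, Pi.zero_apply, add_zero]

theorem obsInfo_dirM_self (ω : Ω) (b : MIdx p → ℝ) (ds dt : ℝ)
    (h : 0 < φ.varY ∧ 0 < φ.varBY ∧ 0 < φ.varM ∧ 0 < φ.varBM) :
    dirM b ds dt ⬝ᵥ (obsInfo (S.E N) (S.data N φ ω) φ *ᵥ dirM b ds dt) =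
      ∑ i, ((whitenedM (S.E N) φ (S.preM N ω) *ᵥ b) i
        + relVar (gramEig (S.E N)) φ.varM φ.varBM ds dt i * S.noiseM N φ ω i) ^ 2
      - 1 / 2 * ∑ i, relVar (gramEig (S.E N)) φ.varM φ.varBM ds dt i ^ 2 := by
  rw [obsInfo_dirM _ _ h]
  refine mixedForm_whitened_self (gramEig_nonneg _) h.2.2.1 h.2.2.2 (fun i => ?_)
    (gramRot_mediator_design S N ω ⟨h.2.2.1, h.2.2.2⟩ b) ds dt
  rw [gramRot_mediator_residual S N ω ⟨h.2.2.1, h.2.2.2⟩, sub_self, mulVec_zero, Pi.zero_apply,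
    add_zero]

theorem relVar_zero {lam : Fin N → ℝ} {s t : ℝ} (i : Fin N) : relVar lam s t 0 0 i = 0 := by
  simp [relVar]

end SelfInfo

/-! ### The Fisher information -/

section Fisher

variable [MeasurableSpace Ω] {P : Measure Ω} {S : System p Ω} {N : ℕ} {φ : Param p}

theorem integrable_obsInfo_form
    (hint : ∀ k l, Integrable (fun ω => obsInfo (S.E N) (S.data N φ ω) φ k l) P) (u w : Param p) :
    Integrable (fun ω => u ⬝ᵥ (obsInfo (S.E N) (S.data N φ ω) φ *ᵥ w)) P := by
  simp only [dotProduct, mulVec]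
  exact integrable_finsetSum _ fun k _ => (integrable_finsetSum _ fun l _ =>
    (hint k l).mul_const _).const_mul _

theorem fisherInfo_form
    (hint : ∀ k l, Integrable (fun ω => obsInfo (S.E N) (S.data N φ ω) φ k l) P) (u w : Param p) :
    u ⬝ᵥ (fisherInfo S P N φ *ᵥ w)
      = ∫ ω, u ⬝ᵥ (obsInfo (S.E N) (S.data N φ ω) φ *ᵥ w) ∂P := by
  simp only [dotProduct, mulVec, fisherInfo, of_apply]
  rw [integral_finsetSum _ fun k _ => (integrable_finsetSum _ fun l _ =>
    (hint k l).mul_const _).const_mul _]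
  refine Finset.sum_congr rfl fun k _ => ?_
  rw [integral_const_mul, integral_finsetSum _ fun l _ => (hint k l).mul_const _]
  simp only [integral_mul_const]

theorem fisherInfo_isSplit (h : 0 < φ.varY ∧ 0 < φ.varBY ∧ 0 < φ.varM ∧ 0 < φ.varBM) :
    IsSplit (fisherInfo S P N φ) := by
  refine ⟨?_, fun k l => ?_⟩
  · ext k l
    simp only [transpose_apply, fisherInfo, of_apply]
    congr 1
    funext ω
    exact (obsInfo_isSymm (S.E N) (S.data N φ ω) h).apply k l
  · simp only [fisherInfo, of_apply]
    simp [(obsInfo_isSplit (S.E N) (S.data N φ _) h).2]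

theorem lintegral_eq_fisherInfo_form
    (hint : ∀ k l, Integrable (fun ω => obsInfo (S.E N) (S.data N φ ω) φ k l) P) (u : Param p)
    {f : Ω → ℝ} (hf : ∀ ω, u ⬝ᵥ (obsInfo (S.E N) (S.data N φ ω) φ *ᵥ u) = f ω)
    (hf0 : ∀ ω, 0 ≤ f ω) :
    Integrable f P ∧ ∫⁻ ω, ENNReal.ofReal (f ω) ∂P
      = ENNReal.ofReal (u ⬝ᵥ (fisherInfo S P N φ *ᵥ u)) := by
  have h1 := integrable_obsInfo_form hint u u
  rw [fisherInfo_form hint]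
  simp only [hf] at h1 ⊢
  exact ⟨h1, (ofReal_integral_eq_lintegral_ofReal h1 (Eventually.of_forall hf0)).symm⟩

/-- Along pure regression directions the observed information is itself a sum of squares, so
integrability of the whitened design and its second moments are read off from the existence of the
Fisher information. -/
theorem lintegral_whitenedY
    (hint : ∀ k l, Integrable (fun ω => obsInfo (S.E N) (S.data N φ ω) φ k l) P)
    (h : 0 < φ.varY ∧ 0 < φ.varBY ∧ 0 < φ.varM ∧ 0 < φ.varBM) (b : YIdx p → ℝ) :
    Integrable (fun ω => ∑ i, (whitenedY (S.E N) φ (S.preY N ω) *ᵥ b) i ^ 2) P ∧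
    ∫⁻ ω, ENNReal.ofReal (∑ i, (whitenedY (S.E N) φ (S.preY N ω) *ᵥ b) i ^ 2) ∂P
      = ENNReal.ofReal (dirY b 0 0 ⬝ᵥ (fisherInfo S P N φ *ᵥ dirY b 0 0)) := by
  refine lintegral_eq_fisherInfo_form hint _ (fun ω => ?_)
    fun ω => Finset.sum_nonneg fun i _ => sq_nonneg _
  rw [obsInfo_dirY_self S ω b 0 0 h]
  simp [relVar_zero]

theorem lintegral_whitenedM
    (hint : ∀ k l, Integrable (fun ω => obsInfo (S.E N) (S.data N φ ω) φ k l) P)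
    (h : 0 < φ.varY ∧ 0 < φ.varBY ∧ 0 < φ.varM ∧ 0 < φ.varBM) (b : MIdx p → ℝ) :
    Integrable (fun ω => ∑ i, (whitenedM (S.E N) φ (S.preM N ω) *ᵥ b) i ^ 2) P ∧
    ∫⁻ ω, ENNReal.ofReal (∑ i, (whitenedM (S.E N) φ (S.preM N ω) *ᵥ b) i ^ 2) ∂P
      = ENNReal.ofReal (dirM b 0 0 ⬝ᵥ (fisherInfo S P N φ *ᵥ dirM b 0 0)) := by
  refine lintegral_eq_fisherInfo_form hint _ (fun ω => ?_)
    fun ω => Finset.sum_nonneg fun i _ => sq_nonneg _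
  rw [obsInfo_dirM_self S ω b 0 0 h]
  simp [relVar_zero]

theorem measurable_mulVec_apply {X q : Type*} [MeasurableSpace X] [Fintype q]
    {H : X → Matrix (Fin N) q ℝ} (hH : ∀ i k, Measurable fun x => H x i k) (b : q → ℝ) (i : Fin N) :
    Measurable fun x => (H x *ᵥ b) i := by
  simp only [mulVec, dotProduct]
  exact Finset.measurable_sum _ fun k _ => (hH i k).mul_const _

variable [IsProbabilityMeasure P]

/-- Regression and variance coordinates are orthogonal in expectation. The variance part is `∑ d_i²`
from the squared noise minus `½ ∑ d_i²` from the log-determinant. -/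
theorem fisherInfo_dirY (hS : S.Valid P)
    (hint : ∀ k l, Integrable (fun ω => obsInfo (S.E N) (S.data N φ ω) φ k l) P)
    (h : 0 < φ.varY ∧ 0 < φ.varBY ∧ 0 < φ.varM ∧ 0 < φ.varBM) (b : YIdx p → ℝ) (ds dt : ℝ) :
    dirY b ds dt ⬝ᵥ (fisherInfo S P N φ *ᵥ dirY b ds dt)
      = dirY b 0 0 ⬝ᵥ (fisherInfo S P N φ *ᵥ dirY b 0 0)
        + 1 / 2 * ∑ i, relVar (gramEig (S.E N)) φ.varY φ.varBY ds dt i ^ 2 := by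
  have := hS.isProbabilityMeasure_map N
  obtain ⟨hi, -⟩ := lintegral_whitenedY hint h b
  have hi2 := integrable_obsInfo_form hint (dirY b ds dt) (dirY b ds dt)
  have key := integral_sum_sq_add (hS.law_outcome N h.1 h.2.1)
    (w := fun x => whitenedY (S.E N) φ x *ᵥ b)
    (measurable_mulVec_apply (measurable_whitenedY (S.E N) φ) b) hi
    (relVar (gramEig (S.E N)) φ.varY φ.varBY ds dt)
  rw [fisherInfo_form hint, fisherInfo_form hint]
  simp only [obsInfo_dirY_self S _ _ _ _ h, relVar_zero] at hi2 ⊢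
  have hi3 := hi2.add (integrable_const
    (1 / 2 * ∑ i, relVar (gramEig (S.E N)) φ.varY φ.varBY ds dt i ^ 2))
  simp only [Pi.add_def, sub_add_cancel] at hi3
  rw [integral_sub hi3 (integrable_const _)]
  change ∫ ω, ∑ i, ((whitenedY (S.E N) φ (S.preY N ω) *ᵥ b) i
    + relVar (gramEig (S.E N)) φ.varY φ.varBY ds dt i * S.noiseY N φ ω i) ^ 2 ∂P
    = ∫ ω, ∑ i, (whitenedY (S.E N) φ (S.preY N ω) *ᵥ b) i ^ 2 ∂P + _ at key
  rw [key]
  simp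
  ring

theorem fisherInfo_dirM (hS : S.Valid P)
    (hint : ∀ k l, Integrable (fun ω => obsInfo (S.E N) (S.data N φ ω) φ k l) P)
    (h : 0 < φ.varY ∧ 0 < φ.varBY ∧ 0 < φ.varM ∧ 0 < φ.varBM) (b : MIdx p → ℝ) (ds dt : ℝ) :
    dirM b ds dt ⬝ᵥ (fisherInfo S P N φ *ᵥ dirM b ds dt)
      = dirM b 0 0 ⬝ᵥ (fisherInfo S P N φ *ᵥ dirM b 0 0)
        + 1 / 2 * ∑ i, relVar (gramEig (S.E N)) φ.varM φ.varBM ds dt i ^ 2 := by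
  have := hS.isProbabilityMeasure_map N
  obtain ⟨hi, -⟩ := lintegral_whitenedM hint h b
  have hi2 := integrable_obsInfo_form hint (dirM b ds dt) (dirM b ds dt)
  have key := integral_sum_sq_add (hS.law_mediator N h.2.2.1 h.2.2.2)
    (w := fun x => whitenedM (S.E N) φ x *ᵥ b)
    (measurable_mulVec_apply (measurable_whitenedM (S.E N) φ) b) hi
    (relVar (gramEig (S.E N)) φ.varM φ.varBM ds dt)
  rw [fisherInfo_form hint, fisherInfo_form hint]
  simp only [obsInfo_dirM_self S _ _ _ _ h, relVar_zero] at hi2 ⊢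
  have hi3 := hi2.add (integrable_const
    (1 / 2 * ∑ i, relVar (gramEig (S.E N)) φ.varM φ.varBM ds dt i ^ 2))
  simp only [Pi.add_def, sub_add_cancel] at hi3
  rw [integral_sub hi3 (integrable_const _)]
  change ∫ ω, ∑ i, ((whitenedM (S.E N) φ (S.preM N ω) *ᵥ b) i
    + relVar (gramEig (S.E N)) φ.varM φ.varBM ds dt i * S.noiseM N φ ω i) ^ 2 ∂P
    = ∫ ω, ∑ i, (whitenedM (S.E N) φ (S.preM N ω) *ᵥ b) i ^ 2 ∂P + _ at key
  rw [key]
  simp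
  ring

end Fisher

end RENSEM

namespace RENSEM

variable {p : ℕ} {Ω : Type*}

/-! ### Tightness of the noise terms -/

section Noise

variable {N : ℕ} {q : Type*} [Fintype q]

/-- The linear and the quadratic noise terms of a mixed equation are bounded by `K`, relatively to
the size of the direction and uniformly over the variance components in `[m, M]`. -/
def NoiseBound (lam z : Fin N → ℝ) (H : Matrix (Fin N) q ℝ) (Q : (q → ℝ) → ℝ)
    (s₀ t₀ m M K : ℝ) : Prop :=
  (∀ b κ, |κ| ≤ (M - m) / (M + m) →
    |∑ i, z i * ((s₀ + t₀ * lam i) / (1 + lam i) / (1 + κ * ((1 - lam i) / (1 + lam i))))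
      * (H *ᵥ b) i| ≤ K * Real.sqrt (Q b)) ∧
  ∀ ds dt κ, |κ| ≤ (M - m) / (M + m) →
    |∑ i, (z i ^ 2 - 1) * ((s₀ + t₀ * lam i) / (1 + lam i) /
      (1 + κ * ((1 - lam i) / (1 + lam i)))) * relVar lam s₀ t₀ ds dt i|
        ≤ K * Real.sqrt (∑ i, relVar lam s₀ t₀ ds dt i ^ 2)

/-- The matrix of the linear map `(ds, dt) ↦ relVar`. -/
noncomputable def relVarMatrix (lam : Fin N → ℝ) (s₀ t₀ : ℝ) : Matrix (Fin N) (Fin 2) ℝ :=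
  Matrix.of fun i => ![1 / (s₀ + t₀ * lam i), lam i / (s₀ + t₀ * lam i)]

theorem relVarMatrix_mulVec (lam : Fin N → ℝ) (s₀ t₀ : ℝ) (x : Fin 2 → ℝ) (i : Fin N) :
    (relVarMatrix lam s₀ t₀ *ᵥ x) i = relVar lam s₀ t₀ (x 0) (x 1) i := by
  simp only [relVarMatrix, mulVec, dotProduct, Fin.sum_univ_two, of_apply, relVar, cons_val_zero,
    cons_val_one]
  ring

theorem posDef_relVarMatrix {lam : Fin N → ℝ} {s₀ t₀ Λ : ℝ} (hΛ : 0 < Λ)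
    (hΛd : ∀ ds dt, Λ * (ds ^ 2 + dt ^ 2) ≤ 1 / 2 * ∑ i, relVar lam s₀ t₀ ds dt i ^ 2) :
    ((relVarMatrix lam s₀ t₀)ᵀ * relVarMatrix lam s₀ t₀).PosDef := by
  refine Matrix.PosDef.of_dotProduct_mulVec_pos ?_ fun x hx => ?_
  · rw [IsHermitian, conjTranspose_eq_transpose_of_trivial, transpose_mul, transpose_transpose]
  · rw [star_trivial, dotProduct_transpose_mul_mulVec]
    simp only [relVarMatrix_mulVec]
    have h1 := hΛd (x 0) (x 1)
    have h2 : 0 < x 0 ^ 2 + x 1 ^ 2 := by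
      by_contra hle
      have h3 : x 0 = 0 := by nlinarith [sq_nonneg (x 0), sq_nonneg (x 1)]
      have h4 : x 1 = 0 := by nlinarith [sq_nonneg (x 0), sq_nonneg (x 1)]
      exact hx (by ext i; fin_cases i <;> assumption)
    have h5 := mul_pos hΛ h2
    linarith

/-- Bound for the tails of the noise terms. -/
noncomputable def noiseConst (n : ℕ) (m M : ℝ) : ℝ :=
  (n * (1 + M ^ 2) + 2 * (1 + sqVariance * M ^ 2)) / (1 - (M - m) / (M + m))

/-- Two applications of the uniform noise bound with the same weights `g`, `y`: white noise `z`
against the random design `H`, and white noise `z² - 1` against the deterministic two-column design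
`relVarMatrix`. The two summands in `noiseConst` correspond to them. -/
theorem measure_not_noiseBound_le [MeasurableSpace Ω] (P : Measure Ω) [IsProbabilityMeasure P]
    [DecidableEq q] {X : Type*} [MeasurableSpace X] {μ : Measure X} [IsProbabilityMeasure μ]
    {V : Ω → X × (Fin N → ℝ)} (hV : MeasurePreserving V P (μ.prod (stdNormal N)))
    {H : X → Matrix (Fin N) q ℝ} (hH : ∀ i k, Measurable fun x => H x i k)
    {B : Matrix q q ℝ} (hB : B.PosDef)
    (hHB : ∀ b : q → ℝ, ∫⁻ ω, ENNReal.ofReal (∑ i, (H (V ω).1 *ᵥ b) i ^ 2) ∂P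
      ≤ ENNReal.ofReal (b ⬝ᵥ (B *ᵥ b)))
    {lam : Fin N → ℝ} (hlam : ∀ i, 0 ≤ lam i) {s₀ t₀ m M : ℝ} (hm : 0 < m)
    (hs₀ : s₀ ∈ Set.Icc m M) (ht₀ : t₀ ∈ Set.Icc m M) {Λ : ℝ} (hΛ : 0 < Λ)
    (hΛd : ∀ ds dt, Λ * (ds ^ 2 + dt ^ 2) ≤ 1 / 2 * ∑ i, relVar lam s₀ t₀ ds dt i ^ 2)
    {K : ℝ} (hK : 0 < K) :
    P {ω | ¬ NoiseBound lam (V ω).2 (H (V ω).1) (fun b : q → ℝ => b ⬝ᵥ (B *ᵥ b)) s₀ t₀ m M K}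
      ≤ ENNReal.ofReal (noiseConst (Fintype.card q) m M / K) := by
  have hM : m ≤ M := hs₀.1.trans hs₀.2
  have hM0 : 0 < M := hm.trans_le hM
  have hκ₀ : 0 ≤ (M - m) / (M + m) := div_nonneg (by linarith) (by linarith)
  have hκ₁ : (M - m) / (M + m) < 1 := by rw [div_lt_one (by linarith)]; linarith
  have hg : ∀ i, |(s₀ + t₀ * lam i) / (1 + lam i)| ≤ M := fun i => by
    have hl := hlam i
    have hv := rotVar_pos hlam hm hs₀ ht₀ i
    rw [abs_of_pos (div_pos hv (by linarith)), div_le_iff₀ (by linarith)]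
    nlinarith [hs₀.2, mul_le_mul_of_nonneg_right ht₀.2 hl]
  have hy : ∀ i, |(1 - lam i) / (1 + lam i)| ≤ 1 := fun i => by
    have hl := hlam i
    rw [abs_div, abs_of_pos (by linarith : (0 : ℝ) < 1 + lam i), div_le_one (by linarith), abs_le]
    constructor <;> linarith
  have hHB' : ∀ b : q → ℝ, ∫⁻ x, ENNReal.ofReal (∑ i, (H x *ᵥ b) i ^ 2) ∂μ
      ≤ ENNReal.ofReal (b ⬝ᵥ (B *ᵥ b)) := fun b => by
    refine le_trans (le_of_eq ?_) (hHB b)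
    have hm : Measurable fun x => ENNReal.ofReal (∑ i, (H x *ᵥ b) i ^ 2) :=
      (Finset.measurable_sum _ fun i _ =>
        (measurable_mulVec_apply hH b i).pow_const 2).ennreal_ofReal
    exact ((measurePreserving_fst.comp hV).lintegral_comp hm).symm
  have h1 := measure_sup_noise_le P μ (stdNormal N) hV.measurable hV.map_eq hH
    (ξ := fun z => z) (fun i => measurable_pi_apply i) zero_le_one
    (fun a => (lintegral_sq_sum_stdNormal a).le) hB hHB' hg hy hκ₀ hκ₁ hK
  have h2 := measure_sup_noise_le P μ (stdNormal N) hV.measurable hV.map_eq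
    (H := fun _ => relVarMatrix lam s₀ t₀) (fun _ _ => measurable_const)
    (ξ := fun z i => z i ^ 2 - 1) (fun i => ((measurable_pi_apply i).pow_const 2).sub_const 1)
    sqVariance_nonneg
    (fun a => (lintegral_sq_sum_stdNormal_sq a).le) (posDef_relVarMatrix hΛ hΛd)
    (fun b => by rw [dotProduct_transpose_mul_mulVec]; simp) hg hy hκ₀ hκ₁ hK
  refine (measure_mono (t := _ ∪ _) fun ω hω => ?_).trans
    ((measure_union_le _ _).trans ((add_le_add h1 h2).trans ?_))
  · by_contra hnot
    rw [Set.mem_union, not_or] at hnot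
    simp only [Set.mem_ofPred_eq, not_not] at hnot hω
    refine hω ⟨hnot.1, fun ds dt κ hκ => ?_⟩
    have := hnot.2 ![ds, dt] κ hκ
    rw [dotProduct_transpose_mul_mulVec] at this
    simp only [relVarMatrix_mulVec] at this
    exact this
  · rw [← ENNReal.ofReal_add]
    · refine ENNReal.ofReal_le_ofReal (le_of_eq ?_)
      rw [noiseConst]
      simp only [Fintype.card_fin]
      push_cast
      ring
    · have := hκ₁; have h3 : 0 < 1 - (M - m) / (M + m) := by linarith
      positivity
    · have := sqVariance_nonneg; have h3 : 0 < 1 - (M - m) / (M + m) := by linarith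
      positivity

end Noise
end RENSEM

namespace RENSEM

variable {p : ℕ} {Ω : Type*}

/-! ### Consequences of the noise bounds -/

section Block

variable {N : ℕ} {q : Type*} [Fintype q] {lam z : Fin N → ℝ} {H : Matrix (Fin N) q ℝ}
  {Q : (q → ℝ) → ℝ} {s t s₀ t₀ m M K : ℝ}

/-- Whitened information of a mixed equation at the true parameter is close to its expectation. -/
def InfoClose (lam z : Fin N → ℝ) (H : Matrix (Fin N) q ℝ) (Q : (q → ℝ) → ℝ) (s₀ t₀ : ℝ) : Prop :=
  ∀ b ds dt, |∑ i, ((H *ᵥ b) i + relVar lam s₀ t₀ ds dt i * z i) ^ 2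
      - 1 / 2 * ∑ i, relVar lam s₀ t₀ ds dt i ^ 2
      - (Q b + 1 / 2 * ∑ i, relVar lam s₀ t₀ ds dt i ^ 2)|
      ≤ 1 / 100 * (Q b + 1 / 2 * ∑ i, relVar lam s₀ t₀ ds dt i ^ 2)

theorem InfoClose.le_two_mul (h : InfoClose lam z H Q s₀ t₀) (b : q → ℝ) :
    Q b ≤ 2 * ∑ i, (H *ᵥ b) i ^ 2 := by
  have h1 := h b 0 0
  simp only [relVar_zero, zero_mul, add_zero, ne_eq, OfNat.ofNat_ne_zero, not_false_eq_true,
    zero_pow, Finset.sum_const_zero, mul_zero, sub_zero] at h1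
  have h2 := abs_le.mp h1
  have h3 : 0 ≤ Q b := by linarith [(abs_nonneg _).trans h1]
  linarith [h2.1]

theorem InfoClose.nonneg (h : InfoClose lam z H Q s₀ t₀) (b : q → ℝ) : 0 ≤ Q b := by
  have h1 := h b 0 0
  simp only [relVar_zero, zero_mul, add_zero, ne_eq, OfNat.ofNat_ne_zero, not_false_eq_true,
    zero_pow, Finset.sum_const_zero, mul_zero, sub_zero] at h1
  linarith [(abs_nonneg _).trans h1]

theorem NoiseBound.logLik_le (hN : NoiseBound lam z H Q s₀ t₀ m M K)
    (hI : InfoClose lam z H Q s₀ t₀) (hlam : ∀ i, 0 ≤ lam i) (hm : 0 < m)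
    (hs : s ∈ Set.Icc m M) (ht : t ∈ Set.Icc m M) (hs₀ : s₀ ∈ Set.Icc m M) (ht₀ : t₀ ∈ Set.Icc m M)
    (hK : 0 ≤ K) {r₀ r : Fin N → ℝ} (b : q → ℝ) (hr₀ : ∀ i, r₀ i = Real.sqrt (s₀ + t₀ * lam i) * z i)
    (hr : ∀ i, r i = Real.sqrt (s₀ + t₀ * lam i) * (z i + (H *ᵥ b) i)) :
    (∑ i, (-(1 / 2) * Real.log (s + t * lam i) - 1 / 2 * (r i ^ 2 / (s + t * lam i))))
      - (∑ i, (-(1 / 2) * Real.log (s₀ + t₀ * lam i) - 1 / 2 * (r₀ i ^ 2 / (s₀ + t₀ * lam i))))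
      + 1 / (8 * (M / m) ^ 2 * (M / m + 1)) *
        (∑ i, (H *ᵥ b) i ^ 2 + ∑ i, relVar lam s₀ t₀ (s - s₀) (t - t₀) i ^ 2)
      ≤ 16 * (M / m) ^ 2 * (M / m + 1) * (K / m) ^ 2 :=
  mixed_logLik_le hlam hm hs ht hs₀ ht₀ hr₀ hr hK (hI.le_two_mul b) (fun κ hκ => hN.1 b κ hκ)
    fun κ hκ => hN.2 _ _ κ hκ

theorem InfoClose.mixedForm_ge (hI : InfoClose lam z H Q s₀ t₀) (hQ0 : Q 0 = 0)
    (hlam : ∀ i, 0 ≤ lam i) (hm : 0 < m)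
    (hs : s ∈ Set.Icc m M) (ht : t ∈ Set.Icc m M) (hs₀ : s₀ ∈ Set.Icc m M) (ht₀ : t₀ ∈ Set.Icc m M)
    {r x h : Fin N → ℝ} (hr : ∀ i, r i = Real.sqrt (s₀ + t₀ * lam i) * (z i + h i))
    {Λ R : ℝ} (hR : 0 ≤ R) (hΛ : 0 < Λ)
    (hΛd : ∀ ds dt, Λ * (ds ^ 2 + dt ^ 2) ≤ 1 / 2 * ∑ i, relVar lam s₀ t₀ ds dt i ^ 2)
    (hh : ∑ i, h i ^ 2 ≤ R) (hd : ∑ i, relVar lam s₀ t₀ (s - s₀) (t - t₀) i ^ 2 ≤ R)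
    (hΛR : 10000 * ((M / m) ^ 2 + 1) * (R / m ^ 2) ≤ Λ) (b : q → ℝ)
    (hx : ∀ i, x i = Real.sqrt (s₀ + t₀ * lam i) * (H *ᵥ b) i) (ds dt : ℝ) :
    1 / 2 * (Q b + 1 / 2 * ∑ i, relVar lam s₀ t₀ ds dt i ^ 2)
      ≤ mixedForm lam r s t x ds dt x ds dt := by
  refine RENSEM.mixedForm_ge hlam hm hs ht hs₀ ht₀ hr hR hΛ hΛd hh hd hΛR hx ds dt (hI.nonneg b) ?_
    (hI b ds dt)
  -- The direction `b = 0` isolates the fluctuation of `∑ (d_i z_i)²` around `∑ d_i²`, whose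
  -- tolerance is then `1/100 · 1/2`.
  have h1 := hI 0 ds dt
  simp only [mulVec_zero, Pi.zero_apply, zero_add, hQ0] at h1
  convert h1 using 1
  · congr 1
    ring
  · ring

end Block

/-! ### The likelihood ratio -/

theorem logLik_exposure (C : Fin p → ℝ) (A : ℝ) (α : Fin p → ℝ) :
    A * Real.log (propensity C α / (1 - propensity C α)) + Real.log (1 - propensity C α)
      = A * (α ⬝ᵥ C) - Real.log (1 + Real.exp (α ⬝ᵥ C)) := by
  rw [propensity_eq]
  exact logOdds_add_log _ _

/-- The exposure part is expanded about `α₀`, so that in a difference of two likelihoods only score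
minus Bregman divergence remains. -/
theorem logLik_eq {N : ℕ} (E : Matrix (Fin N) (Fin N) ℝ) (D : Obs N p) {φ : Param p}
    (h : 0 < φ.varY ∧ 0 < φ.varBY ∧ 0 < φ.varM ∧ 0 < φ.varBM) (α₀ : Fin p → ℝ) :
    logLik E D φ = -N * Real.log (2 * Real.pi)
      + ∑ i, (-(1 / 2) * Real.log (φ.varY + φ.varBY * gramEig E i)
        - 1 / 2 * ((gramRot E *ᵥ (D.Y - designY E D.C D.A D.M *ᵥ φ.beta)) i ^ 2
          / (φ.varY + φ.varBY * gramEig E i)))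
      + ∑ i, (-(1 / 2) * Real.log (φ.varM + φ.varBM * gramEig E i)
        - 1 / 2 * ((gramRot E *ᵥ (D.M - designM E D.C D.A *ᵥ φ.gamma)) i ^ 2
          / (φ.varM + φ.varBM * gramEig E i)))
      + ∑ i, (D.A i * (α₀ ⬝ᵥ D.C i) - Real.log (1 + Real.exp (α₀ ⬝ᵥ D.C i)))
      + (logisticScore D.C D.A α₀ (φ.alpha - α₀) - logisticBregman D.C α₀ (φ.alpha - α₀)) := by
  have h1 : (∑ i, D.A i * Real.log (propensity (D.C i) φ.alpha / (1 - propensity (D.C i) φ.alpha))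
      + ∑ i, Real.log (1 - propensity (D.C i) φ.alpha))
      = ∑ i, (D.A i * (α₀ ⬝ᵥ D.C i) - Real.log (1 + Real.exp (α₀ ⬝ᵥ D.C i)))
      + (logisticScore D.C D.A α₀ (φ.alpha - α₀) - logisticBregman D.C α₀ (φ.alpha - α₀)) := by
    rw [logisticScore, logisticBregman, ← Finset.sum_sub_distrib, ← Finset.sum_add_distrib,
      ← Finset.sum_add_distrib]
    refine Finset.sum_congr rfl fun i _ => ?_
    rw [logLik_exposure, add_sub_cancel, sub_dotProduct]
    ring
  rw [logLik, h1, gaussLogLik_covMat E (gramVar_pos E h.1 h.2.1),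
    gaussLogLik_covMat E (gramVar_pos E h.2.2.1 h.2.2.2)]
  simp only [mulVec_sub, Pi.sub_apply]
  ring

/-- Radius of the region in which a maximizer of the likelihood must lie. -/
noncomputable def mleRadius (m M K K' : ℝ) : ℝ :=
  8 * (M / m) ^ 2 * (M / m + 1) * (2 * (16 * (M / m) ^ 2 * (M / m + 1) * (K / m) ^ 2) + K')

section MLE

variable {S : System p Ω} {N : ℕ} {φ₀ φ : Param p} {m M K K' : ℝ} {ω : Ω}

/-- The variance components of `φ` lie in `[m, M]`. -/
def VarMem (m M : ℝ) (φ : Param p) : Prop :=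
  (φ.varY ∈ Set.Icc m M ∧ φ.varBY ∈ Set.Icc m M) ∧ φ.varM ∈ Set.Icc m M ∧ φ.varBM ∈ Set.Icc m M

theorem VarMem.pos (hm : 0 < m) (h : VarMem m M φ) :
    0 < φ.varY ∧ 0 < φ.varBY ∧ 0 < φ.varM ∧ 0 < φ.varBM :=
  ⟨hm.trans_le h.1.1.1, hm.trans_le h.1.2.1, hm.trans_le h.2.1.1, hm.trans_le h.2.2.1⟩

/-- The event on which the maximum likelihood estimator is controlled. -/
structure GoodEvent (S : System p Ω) (N : ℕ) (φ₀ : Param p) (B : Matrix (Idx p) (Idx p) ℝ)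
    (m M K K' : ℝ) (ω : Ω) : Prop where
  closeY : InfoClose (gramEig (S.E N)) (S.noiseY N φ₀ ω) (whitenedY (S.E N) φ₀ (S.preY N ω))
    (fun b => dirY b 0 0 ⬝ᵥ (B *ᵥ dirY b 0 0)) φ₀.varY φ₀.varBY
  closeM : InfoClose (gramEig (S.E N)) (S.noiseM N φ₀ ω) (whitenedM (S.E N) φ₀ (S.preM N ω))
    (fun b => dirM b 0 0 ⬝ᵥ (B *ᵥ dirM b 0 0)) φ₀.varM φ₀.varBM
  noiseY : NoiseBound (gramEig (S.E N)) (S.noiseY N φ₀ ω) (whitenedY (S.E N) φ₀ (S.preY N ω))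
    (fun b => dirY b 0 0 ⬝ᵥ (B *ᵥ dirY b 0 0)) φ₀.varY φ₀.varBY m M K
  noiseM : NoiseBound (gramEig (S.E N)) (S.noiseM N φ₀ ω) (whitenedM (S.E N) φ₀ (S.preM N ω))
    (fun b => dirM b 0 0 ⬝ᵥ (B *ᵥ dirM b 0 0)) φ₀.varM φ₀.varBM m M K
  exposure : ∀ x, logisticScore (S.C N ω) (S.exposure N φ₀ ω) φ₀.alpha x
    - logisticBregman (S.C N ω) φ₀.alpha x ≤ K'

variable {B : Matrix (Idx p) (Idx p) ℝ}

/-- The three log-likelihood ratios add up to a nonnegative number while each is bounded above, so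
the drift retained in the two mixed equations is bounded by the sum of the bounds. -/
theorem GoodEvent.mle_close (hG : GoodEvent S N φ₀ B m M K K' ω) (hm : 0 < m)
    (h₀ : VarMem m M φ₀) (h : VarMem m M φ) (hK : 0 ≤ K)
    (hl : logLik (S.E N) (S.data N φ₀ ω) φ₀ ≤ logLik (S.E N) (S.data N φ₀ ω) φ) :
    (∑ i, (whitenedY (S.E N) φ₀ (S.preY N ω) *ᵥ (φ₀.beta - φ.beta)) i ^ 2
      + ∑ i, relVar (gramEig (S.E N)) φ₀.varY φ₀.varBY (φ.varY - φ₀.varY) (φ.varBY - φ₀.varBY) i ^ 2)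
    + (∑ i, (whitenedM (S.E N) φ₀ (S.preM N ω) *ᵥ (φ₀.gamma - φ.gamma)) i ^ 2
      + ∑ i, relVar (gramEig (S.E N)) φ₀.varM φ₀.varBM (φ.varM - φ₀.varM) (φ.varBM - φ₀.varBM) i ^ 2)
    ≤ mleRadius m M K K' := by
  have hp₀ := h₀.pos hm
  have hp := h.pos hm
  have hM : 0 < M := hm.trans_le (h.1.1.1.trans h.1.1.2)
  have hY := hG.noiseY.logLik_le hG.closeY (gramEig_nonneg _) hm h.1.1 h.1.2 h₀.1.1 h₀.1.2 hK
    (φ₀.beta - φ.beta)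
    (r₀ := gramRot (S.E N) *ᵥ ((S.data N φ₀ ω).Y
        - designY (S.E N) (S.data N φ₀ ω).C (S.data N φ₀ ω).A (S.data N φ₀ ω).M *ᵥ φ₀.beta))
    (fun i => by
      rw [gramRot_outcome_residual S N ω ⟨hp₀.1, hp₀.2.1⟩, sub_self, mulVec_zero, Pi.zero_apply,
        add_zero])
    (gramRot_outcome_residual S N ω ⟨hp₀.1, hp₀.2.1⟩ φ.beta)
  have hMd := hG.noiseM.logLik_le hG.closeM (gramEig_nonneg _) hm h.2.1 h.2.2 h₀.2.1 h₀.2.2 hK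
    (φ₀.gamma - φ.gamma)
    (r₀ := gramRot (S.E N) *ᵥ ((S.data N φ₀ ω).M
        - designM (S.E N) (S.data N φ₀ ω).C (S.data N φ₀ ω).A *ᵥ φ₀.gamma))
    (fun i => by
      rw [gramRot_mediator_residual S N ω hp₀.2.2, sub_self, mulVec_zero, Pi.zero_apply,
        add_zero])
    (gramRot_mediator_residual S N ω hp₀.2.2 φ.gamma)
  have hA : logisticScore (S.data N φ₀ ω).C (S.data N φ₀ ω).A φ₀.alpha (φ.alpha - φ₀.alpha)
    - logisticBregman (S.data N φ₀ ω).C φ₀.alpha (φ.alpha - φ₀.alpha) ≤ K' :=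
    hG.exposure (φ.alpha - φ₀.alpha)
  have hA0 : logisticScore (S.data N φ₀ ω).C (S.data N φ₀ ω).A φ₀.alpha (φ₀.alpha - φ₀.alpha)
    - logisticBregman (S.data N φ₀ ω).C φ₀.alpha (φ₀.alpha - φ₀.alpha) = 0 := by
    rw [sub_self, logisticBregman_zero]
    simp [logisticScore]
  rw [logLik_eq _ _ hp₀ φ₀.alpha, logLik_eq _ _ hp φ₀.alpha, hA0] at hl
  rw [mleRadius]
  set c := 8 * (M / m) ^ 2 * (M / m + 1) with hc
  have hc0 : 0 < c := by positivity
  set T := 16 * (M / m) ^ 2 * (M / m + 1) * (K / m) ^ 2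
  rw [← div_le_iff₀' hc0, div_eq_inv_mul, ← one_div, mul_add]
  linarith

/-- The likelihood inequality places `φ` at bounded whitened distance from `φ₀`, where the
mixed-equation information keeps half of its expected size. The exposure block is only used through
its nonnegativity, so `alpha` does not appear on the left. -/
theorem GoodEvent.obsInfo_form_ge (hG : GoodEvent S N φ₀ B m M K K' ω) (hm : 0 < m)
    (h₀ : VarMem m M φ₀) (h : VarMem m M φ) (hK : 0 ≤ K) (hK' : 0 ≤ K')
    (hl : logLik (S.E N) (S.data N φ₀ ω) φ₀ ≤ logLik (S.E N) (S.data N φ₀ ω) φ)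
    {Λ : ℝ} (hΛ : 0 < Λ) (hΛR : 10000 * ((M / m) ^ 2 + 1) * (mleRadius m M K K' / m ^ 2) ≤ Λ)
    (hΛB : ∀ u, Λ * (u ⬝ᵥ u) ≤ u ⬝ᵥ (B *ᵥ u))
    (hBY : ∀ b ds dt, dirY b ds dt ⬝ᵥ (B *ᵥ dirY b ds dt) = dirY b 0 0 ⬝ᵥ (B *ᵥ dirY b 0 0)
        + 1 / 2 * ∑ i, relVar (gramEig (S.E N)) φ₀.varY φ₀.varBY ds dt i ^ 2)
    (hBM : ∀ b ds dt, dirM b ds dt ⬝ᵥ (B *ᵥ dirM b ds dt) = dirM b 0 0 ⬝ᵥ (B *ᵥ dirM b 0 0)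
        + 1 / 2 * ∑ i, relVar (gramEig (S.E N)) φ₀.varM φ₀.varBM ds dt i ^ 2) (u : Param p) :
    Λ / 2 * ((u.beta ⬝ᵥ u.beta + (u.varY ^ 2 + u.varBY ^ 2))
      + (u.gamma ⬝ᵥ u.gamma + (u.varM ^ 2 + u.varBM ^ 2)))
      ≤ u ⬝ᵥ (obsInfo (S.E N) (S.data N φ₀ ω) φ *ᵥ u) := by
  have hp₀ := h₀.pos hm
  have hp := h.pos hm
  have hM : 0 < M := hm.trans_le (h.1.1.1.trans h.1.1.2)
  have hR : 0 ≤ mleRadius m M K K' := by unfold mleRadius; positivity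
  have hclose := hG.mle_close hm h₀ h hK hl
  have n1 : 0 ≤ ∑ i, (whitenedY (S.E N) φ₀ (S.preY N ω) *ᵥ (φ₀.beta - φ.beta)) i ^ 2 :=
    Finset.sum_nonneg fun _ _ => sq_nonneg _
  have n2 : 0 ≤ ∑ i, (whitenedM (S.E N) φ₀ (S.preM N ω) *ᵥ (φ₀.gamma - φ.gamma)) i ^ 2 :=
    Finset.sum_nonneg fun _ _ => sq_nonneg _
  have n3 : 0 ≤ ∑ i, relVar (gramEig (S.E N)) φ₀.varY φ₀.varBY (φ.varY - φ₀.varY)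
    (φ.varBY - φ₀.varBY) i ^ 2 := Finset.sum_nonneg fun _ _ => sq_nonneg _
  have n4 : 0 ≤ ∑ i, relVar (gramEig (S.E N)) φ₀.varM φ₀.varBM (φ.varM - φ₀.varM)
    (φ.varBM - φ₀.varBM) i ^ 2 := Finset.sum_nonneg fun _ _ => sq_nonneg _
  have z1 : (dirY (0 : YIdx p → ℝ) 0 0) ⬝ᵥ (B *ᵥ dirY 0 0 0) = 0 := by
    have : (dirY 0 0 0 : Param p) = 0 := by
      ext k; rcases k with (k | k) | k
      · rfl
      · fin_cases k <;> rfl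
      · rfl
    rw [this, zero_dotProduct]
  have z2 : (dirM (0 : MIdx p → ℝ) 0 0) ⬝ᵥ (B *ᵥ dirM 0 0 0) = 0 := by
    have : (dirM 0 0 0 : Param p) = 0 := by
      ext k; rcases k with k | (k | k) | k
      · rfl
      · rfl
      · fin_cases k <;> rfl
      · rfl
    rw [this, zero_dotProduct]
  have dY : ∀ ds dt : ℝ, Λ * (ds ^ 2 + dt ^ 2)
      ≤ 1 / 2 * ∑ i, relVar (gramEig (S.E N)) φ₀.varY φ₀.varBY ds dt i ^ 2 := fun ds dt => by
    have := hΛB (dirY 0 ds dt)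
    rwa [hBY, z1, zero_add, dirY_dotProduct_self, zero_dotProduct, zero_add] at this
  have dM : ∀ ds dt : ℝ, Λ * (ds ^ 2 + dt ^ 2)
      ≤ 1 / 2 * ∑ i, relVar (gramEig (S.E N)) φ₀.varM φ₀.varBM ds dt i ^ 2 := fun ds dt => by
    have := hΛB (dirM 0 ds dt)
    rwa [hBM, z2, zero_add, dirM_dotProduct_self, zero_dotProduct, zero_add] at this
  have hY := hG.closeY.mixedForm_ge z1 (gramEig_nonneg _) hm h.1.1 h.1.2 h₀.1.1 h₀.1.2
    (gramRot_outcome_residual S N ω ⟨hp₀.1, hp₀.2.1⟩ φ.beta) hR hΛ dY (by linarith) (by linarith)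
    hΛR u.beta (gramRot_outcome_design S N ω ⟨hp₀.1, hp₀.2.1⟩ u.beta) u.varY u.varBY
  have hMd := hG.closeM.mixedForm_ge z2 (gramEig_nonneg _) hm h.2.1 h.2.2 h₀.2.1 h₀.2.2
    (gramRot_mediator_residual S N ω hp₀.2.2 φ.gamma) hR hΛ dM (by linarith) (by linarith)
    hΛR u.gamma (gramRot_mediator_design S N ω hp₀.2.2 u.gamma) u.varM u.varBM
  rw [← hBY] at hY
  rw [← hBM] at hMd
  have hA := logisticForm_nonneg (S.data N φ₀ ω).C φ.alpha u.alpha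
  have bY := hΛB (dirY u.beta u.varY u.varBY)
  have bM := hΛB (dirM u.gamma u.varM u.varBM)
  rw [dirY_dotProduct_self] at bY
  rw [dirM_dotProduct_self] at bM
  rw [obsInfo_form _ _ hp]
  linarith

/-- For `v = J⁻¹ e_l` one has `vᵀ J v = v_l`, and the lower bound on the form gives `(Λ/2) v_k² ≤
v_l` for the controlled coordinates. The case `k = l` bounds `v_l` by `2 / Λ`; inserting this bounds
every `v_k`. -/
theorem GoodEvent.abs_inv_le (hG : GoodEvent S N φ₀ B m M K K' ω) (hm : 0 < m)
    (h₀ : VarMem m M φ₀) (h : VarMem m M φ) (hK : 0 ≤ K) (hK' : 0 ≤ K')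
    (hl : logLik (S.E N) (S.data N φ₀ ω) φ₀ ≤ logLik (S.E N) (S.data N φ₀ ω) φ)
    (hJ : (obsInfo (S.E N) (S.data N φ₀ ω) φ).PosDef)
    {Λ : ℝ} (hΛ : 0 < Λ) (hΛR : 10000 * ((M / m) ^ 2 + 1) * (mleRadius m M K K' / m ^ 2) ≤ Λ)
    (hΛB : ∀ u, Λ * (u ⬝ᵥ u) ≤ u ⬝ᵥ (B *ᵥ u))
    (hBY : ∀ b ds dt, dirY b ds dt ⬝ᵥ (B *ᵥ dirY b ds dt) = dirY b 0 0 ⬝ᵥ (B *ᵥ dirY b 0 0)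
        + 1 / 2 * ∑ i, relVar (gramEig (S.E N)) φ₀.varY φ₀.varBY ds dt i ^ 2)
    (hBM : ∀ b ds dt, dirM b ds dt ⬝ᵥ (B *ᵥ dirM b ds dt) = dirM b 0 0 ⬝ᵥ (B *ᵥ dirM b 0 0)
        + 1 / 2 * ∑ i, relVar (gramEig (S.E N)) φ₀.varM φ₀.varBM ds dt i ^ 2) :
    (∀ k, |(obsInfo (S.E N) (S.data N φ₀ ω) φ)⁻¹ (iBeta p k) (iBeta p k)| ≤ 2 / Λ) ∧
    ∀ k l, |(obsInfo (S.E N) (S.data N φ₀ ω) φ)⁻¹ (iGamma p k) (iGamma p l)| ≤ 2 / Λ := by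
  have hform := hG.obsInfo_form_ge hm h₀ h hK hK' hl hΛ hΛR hΛB hBY hBM
  set J := obsInfo (S.E N) (S.data N φ₀ ω) φ
  have hdet : IsUnit J.det := hJ.det_pos.ne'.isUnit
  have hdiag : ∀ k, (J⁻¹ *ᵥ Pi.single k 1) ⬝ᵥ (J *ᵥ (J⁻¹ *ᵥ Pi.single k 1))
      = (J⁻¹ *ᵥ Pi.single k 1) k := fun k => by
    rw [mulVec_mulVec, mul_nonsing_inv _ hdet, one_mulVec, dotProduct_single_one]
  have hcol : ∀ k l, (J⁻¹ *ᵥ Pi.single k 1) l = J⁻¹ l k := fun k l => by simp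
  have hb : ∀ (v : Param p) (k : YIdx p),
      v (Sum.inl (Sum.inl k)) ^ 2 ≤ v.beta ⬝ᵥ v.beta := fun v k => by
    rw [dotProduct, sq]
    exact Finset.single_le_sum (f := fun k => v.beta k * v.beta k)
      (fun i _ => mul_self_nonneg _) (Finset.mem_univ k)
  have hg : ∀ (v : Param p) (k : MIdx p),
      v (Sum.inr (Sum.inl (Sum.inl k))) ^ 2 ≤ v.gamma ⬝ᵥ v.gamma := fun v k => by
    rw [dotProduct, sq]
    exact Finset.single_le_sum (f := fun k => v.gamma k * v.gamma k)
      (fun i _ => mul_self_nonneg _) (Finset.mem_univ k)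
  have hbn : ∀ v : Param p, 0 ≤ v.beta ⬝ᵥ v.beta := fun v =>
    Finset.sum_nonneg fun i _ => mul_self_nonneg _
  have hgn : ∀ v : Param p, 0 ≤ v.gamma ⬝ᵥ v.gamma := fun v =>
    Finset.sum_nonneg fun i _ => mul_self_nonneg _
  have hfin : ∀ {x y : ℝ}, Λ / 2 * y ^ 2 ≤ x → Λ / 2 * x ^ 2 ≤ x → |y| ≤ 2 / Λ := by
    intro x y hy hx
    have hx0 : 0 ≤ x := le_trans (by positivity) hy
    have h1 : Λ * x ≤ 2 := by
      by_contra hlt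
      push Not at hlt
      have : 0 < x := by nlinarith
      nlinarith
    rw [le_div_iff₀ hΛ]
    have h2 : (|y| * Λ) ^ 2 ≤ 2 ^ 2 := by
      rw [mul_pow, sq_abs]
      nlinarith
    exact (abs_le_of_sq_le_sq' h2 zero_le_two).2
  refine ⟨fun k => ?_, fun k l => ?_⟩
  · set v : Param p := J⁻¹ *ᵥ Pi.single (iBeta p k) 1 with hv
    have h1 := hform v
    rw [hv, hdiag, ← hv] at h1
    rw [← hcol, ← hv]
    have h2 : Λ / 2 * v (iBeta p k) ^ 2 ≤ v (iBeta p k) := by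
      refine le_trans (mul_le_mul_of_nonneg_left ?_ (by positivity)) h1
      linarith [hb v (Sum.inl k), hgn v, sq_nonneg v.varY, sq_nonneg v.varBY, sq_nonneg v.varM,
        sq_nonneg v.varBM]
    exact hfin h2 h2
  · set v : Param p := J⁻¹ *ᵥ Pi.single (iGamma p l) 1 with hv
    have h1 := hform v
    rw [hv, hdiag, ← hv] at h1
    rw [← hcol, ← hv]
    have h2 : ∀ k, Λ / 2 * v (iGamma p k) ^ 2 ≤ v (iGamma p l) := fun k => by
      refine le_trans (mul_le_mul_of_nonneg_left ?_ (by positivity)) h1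
      linarith [hg v (Sum.inl k), hbn v, sq_nonneg v.varY, sq_nonneg v.varBY, sq_nonneg v.varM,
        sq_nonneg v.varBM]
    exact hfin (h2 k) (h2 l)

end MLE

end RENSEM

/-! ### Consequences of the regularity conditions and probability of the good event -/

namespace RENSEM

variable {p : ℕ} {Ω : Type*}

theorem eventually_le_of_tendsto_iSup {X : Type*} {Θ : Set X} {f : ℕ → X → ENNReal}
    (h : Tendsto (fun N => ⨆ φ ∈ Θ, f N φ) atTop (𝓝 0)) {ε : ℝ} (hε : 0 < ε) :
    ∀ᶠ N in atTop, ∀ φ ∈ Θ, f N φ ≤ ENNReal.ofReal ε := by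
  filter_upwards [h.eventually_le_const (by simpa using hε : (0 : ENNReal) < ENNReal.ofReal ε)]
    with N hN φ hφ
  exact (le_iSup₂ (f := fun φ _ => f N φ) φ hφ).trans hN

section Events

variable [MeasurableSpace Ω] {P : Measure Ω} {S : System p Ω} {Θ : Set (Param p)} {φ₀ : Param p}

theorem InfoGrowth.eventually_frob_inv_le (hG : InfoGrowth S P Θ) {ε : ℝ} (hε : 0 < ε) :
    ∀ᶠ N in atTop, ∀ φ ∈ Θ, frob (fisherInfo S P N φ)⁻¹ ≤ ε := by
  filter_upwards [eventually_le_of_tendsto_iSup hG.inv_tendsto hε] with N hN φ hφ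
  exact (ENNReal.ofReal_le_ofReal_iff hε.le).mp (hN φ hφ)

theorem InfoGrowth.eventually_form_ge (hG : InfoGrowth S P Θ) {Λ : ℝ} (hΛ : 0 < Λ) :
    ∀ᶠ N in atTop, ∀ φ ∈ Θ, ∀ u, Λ * (u ⬝ᵥ u) ≤ u ⬝ᵥ (fisherInfo S P N φ *ᵥ u) := by
  filter_upwards [hG.eventually_frob_inv_le (inv_pos.mpr hΛ), hG.posDef] with N h1 h2 φ hφ u
  have h3 := dotProduct_self_le_frob_inv (h2 φ hφ) u
  have h4 := mul_le_mul_of_nonneg_right (h1 φ hφ) (form_nonneg (h2 φ hφ) u)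
  rw [← le_div_iff₀' hΛ, div_eq_inv_mul]
  exact h3.trans h4

theorem FisherSmooth.eventually_frob_le (hF : FisherSmooth S P Θ) {R ε : ℝ} (hR : 0 < R)
    (hε : 0 < ε) : ∀ᶠ N in atTop, ∀ φ ∈ Θ, ∀ φ' ∈ Θ,
      eucl ((msqrt (fisherInfo S P N φ))ᵀ *ᵥ (φ - φ')) ≤ R →
      frob ((msqrt (fisherInfo S P N φ))⁻¹ * msqrt (fisherInfo S P N φ') - 1) ≤ ε := by
  filter_upwards [eventually_le_of_tendsto_iSup (hF R hR) hε] with N hN φ hφ φ' hφ' h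
  have h1 := hN φ hφ
  rw [iSup₂_le_iff] at h1
  have h2 := h1 φ' hφ'
  rw [iSup_le_iff] at h2
  exact (ENNReal.ofReal_le_ofReal_iff hε.le).mp (h2 h)

/-- The relative error of the observed information. -/
noncomputable def relErr (S : System p Ω) (P : Measure Ω) (N : ℕ) (φ : Param p) (ω : Ω) : ℝ :=
  frob ((msqrt (fisherInfo S P N φ))⁻¹ * obsInfo (S.E N) (S.data N φ ω) φ
      * (msqrt (fisherInfo S P N φ))⁻¹ - 1)

theorem aemeasurable_relErr {N : ℕ} {φ : Param p}
    (hint : ∀ k l, Integrable (fun ω => obsInfo (S.E N) (S.data N φ ω) φ k l) P) :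
    AEMeasurable (relErr S P N φ) P := by
  have hJ : ∀ k l, AEMeasurable (fun ω => obsInfo (S.E N) (S.data N φ ω) φ k l) P :=
    fun k l => (hint k l).aemeasurable
  set A := (msqrt (fisherInfo S P N φ))⁻¹
  have h1 : ∀ k l, AEMeasurable
      (fun ω => (A * obsInfo (S.E N) (S.data N φ ω) φ * A - 1) k l) P := fun k l => by
    simp only [Matrix.sub_apply, Matrix.mul_apply]
    refine AEMeasurable.sub_const (Finset.aemeasurable_fun_sum _ fun j _ =>
      AEMeasurable.mul_const (Finset.aemeasurable_fun_sum _ fun i _ => (hJ i j).const_mul _) _) _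
  have h2 : relErr S P N φ = fun ω => Real.sqrt
      (∑ l, ∑ k, (A * obsInfo (S.E N) (S.data N φ ω) φ * A - 1) k l ^ 2) := by
    funext ω
    rw [← frob_sq, Real.sqrt_sq (frob_nonneg _)]
    rfl
  rw [h2]
  exact (Finset.aemeasurable_fun_sum _ fun l _ => Finset.aemeasurable_fun_sum _ fun k _ =>
    (h1 k l).pow_const 2).sqrt

theorem InfoStability.eventually_measure_le (hSt : InfoStability S P Θ) (hG : InfoGrowth S P Θ)
    {η δ : ℝ} (hη : 0 < η) (hδ : 0 < δ) :
    ∀ᶠ N in atTop, ∀ φ ∈ Θ, P {ω | η < relErr S P N φ ω} ≤ ENNReal.ofReal δ := by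
  filter_upwards [eventually_le_of_tendsto_iSup hSt (by positivity : 0 < δ * η ^ 2),
    hG.integrable] with N h1 h2 φ hφ
  have hm : AEMeasurable (fun ω => ENNReal.ofReal (relErr S P N φ ω ^ 2)) P :=
    ((aemeasurable_relErr (h2 φ hφ)).pow_const 2).ennreal_ofReal
  calc P {ω | η < relErr S P N φ ω}
      ≤ P {ω | ENNReal.ofReal (η ^ 2) ≤ ENNReal.ofReal (relErr S P N φ ω ^ 2)} :=
        measure_mono fun ω hω => ENNReal.ofReal_le_ofReal
          (pow_le_pow_left₀ hη.le (le_of_lt hω) 2)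
    _ ≤ (∫⁻ ω, ENNReal.ofReal (relErr S P N φ ω ^ 2) ∂P) / ENNReal.ofReal (η ^ 2) :=
        meas_ge_le_lintegral_div hm (by simpa using hη.ne') ENNReal.ofReal_ne_top
    _ ≤ ENNReal.ofReal (δ * η ^ 2) / ENNReal.ofReal (η ^ 2) := by
        gcongr
        exact h1 φ hφ
    _ = ENNReal.ofReal δ := by
        rw [← ENNReal.ofReal_div_of_pos (by positivity)]
        congr 1
        field_simp

variable [IsProbabilityMeasure P]

theorem infoClose_of_relErr_le (hS : S.Valid P) {N : ℕ}
    (hint : ∀ k l, Integrable (fun ω => obsInfo (S.E N) (S.data N φ₀ ω) φ₀ k l) P)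
    (h : 0 < φ₀.varY ∧ 0 < φ₀.varBY ∧ 0 < φ₀.varM ∧ 0 < φ₀.varBM)
    (hB : (fisherInfo S P N φ₀).PosDef) {ω : Ω} (hω : relErr S P N φ₀ ω ≤ 1 / 100) :
    InfoClose (gramEig (S.E N)) (S.noiseY N φ₀ ω) (whitenedY (S.E N) φ₀ (S.preY N ω))
      (fun b => dirY b 0 0 ⬝ᵥ (fisherInfo S P N φ₀ *ᵥ dirY b 0 0)) φ₀.varY φ₀.varBY ∧
    InfoClose (gramEig (S.E N)) (S.noiseM N φ₀ ω) (whitenedM (S.E N) φ₀ (S.preM N ω))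
      (fun b => dirM b 0 0 ⬝ᵥ (fisherInfo S P N φ₀ *ᵥ dirM b 0 0)) φ₀.varM φ₀.varBM := by
  have key : ∀ u, |u ⬝ᵥ (obsInfo (S.E N) (S.data N φ₀ ω) φ₀ *ᵥ u)
      - u ⬝ᵥ (fisherInfo S P N φ₀ *ᵥ u)| ≤ 1 / 100 * (u ⬝ᵥ (fisherInfo S P N φ₀ *ᵥ u)) :=
    fun u => (abs_form_sub_le hB _ u).trans
      (mul_le_mul_of_nonneg_right hω (form_nonneg hB u))
  refine ⟨fun b ds dt => ?_, fun b ds dt => ?_⟩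
  · have h1 := key (dirY b ds dt)
    rwa [obsInfo_dirY_self S ω b ds dt h, fisherInfo_dirY hS hint h b ds dt] at h1
  · have h1 := key (dirM b ds dt)
    rwa [obsInfo_dirM_self S ω b ds dt h, fisherInfo_dirM hS hint h b ds dt] at h1

theorem measure_not_noiseY_le (hS : S.Valid P) {N : ℕ}
    (hint : ∀ k l, Integrable (fun ω => obsInfo (S.E N) (S.data N φ₀ ω) φ₀ k l) P)
    (hB : (fisherInfo S P N φ₀).PosDef) {m M : ℝ} (hm : 0 < m) (h₀ : VarMem m M φ₀)
    (hΛB : ∀ u, 1 * (u ⬝ᵥ u) ≤ u ⬝ᵥ (fisherInfo S P N φ₀ *ᵥ u)) {K : ℝ} (hK : 0 < K) :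
    P {ω | ¬ NoiseBound (gramEig (S.E N)) (S.noiseY N φ₀ ω) (whitenedY (S.E N) φ₀ (S.preY N ω))
      (fun b => dirY b 0 0 ⬝ᵥ (fisherInfo S P N φ₀ *ᵥ dirY b 0 0)) φ₀.varY φ₀.varBY m M K}
      ≤ ENNReal.ofReal (noiseConst (Fintype.card (YIdx p)) m M / K) := by
  have := hS.isProbabilityMeasure_map N
  have h := h₀.pos hm
  set ι : YIdx p → Idx p := fun k => Sum.inl (Sum.inl k) with hι
  have hinj : Function.Injective ι := Sum.inl_injective.comp Sum.inl_injective
  have hform : ∀ b : YIdx p → ℝ, b ⬝ᵥ ((fisherInfo S P N φ₀).submatrix ι ι *ᵥ b)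
      = dirY b 0 0 ⬝ᵥ (fisherInfo S P N φ₀ *ᵥ dirY b 0 0) := fun b => by
    refine dotProduct_submatrix_mulVec (fisherInfo S P N φ₀) hinj (u := dirY b 0 0) fun k hk => ?_
    rcases k with (k | k) | k
    · exact absurd ⟨k, rfl⟩ hk
    · fin_cases k <;> rfl
    · rfl
  have hz : dirY (0 : YIdx p → ℝ) 0 0 ⬝ᵥ (fisherInfo S P N φ₀ *ᵥ dirY 0 0 0) = 0 := by
    rw [← hform, zero_dotProduct]
  simp only [← hform]
  refine measure_not_noiseBound_le P (hS.law_outcome N h.1 h.2.1)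
    (measurable_whitenedY (S.E N) φ₀) (hB.submatrix hinj)
    (fun b => by rw [hform]; exact (lintegral_whitenedY hint h b).2.le) (gramEig_nonneg _) hm
    h₀.1.1 h₀.1.2 zero_lt_one (fun ds dt => ?_) hK
  have h1 := hΛB (dirY 0 ds dt)
  rwa [fisherInfo_dirY hS hint h, hz, zero_add, dirY_dotProduct_self, zero_dotProduct,
    zero_add] at h1

theorem measure_not_noiseM_le (hS : S.Valid P) {N : ℕ}
    (hint : ∀ k l, Integrable (fun ω => obsInfo (S.E N) (S.data N φ₀ ω) φ₀ k l) P)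
    (hB : (fisherInfo S P N φ₀).PosDef) {m M : ℝ} (hm : 0 < m) (h₀ : VarMem m M φ₀)
    (hΛB : ∀ u, 1 * (u ⬝ᵥ u) ≤ u ⬝ᵥ (fisherInfo S P N φ₀ *ᵥ u)) {K : ℝ} (hK : 0 < K) :
    P {ω | ¬ NoiseBound (gramEig (S.E N)) (S.noiseM N φ₀ ω) (whitenedM (S.E N) φ₀ (S.preM N ω))
      (fun b => dirM b 0 0 ⬝ᵥ (fisherInfo S P N φ₀ *ᵥ dirM b 0 0)) φ₀.varM φ₀.varBM m M K}
      ≤ ENNReal.ofReal (noiseConst (Fintype.card (MIdx p)) m M / K) := by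
  have := hS.isProbabilityMeasure_map N
  have h := h₀.pos hm
  set ι : MIdx p → Idx p := fun k => Sum.inr (Sum.inl (Sum.inl k)) with hι
  have hinj : Function.Injective ι :=
    Sum.inr_injective.comp (Sum.inl_injective.comp Sum.inl_injective)
  have hform : ∀ b : MIdx p → ℝ, b ⬝ᵥ ((fisherInfo S P N φ₀).submatrix ι ι *ᵥ b)
      = dirM b 0 0 ⬝ᵥ (fisherInfo S P N φ₀ *ᵥ dirM b 0 0) := fun b => by
    refine dotProduct_submatrix_mulVec (fisherInfo S P N φ₀) hinj (u := dirM b 0 0) fun k hk => ?_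
    rcases k with k | (k | k) | k
    · rfl
    · exact absurd ⟨k, rfl⟩ hk
    · fin_cases k <;> rfl
    · rfl
  have hz : dirM (0 : MIdx p → ℝ) 0 0 ⬝ᵥ (fisherInfo S P N φ₀ *ᵥ dirM 0 0 0) = 0 := by
    rw [← hform, zero_dotProduct]
  simp only [← hform]
  refine measure_not_noiseBound_le P (hS.law_mediator N h.2.2.1 h.2.2.2)
    (measurable_whitenedM (S.E N) φ₀) (hB.submatrix hinj)
    (fun b => by rw [hform]; exact (lintegral_whitenedM hint h b).2.le) (gramEig_nonneg _) hm
    h₀.2.1 h₀.2.2 zero_lt_one (fun ds dt => ?_) hK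
  have h1 := hΛB (dirM 0 ds dt)
  rwa [fisherInfo_dirM hS hint h, hz, zero_add, dirM_dotProduct_self, zero_dotProduct,
    zero_add] at h1

/-! ### The exposure model -/

/-- The stability condition at `φ` concerns data generated at `φ`, but the exposure information
depends on the confounders only, whose law does not involve the parameter. It therefore also
describes the information at a shifted parameter for data generated at `φ₀`. The error is split at
the Fisher information at `φ`: `f` accounts for its distance to `B`, and `a ≤ τ + a²/τ` turns the
second moment of the relative error into a first moment. -/
theorem lintegral_logisticForm_sub_le {N : ℕ} {φ : Param p}
    (h : 0 < φ.varY ∧ 0 < φ.varBY ∧ 0 < φ.varM ∧ 0 < φ.varBM)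
    {B : Matrix (Idx p) (Idx p) ℝ} (hB : B.PosDef) (hBφ : (fisherInfo S P N φ).PosDef)
    {τ f : ℝ} (hτ : 0 < τ) (hf0 : 0 < f) (hf1 : f ≤ 1)
    (hf : frob ((msqrt B)⁻¹ * msqrt (fisherInfo S P N φ) - 1) ≤ f)
    (hF : ∫⁻ ω, ENNReal.ofReal (relErr S P N φ ω ^ 2) ∂P ≤ ENNReal.ofReal (τ ^ 2)) (x : Fin p → ℝ) :
    ∫⁻ ω, ENNReal.ofReal |logisticForm (S.C N ω) φ.alpha x x - dirA x ⬝ᵥ (B *ᵥ dirA x)| ∂P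
      ≤ ENNReal.ofReal ((8 * τ + 3 * f) * (dirA x ⬝ᵥ (B *ᵥ dirA x))) := by
  set q := dirA x ⬝ᵥ (B *ᵥ dirA x) with hq
  have hq0 : 0 ≤ q := form_nonneg hB _
  have h1 := abs_form_sub_le_of_sqrt hB hBφ hf (dirA x)
  rw [← hq] at h1
  have hff : 2 * f + f ^ 2 ≤ 3 * f := by nlinarith
  have h2 : |dirA x ⬝ᵥ (fisherInfo S P N φ *ᵥ dirA x) - q| ≤ 3 * f * q :=
    h1.trans (mul_le_mul_of_nonneg_right hff hq0)
  have h3 : dirA x ⬝ᵥ (fisherInfo S P N φ *ᵥ dirA x) ≤ 4 * q := by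
    have := (abs_le.mp h2).2
    nlinarith
  have hpt : ∀ ω, |logisticForm (S.C N ω) φ.alpha x x - q|
      ≤ (3 * f * q + 4 * τ * q) + 4 * q / τ * relErr S P N φ ω ^ 2 := fun ω => by
    have h4 := abs_form_sub_le hBφ (obsInfo (S.E N) (S.data N φ ω) φ) (dirA x)
    rw [obsInfo_dirA _ _ h] at h4
    change |logisticForm (S.C N ω) φ.alpha x x - _| ≤ relErr S P N φ ω * _ at h4
    have h5 : relErr S P N φ ω ≤ τ + relErr S P N φ ω ^ 2 / τ := by
      rw [← sub_le_iff_le_add', le_div_iff₀ hτ]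
      nlinarith [sq_nonneg (relErr S P N φ ω - τ), sq_nonneg (relErr S P N φ ω)]
    have h6 : 0 ≤ relErr S P N φ ω := frob_nonneg _
    have h7 : relErr S P N φ ω * (dirA x ⬝ᵥ (fisherInfo S P N φ *ᵥ dirA x))
        ≤ (τ + relErr S P N φ ω ^ 2 / τ) * (4 * q) :=
      mul_le_mul h5 h3 (form_nonneg hBφ _) (h6.trans h5)
    have h8 := abs_sub_le (logisticForm (S.C N ω) φ.alpha x x)
      (dirA x ⬝ᵥ (fisherInfo S P N φ *ᵥ dirA x)) q
    have h9 : (τ + relErr S P N φ ω ^ 2 / τ) * (4 * q)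
        = 4 * τ * q + 4 * q / τ * relErr S P N φ ω ^ 2 := by ring
    linarith
  have hc1 : 0 ≤ 3 * f * q + 4 * τ * q := by positivity
  have hc2 : 0 ≤ 4 * q / τ := by positivity
  calc _ ≤ ∫⁻ ω, (ENNReal.ofReal (3 * f * q + 4 * τ * q)
        + ENNReal.ofReal (4 * q / τ) * ENNReal.ofReal (relErr S P N φ ω ^ 2)) ∂P := by
        refine lintegral_mono fun ω => ?_
        rw [← ENNReal.ofReal_mul hc2, ← ENNReal.ofReal_add hc1 (mul_nonneg hc2 (sq_nonneg _))]
        exact ENNReal.ofReal_le_ofReal (hpt ω)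
    _ ≤ ENNReal.ofReal (3 * f * q + 4 * τ * q)
        + ENNReal.ofReal (4 * q / τ) * ENNReal.ofReal (τ ^ 2) := by
        rw [lintegral_add_left measurable_const, lintegral_const_mul' _ _ ENNReal.ofReal_ne_top,
          lintegral_const, measure_univ, mul_one]
        gcongr
    _ = _ := by
        rw [← ENNReal.ofReal_mul hc2, ← ENNReal.ofReal_add hc1 (by positivity)]
        congr 1
        field_simp
        ring

theorem exists_eventually_exposure_bound (hS : S.Valid P)
    (hvar : ∀ φ ∈ Θ, 0 < φ.varY ∧ 0 < φ.varBY ∧ 0 < φ.varM ∧ 0 < φ.varBM)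
    (hφ₀ : φ₀ ∈ interior Θ) (hG : InfoGrowth S P Θ) (hSt : InfoStability S P Θ)
    (hF : FisherSmooth S P Θ) {δ : ℝ} (hδ : 0 < δ) :
    ∃ K : ℝ, 0 ≤ K ∧ ∀ᶠ N in atTop,
      P {ω | ¬ ∀ x, logisticScore (S.C N ω) (S.exposure N φ₀ ω) φ₀.alpha x
        - logisticBregman (S.C N ω) φ₀.alpha x ≤ K} ≤ ENNReal.ofReal δ := by
  obtain ⟨K, R, ε, hK, hR, hε, hmain⟩ := exists_logistic_sup_bound p hδ
  refine ⟨K, hK, ?_⟩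
  have hφ₀Θ : φ₀ ∈ Θ := interior_subset hφ₀
  obtain ⟨ρ, hρ, hball⟩ := Metric.isOpen_iff.mp isOpen_interior φ₀ hφ₀
  set f : ℝ := min 1 (ε / 6) with hf
  have hf0 : 0 < f := lt_min one_pos (by positivity)
  have hfε : 3 * f ≤ ε / 2 := by
    have : f ≤ ε / 6 := min_le_right _ _
    linarith
  set τ : ℝ := ε / 16 with hτ
  have hτ0 : 0 < τ := by positivity
  filter_upwards [hG.integrable, hG.posDef,
    hG.eventually_frob_inv_le (by positivity : 0 < (ρ / 2) ^ 2 / R),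
    hF.eventually_frob_le (by positivity : 0 < Real.sqrt R + 1) hf0,
    eventually_le_of_tendsto_iSup hSt (by positivity : 0 < τ ^ 2)] with N hint hpd hinv hsm hst
  set B := fisherInfo S P N φ₀ with hB
  have hBpd : B.PosDef := hpd φ₀ hφ₀Θ
  set ι : Fin p → Idx p := fun k => Sum.inr (Sum.inr k) with hι
  have hinj : Function.Injective ι := Sum.inr_injective.comp Sum.inr_injective
  have hform : ∀ x : Fin p → ℝ, x ⬝ᵥ (B.submatrix ι ι *ᵥ x) = dirA x ⬝ᵥ (B *ᵥ dirA x) := fun x => by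
    refine dotProduct_submatrix_mulVec B hinj (u := dirA x) fun k hk => ?_
    rcases k with k | k | k
    · rfl
    · rfl
    · exact absurd ⟨k, rfl⟩ hk
  refine hmain P (hS.meas_C N) (A := S.exposure N φ₀)
    ((measurable_exposureOf φ₀.alpha).comp ((hS.meas_C N).prodMk (hS.meas_U N))) φ₀.alpha
    (hBpd.submatrix hinj) (fun x hx t ht => ?_) fun x => ?_
  · rw [hform] at hx ⊢
    set φ : Param p := φ₀ + t • dirA x with hφ
    have hdiff : φ₀ - φ = -(t • dirA x) := by rw [hφ]; abel
    have ht2 : t ^ 2 ≤ 1 := by nlinarith [ht.1, ht.2]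
    have hq0 := form_nonneg hBpd (dirA x)
    -- The conditions hold only on `Θ`. A direction of bounded information is short because `B⁻¹` is
    -- small, so the segment from the interior point `φ₀` stays in a ball inside `Θ`.
    have hφΘ : φ ∈ Θ := by
      refine interior_subset (hball ?_)
      rw [Metric.mem_ball, dist_eq_norm, hφ, add_sub_cancel_left]
      refine lt_of_le_of_lt ((pi_norm_le_iff_of_nonneg (by positivity : 0 ≤ ρ / 2)).mpr fun k => ?_)
        (half_lt_self hρ)
      have h1 := dotProduct_self_le_frob_inv hBpd (dirA x)
      have h2 : dirA x k ^ 2 ≤ dirA x ⬝ᵥ dirA x := by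
        rw [dotProduct, sq]
        exact Finset.single_le_sum (f := fun k => dirA x k * dirA x k)
          (fun i _ => mul_self_nonneg _) (Finset.mem_univ k)
      have h3 : frob B⁻¹ * (dirA x ⬝ᵥ (B *ᵥ dirA x)) ≤ (ρ / 2) ^ 2 / R * R :=
        mul_le_mul (hinv φ₀ hφ₀Θ) hx hq0 (by positivity)
      rw [div_mul_cancel₀ _ hR.ne'] at h3
      rw [Real.norm_eq_abs, Pi.smul_apply, smul_eq_mul]
      refine abs_le_of_sq_le_sq ?_ (by positivity)
      rw [mul_pow]
      nlinarith [mul_le_mul_of_nonneg_right ht2 (sq_nonneg (dirA x k))]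
    have heu : eucl ((msqrt B)ᵀ *ᵥ (φ₀ - φ)) ≤ Real.sqrt R + 1 := by
      refine le_trans (Real.sqrt_le_sqrt ?_) (le_add_of_nonneg_right zero_le_one)
      rw [msqrt_transpose, msqrt_sq_form hBpd, hdiff, mulVec_neg, neg_dotProduct, dotProduct_neg,
        neg_neg, mulVec_smul, smul_dotProduct, dotProduct_smul, smul_eq_mul, smul_eq_mul]
      nlinarith [mul_le_mul_of_nonneg_right ht2 hq0]
    have halpha : φ.alpha = φ₀.alpha + t • x := rfl
    rw [← halpha]
    refine (lintegral_logisticForm_sub_le (hvar φ hφΘ) hBpd (hpd φ hφΘ) hτ0 hf0 (min_le_left _ _)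
      (hsm φ₀ hφ₀Θ φ hφΘ heu) (hst φ hφΘ) x).trans (ENNReal.ofReal_le_ofReal ?_)
    refine mul_le_mul_of_nonneg_right ?_ hq0
    rw [hτ]
    linarith
  · rw [hform, hS.lintegral_score N φ₀ x]
    exact (lintegral_eq_fisherInfo_form (hint φ₀ hφ₀Θ) (dirA x)
      (fun ω => obsInfo_dirA _ _ (hvar φ₀ hφ₀Θ) x) fun ω => logisticForm_nonneg _ _ _).2.le

/-! ### Control of the maximum likelihood estimator -/

/-- Four sources of failure, each of probability at most `δ`: the relative error of the information
at `φ₀`, the exposure ratio, and the noise of the two mixed equations. -/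
theorem exists_eventually_goodEvent (hS : S.Valid P)
    (hvar : ∀ φ ∈ Θ, 0 < φ.varY ∧ 0 < φ.varBY ∧ 0 < φ.varM ∧ 0 < φ.varBM)
    (hφ₀ : φ₀ ∈ interior Θ) (hG : InfoGrowth S P Θ) (hSt : InfoStability S P Θ)
    (hF : FisherSmooth S P Θ) {m M : ℝ} (hm : 0 < m) (h₀ : VarMem m M φ₀) {δ : ℝ} (hδ : 0 < δ) :
    ∃ K K' : ℝ, 0 ≤ K ∧ 0 ≤ K' ∧ ∀ᶠ N in atTop,
      P {ω | ¬ GoodEvent S N φ₀ (fisherInfo S P N φ₀) m M K K' ω} ≤ ENNReal.ofReal (4 * δ) := by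
  obtain ⟨K', hK', hexp⟩ := exists_eventually_exposure_bound hS hvar hφ₀ hG hSt hF hδ
  have hφ₀Θ : φ₀ ∈ Θ := interior_subset hφ₀
  set c := max (noiseConst (Fintype.card (YIdx p)) m M) (noiseConst (Fintype.card (MIdx p)) m M)
  set K := max (c / δ) 1 with hK
  have hK1 : 1 ≤ K := le_max_right _ _
  have hK0 : 0 < K := by linarith
  have hcK : ∀ {x : ℝ}, x ≤ c → x / K ≤ δ := fun {x} hx => by
    rw [div_le_iff₀ hK0, ← div_le_iff₀' hδ]
    exact (div_le_div_of_nonneg_right hx hδ.le).trans (le_max_left _ _)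
  refine ⟨K, K', hK0.le, hK', ?_⟩
  filter_upwards [hexp, hG.integrable, hG.posDef, hG.eventually_form_ge zero_lt_one,
    hSt.eventually_measure_le hG (by norm_num : (0 : ℝ) < 1 / 100) hδ] with N h1 hint hpd hform h2
  have h3 := (measure_not_noiseY_le hS (hint φ₀ hφ₀Θ) (hpd φ₀ hφ₀Θ) hm h₀ (hform φ₀ hφ₀Θ)
    hK0).trans (ENNReal.ofReal_le_ofReal (hcK (le_max_left _ _)))
  have h4 := (measure_not_noiseM_le hS (hint φ₀ hφ₀Θ) (hpd φ₀ hφ₀Θ) hm h₀ (hform φ₀ hφ₀Θ)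
    hK0).trans (ENNReal.ofReal_le_ofReal (hcK (le_max_right _ _)))
  have h5 : ENNReal.ofReal (4 * δ)
      = (ENNReal.ofReal δ + ENNReal.ofReal δ) + (ENNReal.ofReal δ + ENNReal.ofReal δ) := by
    rw [← ENNReal.ofReal_add hδ.le hδ.le, ← ENNReal.ofReal_add (by positivity) (by positivity)]
    congr 1
    ring
  rw [h5]
  refine le_trans (measure_mono (t := (_ ∪ _) ∪ (_ ∪ _)) fun ω hω => ?_)
    ((measure_union_le _ _).trans (add_le_add
      ((measure_union_le _ _).trans (add_le_add (h2 φ₀ hφ₀Θ) h1))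
      ((measure_union_le _ _).trans (add_le_add h3 h4))))
  by_contra hnot
  simp only [Set.mem_union, not_or, Set.mem_ofPred_eq, not_not, not_lt] at hnot hω
  obtain ⟨⟨g1, g2⟩, g3, g4⟩ := hnot
  have hcl := infoClose_of_relErr_le hS (hint φ₀ hφ₀Θ) (h₀.pos hm) (hpd φ₀ hφ₀Θ) g1
  exact hω ⟨hcl.1, hcl.2, g3, g4, g2⟩

end Events

end RENSEM

/-! ### Constants from compactness and the final argument -/

namespace RENSEM

variable {p : ℕ}

theorem exists_forall_abs_le {Θ : Set (Param p)} (hΘ : IsCompact Θ) :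
    ∃ K : ℝ, 1 ≤ K ∧ ∀ φ ∈ Θ, ∀ k, |φ k| ≤ K := by
  obtain ⟨K, hK⟩ := hΘ.isBounded.exists_norm_le
  exact ⟨max K 1, le_max_right _ _, fun φ hφ k =>
    (norm_le_pi_norm φ k).trans ((hK φ hφ).trans (le_max_left _ _))⟩

theorem exists_varMem {Θ : Set (Param p)} (hΘ : IsCompact Θ) (hne : Θ.Nonempty)
    (hvar : ∀ φ ∈ Θ, 0 < φ.varY ∧ 0 < φ.varBY ∧ 0 < φ.varM ∧ 0 < φ.varBM) :
    ∃ m M : ℝ, 0 < m ∧ ∀ φ ∈ Θ, VarMem m M φ := by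
  obtain ⟨M, -, hM⟩ := exists_forall_abs_le hΘ
  have hcont : Continuous fun φ : Param p => min (min φ.varY φ.varBY) (min φ.varM φ.varBM) := by
    unfold Param.varY Param.varBY Param.varM Param.varBM
    fun_prop
  obtain ⟨φ₁, hφ₁, hmin⟩ := hΘ.exists_isMinOn hne hcont.continuousOn
  obtain ⟨h1, h2, h3, h4⟩ := hvar φ₁ hφ₁
  refine ⟨_, M, lt_min (lt_min h1 h2) (lt_min h3 h4), fun φ hφ => ?_⟩
  have hle := isMinOn_iff.mp hmin φ hφ
  rw [le_min_iff, le_min_iff, le_min_iff] at hle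
  have hb := fun k => (le_abs_self _).trans (hM φ hφ k)
  exact ⟨⟨⟨hle.1.1, hb _⟩, hle.1.2, hb _⟩, ⟨hle.2.1, hb _⟩, hle.2.2, hb _⟩

end RENSEM

theorem mainTheorem6 {p : ℕ} {Ω : Type*} [MeasurableSpace Ω] (P : Measure Ω)
    [IsProbabilityMeasure P] (S : RENSEM.System p Ω) (hS : S.Valid P)
    (Θ : Set (RENSEM.Param p)) (hΘ : IsCompact Θ)
    (hvar : ∀ φ ∈ Θ, 0 < φ.varY ∧ 0 < φ.varBY ∧ 0 < φ.varM ∧ 0 < φ.varBM)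
    (φ₀ : RENSEM.Param p) (hφ₀ : φ₀ ∈ interior Θ)
    (hgrowth : RENSEM.InfoGrowth S P Θ) (hstab : RENSEM.InfoStability S P Θ)
    (hfisher : RENSEM.FisherSmooth S P Θ) (hinfo : RENSEM.InfoSmooth S P Θ)
    (φhat : ℕ → Ω → RENSEM.Param p)
    (hmle : ∀ N ω, φhat N ω ∈ Θ ∧
      IsMaxOn (RENSEM.logLik (S.E N) (S.data N φ₀ ω)) Θ (φhat N ω))
    (hpos : Tendsto (fun N : ℕ => P {ω |
      ¬ ((RENSEM.obsInfo (S.E N) (S.data N φ₀ ω) φ₀).PosDef ∧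
        (RENSEM.obsInfo (S.E N) (S.data N φ₀ ω) (φhat N ω)).PosDef)}) atTop (𝓝 0))
    (a a' s s' : ℝ) (ha : a = 0 ∨ a = 1) (ha' : a' = 0 ∨ a' = 1)
    (hs : s ∈ Set.Icc (0 : ℝ) 1) (hs' : s' ∈ Set.Icc (0 : ℝ) 1) (k : Fin 6) :
    (∀ N ω, IsUnit (RENSEM.obsInfo (S.E N) (S.data N φ₀ ω) (φhat N ω)).det →
      RENSEM.sandwich (RENSEM.estimand (S.E N) a a' s s' k)
          (RENSEM.obsInfo (S.E N) (S.data N φ₀ ω) (φhat N ω))⁻¹ (φhat N ω) =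
        RENSEM.varEstimator (S.E N) a a' s s'
          (RENSEM.obsInfo (S.E N) (S.data N φ₀ ω) (φhat N ω))⁻¹ (φhat N ω) k) ∧
    TendstoInMeasure P (fun N ω =>
      RENSEM.varEstimator (S.E N) a a' s s'
          (RENSEM.obsInfo (S.E N) (S.data N φ₀ ω) (φhat N ω))⁻¹ (φhat N ω) k
        - RENSEM.sandwich (RENSEM.estimand (S.E N) a a' s s' k)
            (RENSEM.fisherInfo S P N φ₀)⁻¹ φ₀)
      atTop (fun _ => 0) := by
  have hφ₀Θ : φ₀ ∈ Θ := interior_subset hφ₀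
  refine ⟨fun N ω _ => RENSEM.sandwich_estimand _ _ _ _ _
    (RENSEM.obsInfo_isSplit _ _ (hvar _ (hmle N ω).1)).inv _ _, ?_⟩
  obtain ⟨m, M, hm, hmem⟩ := RENSEM.exists_varMem hΘ ⟨φ₀, hφ₀Θ⟩ hvar
  obtain ⟨Kφ, hKφ, hbd⟩ := RENSEM.exists_forall_abs_le hΘ
  rw [tendstoInMeasure_iff_norm]
  intro ε hε
  rw [ENNReal.tendsto_nhds_zero]
  intro η hη
  -- `4 δ` is spent on the good event and `δ` on positive definiteness of the observed information.
  obtain ⟨δ, hδ, hδη⟩ : ∃ δ : ℝ, 0 < δ ∧ ENNReal.ofReal (5 * δ) ≤ η := by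
    obtain ⟨r, hr0, hrη⟩ := ENNReal.lt_iff_exists_nnreal_btwn.mp hη
    refine ⟨r / 5, by simpa using hr0, ?_⟩
    rw [mul_div_cancel₀ _ (by norm_num : (5 : ℝ) ≠ 0), ENNReal.ofReal_coe_nnreal]
    exact hrη.le
  obtain ⟨K, K', hK, hK', hgood⟩ := RENSEM.exists_eventually_goodEvent hS hvar hφ₀ hgrowth hstab
    hfisher hm (hmem φ₀ hφ₀Θ) hδ
  -- The first entry is the threshold for stability of the information within the radius of the
  -- maximizer. The second makes the sum `30 Kφ² / Λ` of the two variance bounds smaller than `ε`.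
  set Λ : ℝ := max (10000 * ((M / m) ^ 2 + 1) * (RENSEM.mleRadius m M K K' / m ^ 2))
    (40 * Kφ ^ 2 / ε) with hΛ
  have hΛ0 : 0 < Λ := lt_of_lt_of_le (by positivity) (le_max_right _ _)
  have hsmall : 10 * Kφ ^ 2 * (2 / Λ) + 10 * Kφ ^ 2 * (1 / Λ) < ε := by
    have h1 : 40 * Kφ ^ 2 / ε ≤ Λ := le_max_right _ _
    rw [div_le_iff₀ hε] at h1
    have h2 : 10 * Kφ ^ 2 * (2 / Λ) + 10 * Kφ ^ 2 * (1 / Λ) = 30 * Kφ ^ 2 / Λ := by ring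
    rw [h2, div_lt_iff₀ hΛ0]
    nlinarith [sq_nonneg Kφ]
  -- `K`, `K'` and hence `Λ` are fixed before `N`, so the information eventually exceeds `Λ`. The
  -- restriction `N ≥ 2` provides positive degrees.
  filter_upwards [hgood, hpos.eventually_le_const (by simpa using hδ : (0 : ENNReal) <
      ENNReal.ofReal δ), hgrowth.integrable, hgrowth.eventually_form_ge hΛ0,
    hgrowth.eventually_frob_inv_le (by positivity : 0 < 1 / Λ), eventually_ge_atTop 2]
    with N h1 h2 hint hform hinv hN
  have hE := hS.adjacency N
  have hdeg := hS.connected N hN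
  have hvar₀ := hvar φ₀ hφ₀Θ
  -- The target variance is itself negligible, so it suffices to bound the two terms of the
  -- difference separately.
  have hB : |RENSEM.sandwich (RENSEM.estimand (S.E N) a a' s s' k)
      (RENSEM.fisherInfo S P N φ₀)⁻¹ φ₀| ≤ 10 * Kφ ^ 2 * (1 / Λ) := by
    rw [RENSEM.sandwich_estimand _ _ _ _ _ (RENSEM.fisherInfo_isSplit hvar₀).inv]
    have hentry := fun k l => (RENSEM.abs_apply_le_frob (RENSEM.fisherInfo S P N φ₀)⁻¹ k l).trans
      (hinv φ₀ hφ₀Θ)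
    exact RENSEM.abs_varEstimator_le hE hdeg ha ha' hs hs' hKφ (hbd φ₀ hφ₀Θ)
      (fun _ => hentry _ _) (fun _ _ => hentry _ _) k
  refine le_trans ((measure_mono (t := _ ∪ _) fun ω hω => ?_).trans
    ((measure_union_le _ _).trans (add_le_add h1 h2))) ?_
  · by_contra hnot
    simp only [Set.mem_union, not_or, Set.mem_ofPred_eq, not_not, sub_zero, Real.norm_eq_abs]
      at hnot hω
    obtain ⟨hG, -, hJ⟩ := hnot
    obtain ⟨hφ, hmax⟩ := hmle N ω
    obtain ⟨hb, hg⟩ := hG.abs_inv_le hm (hmem φ₀ hφ₀Θ) (hmem _ hφ) hK hK'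
      (isMaxOn_iff.mp hmax φ₀ hφ₀Θ) hJ hΛ0 (le_max_left _ _) (hform φ₀ hφ₀Θ)
      (RENSEM.fisherInfo_dirY hS (hint φ₀ hφ₀Θ) hvar₀)
      (RENSEM.fisherInfo_dirM hS (hint φ₀ hφ₀Θ) hvar₀)
    have hV := RENSEM.abs_varEstimator_le hE hdeg ha ha' hs hs' hKφ (hbd _ hφ) hb hg k
    have := abs_sub (RENSEM.varEstimator (S.E N) a a' s s'
      (RENSEM.obsInfo (S.E N) (S.data N φ₀ ω) (φhat N ω))⁻¹ (φhat N ω) k)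
      (RENSEM.sandwich (RENSEM.estimand (S.E N) a a' s s' k) (RENSEM.fisherInfo S P N φ₀)⁻¹ φ₀)
    linarith
  · rw [← ENNReal.ofReal_add (by positivity) hδ.le]
    refine le_trans (le_of_eq ?_) hδη
    congr 1
    ring
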